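/- Let $p>2$ be a prime, $q=p^2$, $\mathbb{Q}_q=\mathbb{Q}_{p^2}$ the unramified quadratic extension of $\mathbb{Q}_p$ with ring of integers $\mathbb{Z}_q$ and Frobenius $\mathrm{Fr}$, and fix an embedding $\mathbb{Z}_q\hookrightarrow\bar{\mathbb{Z}}_p$. Let $G=\mathrm{GL}_2(\mathbb{Q}_q)$, $K=\mathrm{GL}_2(\mathbb{Z}_q)$, and let $Z=\mathbb{Q}_q^\times$ be the centre of $G$. For a $\mathbb{Z}_q$-algebra $R$ and $r_0,r_1\ge 0$ let $\mathrm{Sym}^{r_0}R^2\otimes \mathrm{Sym}^{r_1}R^2$ be the space of polynomials over $R$ in $X_0,Y_0,X_1,Y_1$ that are homogeneous of degree $r_i$ in $X_i,Y_i$ for $i=0,1$; a matrix $\begin{pmatrix}a&b\\c&d\end{pmatrix}\in K$ acts by $X_i\mapsto a^{\mathrm{Fr}^i}X_i+c^{\mathrm{Fr}^i}Y_i$, $Y_i\mapsto b^{\mathrm{Fr}^i}X_i+d^{\mathrm{Fr}^i}Y_i$, and $p\in Z$ acts trivially. Let $T$ be the Hecke operator on the compact induction $\mathrm{ind}_{KZ}^G(\mathrm{Sym}^{r_0}R^2\otimes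 \mathrm{Sym}^{r_1}R^2)$ attached to the function $\varphi$ on $G$ with values in $\mathrm{End}_R(\mathrm{Sym}^{r_0}R^2\otimes \mathrm{Sym}^{r_1}R^2)$ that is supported on $KZ\alpha^{-1}KZ$, $\alpha=\begin{pmatrix}1&0\\0&p\end{pmatrix}$, and satisfies $\varphi(h_1gh_2)=h_1\circ\varphi(g)\circ h_2$ for $h_1,h_2\in KZ$ and $\varphi(\alpha^{-1})v(X_i,Y_i)=v(pX_i,Y_i)$; that is, $(T\phi)(g)=\sum_{u\in KZ\alpha^{-1}KZ/KZ}\varphi(u)\,\phi(u^{-1}g)$. For $a_p\in\bar{\mathbb{Z}}_p$ and $k=(k_0,k_1)$ with $k_i=r_i+2$ put $$\Pi_{k,a_p}=\frac{\mathrm{ind}_{KZ}^G(\mathrm{Sym}^{r_0}\bar{\mathbb{Q}}_p^2\otimes \mathrm{Sym}^{r_1}\bar{\mathbb{Q}}_p^2)}{(T-a_p)},$$ let $\Theta_{k,a_p}$ be the image of $\mathrm{ind}_{KZ}^G(\mathrm{Sym}^{r_0}\bar{\mathbb{Z}}_p^2\otimes \mathrm{Sym}^{r_1}\bar{\mathbb{Z}}_p^2)$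 in $\Pi_{k,a_p}$, and let $\bar\Theta_{k,a_p}=\Theta_{k,a_p}\otimes_{\bar{\mathbb{Z}}_p}\bar{\mathbb{F}}_p$. Call a representation of $G$ over $\bar{\mathbb{F}}_p$ supercuspidal if it is smooth, irreducible, and not isomorphic to a subquotient of $\mathrm{Ind}_B^G(\chi_1\otimes\chi_2)$ for any smooth characters $\chi_1,\chi_2:\mathbb{Q}_q^\times\to\bar{\mathbb{F}}_p^\times$, where $B$ is the subgroup of upper triangular matrices. Let $v$ be the $p$-adic valuation with $v(p)=1$. Put $r=r_0+pr_1$ and assume that $r_0,r_1>q+p-2$, that $v(a_p)\in(0,1)$, and that one of the following holds: * $r\equiv 0 \bmod (q-1)$; * $v(a_p)\in(\tfrac12,1)$ and at least one of the following is satisfied: * $r\equiv 1 \bmod (q-1)$, $p\nmid r_1$ and $p\mid r_0$; * $r\equiv c \bmod (q-1)$ for some $c\in\{2,3,\ldots,p-1\}$, and $p\nmid r_1$; * $r\equiv p \bmod (q-1)$, $p\nmid r_0$ and $p\mid r_1$; * $r\equiv cp \bmod (q-1)$ for some $c\in\{2,3,\ldots,p-1\}$, and $p\nmid r_0$. Then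 there is an at most two-step filtration $0\subseteq F\subseteq\bar\Theta_{k,a_p}$ by $G$-subrepresentations such that every irreducible quotient of $F$ and every irreducible quotient of $\bar\Theta_{k,a_p}/F$ is supercuspidal. -/

import Mathlib

open Matrix

set_option linter.unusedSectionVars false

noncomputable section

namespace GL2Red

section Group

variable (p : ℕ) [Fact p.Prime] (k : Type) [Field k] [CharP k p]

/-- `ℤ_q = W(k)`, the ring of integers of the unramified extension `ℚ_q` of `ℚ_p` whose residue
field is the finite field `k` with `q` elements. -/
abbrev Zq := WittVector p k

/-- `ℚ_q = Frac W(k)`. -/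
abbrev Qq := FractionRing (WittVector p k)

/-- `G = GL₂(ℚ_q)`. -/
abbrev GrpG := GL (Fin 2) (Qq p k)

/-- `K = GL₂(ℤ_q)`. -/
abbrev GrpK := GL (Fin 2) (Zq p k)

/-- The inclusion `K → G`. -/
def incl : GrpK p k →* GrpG p k := Matrix.GeneralLinearGroup.map (algebraMap (Zq p k) (Qq p k))

lemma natCast_p_ne_zero : (p : Zq p k) ≠ 0 := WittVector.p_nonzero p k

lemma algebraMap_p_ne_zero : algebraMap (Zq p k) (Qq p k) (p : Zq p k) ≠ 0 := by
  intro h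
  exact natCast_p_ne_zero p k ((map_eq_zero_iff _ (IsFractionRing.injective (Zq p k) (Qq p k))).mp h)

/-- An integral matrix with nonzero determinant, as an element of `G`. -/
def ofInt (m : Matrix (Fin 2) (Fin 2) (Zq p k)) (h : m.det ≠ 0) : GrpG p k :=
  Matrix.GeneralLinearGroup.mkOfDetNeZero (m.map (algebraMap (Zq p k) (Qq p k))) (by
    have := RingHom.map_det (algebraMap (Zq p k) (Qq p k)) m
    rw [RingHom.mapMatrix_apply] at this
    rw [← this]
    simpa using h)

/-- The scalar matrix `p ∈ Z ⊂ G`. Note that `KZ = p^ℤ K`. -/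
def scalarP : GrpG p k :=
  ofInt p k !![(p : Zq p k), 0; 0, (p : Zq p k)] (by
    simpa [Matrix.det_fin_two] using natCast_p_ne_zero p k)

/-- The principal congruence subgroup condition: `u ∈ K` and `u ≡ 1 mod p^n`. The images in `G` of
these groups form a basis of neighbourhoods of `1`. -/
def CongrOne (n : ℕ) (u : GrpK p k) : Prop :=
  ∀ i j, (p : Zq p k) ^ n ∣ (u : Matrix (Fin 2) (Fin 2) (Zq p k)) i j
    - (1 : Matrix (Fin 2) (Fin 2) (Zq p k)) i j

end Group

section Sym

variable {p : ℕ} [Fact p.Prime] {k : Type} [Field k] [CharP k p]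
variable {R : Type} [CommRing R] {f : ℕ}

/-- The multidegree: `X_i` and `Y_i` have degree `1` in the `i`-th direction. The variable `X_i` is
`(i, 0)` and the variable `Y_i` is `(i, 1)`. -/
def multiDeg (f : ℕ) : Fin f × Fin 2 → (Fin f → ℕ) := fun v => Pi.single v.1 1

variable (R) in
/-- `⊗_i Sym^{r_i} R²`: polynomials over `R` in `X_0, Y_0, …, X_{f-1}, Y_{f-1}` that are
homogeneous of degree `r_i` in `X_i, Y_i` for each `i`. -/
abbrev symSubmodule (r : Fin f → ℕ) : Submodule R (MvPolynomial (Fin f × Fin 2) R) :=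
  MvPolynomial.weightedHomogeneousSubmodule R (multiDeg f) r

variable (R) in
/-- `⊗_i Sym^{r_i} R²` as a type. -/
def SymV (r : Fin f → ℕ) : Type := symSubmodule R r

instance (r : Fin f → ℕ) : AddCommGroup (SymV R r) :=
  inferInstanceAs (AddCommGroup (symSubmodule R r))

instance (r : Fin f → ℕ) : Module R (SymV R r) :=
  inferInstanceAs (Module R (symSubmodule R r))


/-- The substitution `X_i ↦ a^{Fr^i} X_i + c^{Fr^i} Y_i`, `Y_i ↦ b^{Fr^i} X_i + d^{Fr^i} Y_i`
attached to a matrix `(a b; c d)` over `ℤ_q` and a `ℤ_q`-algebra `ι : ℤ_q → R`. -/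
def substHom (ι : Zq p k →+* R) (f : ℕ) (m : Matrix (Fin 2) (Fin 2) (Zq p k)) :
    MvPolynomial (Fin f × Fin 2) R →ₐ[R] MvPolynomial (Fin f × Fin 2) R :=
  MvPolynomial.aeval fun v =>
    ∑ l : Fin 2, MvPolynomial.C (ι (((WittVector.frobenius : Zq p k →+* Zq p k) ^ v.1.val) (m l v.2)))
      * MvPolynomial.X (v.1, l)

lemma substHom_one (ι : Zq p k →+* R) : substHom ι f 1 = AlgHom.id R _ := by
  ext v
  obtain ⟨i, j⟩ := v
  fin_cases j <;> simp [substHom]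

lemma substHom_mul (ι : Zq p k →+* R) (m n : Matrix (Fin 2) (Fin 2) (Zq p k)) :
    substHom ι f (m * n) = (substHom ι f m).comp (substHom ι f n) := by
  ext1 v
  obtain ⟨i, j⟩ := v
  simp only [substHom, MvPolynomial.aeval_X, AlgHom.comp_apply,
    Fin.sum_univ_two, Matrix.mul_apply, map_add, map_mul, MvPolynomial.algHom_C,
    MvPolynomial.algebraMap_eq]
  ring

lemma substHom_mem (ι : Zq p k →+* R) (r : Fin f → ℕ) (m : Matrix (Fin 2) (Fin 2) (Zq p k))
    {P : MvPolynomial (Fin f × Fin 2) R} (hP : P ∈ symSubmodule R r) :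
    substHom ι f m P ∈ symSubmodule R r := by
  rw [P.as_sum, map_sum]
  refine Submodule.sum_mem _ fun d hd => ?_
  have hd' : Finsupp.weight (multiDeg f) d = r := hP (MvPolynomial.mem_support_iff.mp hd)
  rw [substHom, MvPolynomial.aeval_monomial, MvPolynomial.algebraMap_eq]
  refine MvPolynomial.IsWeightedHomogeneous.C_mul ?_ _
  rw [← hd', Finsupp.weight_apply]
  refine MvPolynomial.IsWeightedHomogeneous.prod _ _ _ fun v _ => ?_
  refine MvPolynomial.IsWeightedHomogeneous.pow ?_ _
  refine MvPolynomial.IsWeightedHomogeneous.sum _ _ _ fun l _ => ?_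
  refine MvPolynomial.IsWeightedHomogeneous.C_mul ?_ _
  exact MvPolynomial.isWeightedHomogeneous_X R (multiDeg f) (v.1, l)

/-- The action of the monoid `M₂(ℤ_q)` on `⊗_i Sym^{r_i} R²` by substitution; it restricts to the
usual action of `K`. -/
def symRep (ι : Zq p k →+* R) (r : Fin f → ℕ) :
    Representation R (Matrix (Fin 2) (Fin 2) (Zq p k)) (SymV R r) where
  toFun m := (substHom ι f m).toLinearMap.restrict fun _ hP => substHom_mem ι r m hP
  map_one' := by
    ext1 P
    apply Subtype.ext
    change substHom ι f 1 P.1 = P.1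
    rw [substHom_one]
    rfl
  map_mul' m n := by
    ext1 P
    apply Subtype.ext
    change substHom ι f (m * n) P.1 = substHom ι f m (substHom ι f n P.1)
    rw [substHom_mul]
    rfl

end Sym

section Hecke

variable {p : ℕ} [Fact p.Prime] {k : Type} [Field k] [CharP k p]

/-- Right translation of `M`-valued functions on a group, `(h · φ)(g) = φ(g h)`. -/
def transRep (R G M : Type) [CommRing R] [Group G] [AddCommGroup M] [Module R M] :
    Representation R G (G → M) where
  toFun h := LinearMap.funLeft R M (· * h)
  map_one' := by
    ext φ g
    simp [LinearMap.funLeft_apply]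
  map_mul' h h' := by
    ext φ g
    simp [LinearMap.funLeft_apply, mul_assoc]

@[simp] lemma transRep_apply {R G M : Type} [CommRing R] [Group G] [AddCommGroup M] [Module R M]
    (h : G) (φ : G → M) (g : G) : transRep R G M h φ g = φ (g * h) := rfl

section CInd

variable {R : Type} [CommRing R] {f : ℕ} (ι : Zq p k →+* R) (r : Fin f → ℕ)

/-- The compact induction `ind_{KZ}^G (⊗_i Sym^{r_i} R²)`: functions `φ` on `G` with
`φ(h g) = h · φ(g)` for `h ∈ KZ` (where `K` acts by substitution and `p ∈ Z` acts trivially), whose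
support is contained in finitely many cosets `KZ s`. -/
def cInd : Submodule R (GrpG p k → SymV R r) where
  carrier := {φ | (∀ (u : GrpK p k) (g : GrpG p k),
      φ (incl p k u * g) = symRep ι r (u : Matrix (Fin 2) (Fin 2) (Zq p k)) (φ g)) ∧
    (∀ g : GrpG p k, φ (scalarP p k * g) = φ g) ∧
    ∃ S : Finset (GrpG p k), ∀ g, φ g ≠ 0 →
      ∃ s ∈ S, ∃ (n : ℤ) (u : GrpK p k), g = scalarP p k ^ n * incl p k u * s}
  zero_mem' := ⟨by simp, by simp, ∅, by simp⟩
  add_mem' := by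
    classical
    rintro φ ψ ⟨h1, h2, S, hS⟩ ⟨h1', h2', S', hS'⟩
    refine ⟨fun u g => by simp [h1, h1'], fun g => by simp [h2, h2'], S ∪ S', fun g hg => ?_⟩
    by_cases h : φ g = 0
    · have h' : ψ g ≠ 0 := fun h' => hg (by simp [h, h'])
      obtain ⟨s, hs, n, u, hu⟩ := hS' g h'
      exact ⟨s, Finset.mem_union_right _ hs, n, u, hu⟩
    · obtain ⟨s, hs, n, u, hu⟩ := hS g h
      exact ⟨s, Finset.mem_union_left _ hs, n, u, hu⟩
  smul_mem' := by
    rintro c φ ⟨h1, h2, S, hS⟩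
    refine ⟨fun u g => by simp [h1], fun g => by simp [h2], S, fun g hg => hS g fun h => hg ?_⟩
    simp [h]

/-- `G` acts on the compact induction by right translation. -/
def cIndRep : Representation R (GrpG p k) (cInd ι r) :=
  (transRep R (GrpG p k) (SymV R r)).subrepresentation (cInd ι r) (by
    rintro h φ ⟨h1, h2, S, hS⟩
    classical
    refine ⟨fun u g => by simp [mul_assoc, h1], fun g => by simp [mul_assoc, h2],
      S.image (· * h⁻¹), fun g hg => ?_⟩
    obtain ⟨s, hs, n, u, hu⟩ := hS (g * h) hg
    exact ⟨s * h⁻¹, Finset.mem_image_of_mem _ hs, n, u, by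
      rw [← mul_assoc, ← hu, mul_inv_cancel_right]⟩)

end CInd

section HeckeOp

variable [Finite k]

variable (p) in
/-- Representatives `u` of `KZ α⁻¹ KZ / KZ`, `α = (1 0; 0 p)`: the matrices `(p [λ]; 0 1)` for
`λ ∈ k`, with `[λ]` the Teichmüller lift, and the matrix `(1 0; 0 p)`. -/
def heckeMat : Option k → Matrix (Fin 2) (Fin 2) (Zq p k)
  | some lam => !![(p : Zq p k), WittVector.teichmuller p lam; 0, 1]
  | none => !![1, 0; 0, (p : Zq p k)]

lemma det_heckeMat (s : Option k) : (heckeMat p s).det = (p : Zq p k) := by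
  cases s <;> simp [heckeMat, Matrix.det_fin_two]

variable (p) in
/-- The same representatives as elements of `G`. -/
def heckeG (s : Option k) : GrpG p k :=
  ofInt p k (heckeMat p s) (by rw [det_heckeMat]; exact natCast_p_ne_zero p k)

lemma isUnit_iff_coeff (x : Zq p k) : IsUnit x ↔ x.coeff 0 ≠ 0 := by
  refine ⟨fun h h0 => ?_, WittVector.isUnit_of_coeff_zero_ne_zero x⟩
  have := h.map (WittVector.constantCoeff : Zq p k →+* k)
  rw [WittVector.constantCoeff_apply, h0] at this
  exact not_isUnit_zero this

lemma dvd_iff_coeff (x : Zq p k) : (p : Zq p k) ∣ x ↔ x.coeff 0 = 0 := by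
  rw [← Ideal.mem_span_singleton, WittVector.mem_span_p_iff_coeff_zero_eq_zero]

/-- Every integral matrix whose determinant has valuation one is `u * h` with `u` one of the
representatives and `h ∈ K`. -/
lemma exists_heckeMat_mul (m : Matrix (Fin 2) (Fin 2) (Zq p k)) (e : (Zq p k)ˣ)
    (hm : m.det = (p : Zq p k) * e) :
    ∃ (s : Option k) (h : GrpK p k), m = heckeMat p s * (h : Matrix (Fin 2) (Fin 2) (Zq p k)) := by
  have key : ∀ (s : Option k) (h : Matrix (Fin 2) (Fin 2) (Zq p k)), m = heckeMat p s * h →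
      ∃ (s : Option k) (h : GrpK p k),
        m = heckeMat p s * (h : Matrix (Fin 2) (Fin 2) (Zq p k)) := by
    intro s h hs
    have hdet : h.det = e := by
      have h1 : (p : Zq p k) * h.det = (p : Zq p k) * e := by
        rw [← hm, hs, Matrix.det_mul, det_heckeMat]
      exact mul_left_cancel₀ (natCast_p_ne_zero p k) h1
    refine ⟨s, Matrix.GeneralLinearGroup.mk'' h (hdet ▸ e.isUnit), hs⟩
  have hd0 : (m 0 0).coeff 0 * (m 1 1).coeff 0 = (m 0 1).coeff 0 * (m 1 0).coeff 0 := by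
    have h1 : (p : Zq p k) ∣ m 0 0 * m 1 1 - m 0 1 * m 1 0 := by
      rw [← Matrix.det_fin_two, hm]
      exact dvd_mul_right _ _
    rw [dvd_iff_coeff, ← WittVector.constantCoeff_apply, map_sub, map_mul, map_mul] at h1
    simpa [sub_eq_zero] using h1
  have hlam : ∀ lam : k, (m 0 0).coeff 0 = lam * (m 1 0).coeff 0 →
      (m 0 1).coeff 0 = lam * (m 1 1).coeff 0 → ∃ (s : Option k) (h : GrpK p k),
        m = heckeMat p s * (h : Matrix (Fin 2) (Fin 2) (Zq p k)) := by
    intro lam h0 h1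
    have d0 : (p : Zq p k) ∣ m 0 0 - WittVector.teichmuller p lam * m 1 0 := by
      rw [dvd_iff_coeff, ← WittVector.constantCoeff_apply, map_sub, map_mul]
      simp [h0]
    have d1 : (p : Zq p k) ∣ m 0 1 - WittVector.teichmuller p lam * m 1 1 := by
      rw [dvd_iff_coeff, ← WittVector.constantCoeff_apply, map_sub, map_mul]
      simp [h1]
    obtain ⟨x, hx⟩ := d0
    obtain ⟨y, hy⟩ := d1
    refine key (some lam) !![x, y; m 1 0, m 1 1] ?_
    ext i j
    fin_cases i <;> fin_cases j <;> simp [heckeMat, Matrix.mul_apply, ← hx, ← hy]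
  by_cases hc : (m 1 0).coeff 0 = 0
  · by_cases hd : (m 1 1).coeff 0 = 0
    · obtain ⟨x, hx⟩ := (dvd_iff_coeff _).mpr hc
      obtain ⟨y, hy⟩ := (dvd_iff_coeff _).mpr hd
      refine key none !![m 0 0, m 0 1; x, y] ?_
      ext i j
      fin_cases i <;> fin_cases j <;> simp [heckeMat, Matrix.mul_apply, hx, hy]
    · refine hlam ((m 0 1).coeff 0 / (m 1 1).coeff 0) ?_ ?_
      · have : (m 0 0).coeff 0 = 0 := by simpa [hc, hd] using hd0
        simp [this, hc]
      · field_simp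
  · refine hlam ((m 0 0).coeff 0 / (m 1 0).coeff 0) ?_ ?_
    · field_simp
    · field_simp
      rw [← hd0, mul_comm]

/-- The representatives lie in pairwise different cosets of `K`. -/
lemma heckeMat_injective (s t : Option k) (h : GrpK p k)
    (hs : heckeMat p s * (h : Matrix (Fin 2) (Fin 2) (Zq p k)) = heckeMat p t) : s = t := by
  have e := fun i j => congrFun (congrFun hs i) j
  have hp0 : ((p : Zq p k)).coeff 0 = 0 := (dvd_iff_coeff _).mp dvd_rfl
  have hpu : ¬ IsUnit (p : Zq p k) := by
    rw [isUnit_iff_coeff, not_not]; exact hp0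
  have hdet : IsUnit (h : Matrix (Fin 2) (Fin 2) (Zq p k)).det :=
    (Matrix.isUnit_iff_isUnit_det _).mp h.isUnit
  cases s with
  | none =>
    cases t with
    | none => rfl
    | some mu =>
      have := e 1 1
      simp [heckeMat, Matrix.mul_apply] at this
      exact absurd (IsUnit.of_mul_eq_one _ this) hpu
  | some lam =>
    have e10 := e 1 0
    have e11 := e 1 1
    have e01 := e 0 1
    cases t with
    | none =>
      simp [heckeMat, Matrix.mul_apply] at e10 e11
      rw [Matrix.det_fin_two, e10, e11, mul_zero, sub_zero] at hdet
      exact absurd (isUnit_of_mul_isUnit_right hdet) hpu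
    | some mu =>
      simp [heckeMat, Matrix.mul_apply] at e10 e11 e01
      rw [e11, mul_one] at e01
      have := congrArg (WittVector.constantCoeff : Zq p k →+* k) e01
      rw [map_add, map_mul, WittVector.constantCoeff_apply, hp0, zero_mul, zero_add] at this
      simp at this
      rw [this]

lemma coe_heckeG (s : Option k) : (heckeG p s : Matrix (Fin 2) (Fin 2) (Qq p k))
    = (heckeMat p s).map (algebraMap (Zq p k) (Qq p k)) := rfl

lemma coe_incl (u : GrpK p k) : (incl p k u : Matrix (Fin 2) (Fin 2) (Qq p k))
    = (u : Matrix (Fin 2) (Fin 2) (Zq p k)).map (algebraMap (Zq p k) (Qq p k)) := rfl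

lemma scalarP_mul (g : GrpG p k) : scalarP p k * g = g * scalarP p k := by
  apply Units.ext
  ext i j
  fin_cases i <;> fin_cases j <;>
    simp [scalarP, ofInt, Matrix.mul_apply, Matrix.GeneralLinearGroup.mkOfDetNeZero, mul_comm]

lemma scalarP_zpow_mul (n : ℤ) (g : GrpG p k) :
    scalarP p k ^ n * g = g * scalarP p k ^ n :=
  (Commute.zpow_left (scalarP_mul g : Commute (scalarP p k) g) n)

section Operator

variable {R : Type} [CommRing R] {f : ℕ} (ι : Zq p k →+* R) (r : Fin f → ℕ)

/-- The formula for the Hecke operator `T` attached to the function `Φ : G → End(⊗ Sym^{r_i} R²)`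
with support `KZ α⁻¹ KZ`, `Φ(h₁ g h₂) = h₁ ∘ Φ(g) ∘ h₂` for `h₁, h₂ ∈ KZ` and
`Φ(α⁻¹) : v(X_i, Y_i) ↦ v(p X_i, Y_i)`, namely
`(T φ)(g) = ∑_{u ∈ KZ α⁻¹ KZ / KZ} Φ(u) φ(u⁻¹ g)`; in terms of the elementary functions `[g, v]`
this says `T [g, v] = ∑_{y ∈ G / KZ} [g y, Φ(y⁻¹) v]`. As `p` acts trivially and
`p α⁻¹ = (p 0; 0 1)`, the operator `Φ(u)` attached to an integral matrix `u` whose determinant has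
valuation one is the substitution given by `u`. -/
def heckeFun (φ : GrpG p k → SymV R r) (g : GrpG p k) : SymV R r :=
  ∑ᶠ s : Option k, symRep ι r (heckeMat p s) (φ ((heckeG p s)⁻¹ * g))

lemma heckeFun_mem {φ : GrpG p k → SymV R r} (hφ : φ ∈ cInd ι r) :
    heckeFun ι r φ ∈ cInd ι r := by
  classical
  obtain ⟨h1, h2, S, hS⟩ := hφ
  refine ⟨fun u g => ?_, fun g => ?_, ?_⟩
  · have hex : ∀ s : Option k, ∃ (t : Option k) (h : GrpK p k),
        ((u⁻¹ : GrpK p k) : Matrix (Fin 2) (Fin 2) (Zq p k)) * heckeMat p s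
          = heckeMat p t * (h : Matrix (Fin 2) (Fin 2) (Zq p k)) := by
      intro s
      refine exists_heckeMat_mul _ (Matrix.GeneralLinearGroup.det u⁻¹) ?_
      rw [Matrix.det_mul, det_heckeMat, mul_comm]
      rfl
    choose σ h hσ using hex
    have hinj : Function.Injective σ := by
      intro s t hst
      have e1 := hσ s
      have e2 := hσ t
      refine heckeMat_injective s t ((h s)⁻¹ * h t) ?_
      have e3 : heckeMat p s = (u : Matrix (Fin 2) (Fin 2) (Zq p k)) * (heckeMat p (σ s) *
          (h s : Matrix (Fin 2) (Fin 2) (Zq p k))) := by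
        rw [← e1, ← mul_assoc, Units.mul_inv, one_mul]
      have e4 : heckeMat p t = (u : Matrix (Fin 2) (Fin 2) (Zq p k)) * (heckeMat p (σ t) *
          (h t : Matrix (Fin 2) (Fin 2) (Zq p k))) := by
        rw [← e2, ← mul_assoc, Units.mul_inv, one_mul]
      rw [e3, e4, hst, Units.val_mul]
      simp only [mul_assoc]
      rw [Units.mul_inv_cancel_left]
    have hbij : Function.Bijective σ := Finite.injective_iff_bijective.mp hinj
    rw [heckeFun, heckeFun, map_finsum _ (Set.toFinite _)]
    refine finsum_eq_of_bijective σ hbij fun s => ?_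
    have e3 : heckeMat p s = (u : Matrix (Fin 2) (Fin 2) (Zq p k)) * heckeMat p (σ s) *
        (h s : Matrix (Fin 2) (Fin 2) (Zq p k)) := by
      rw [mul_assoc, ← hσ s, ← mul_assoc, Units.mul_inv, one_mul]
    have e4 : heckeG p s = incl p k u * heckeG p (σ s) * incl p k (h s) := by
      apply Units.ext
      simp only [Units.val_mul, coe_heckeG, coe_incl, ← Matrix.map_mul, ← e3]
    have e5 : (heckeG p s)⁻¹ * (incl p k u * g)
        = incl p k (h s)⁻¹ * ((heckeG p (σ s))⁻¹ * g) := by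
      rw [e4, map_inv]
      group
    rw [e5, h1, e3, map_mul, map_mul, Module.End.mul_apply, Module.End.mul_apply,
      ← Module.End.mul_apply (symRep ι r (h s : Matrix (Fin 2) (Fin 2) (Zq p k))), ← map_mul,
      Units.mul_inv, map_one, Module.End.one_apply]
  · simp only [heckeFun]
    refine finsum_congr fun s => ?_
    rw [← mul_assoc, ← scalarP_mul, mul_assoc, h2]
  · let tG : Option k → GrpG p k := fun t =>
      ofInt p k (heckeMat p t)ᵀ (by
        rw [Matrix.det_transpose, det_heckeMat]; exact natCast_p_ne_zero p k)
    have hfin : ((fun x : GrpG p k × Option k => tG x.2 * x.1) ''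
        ((S : Set (GrpG p k)) ×ˢ (Set.univ : Set (Option k)))).Finite :=
      (S.finite_toSet.prod Set.finite_univ).image _
    refine ⟨hfin.toFinset, fun g hg => ?_⟩
    obtain ⟨s, hs⟩ : ∃ s : Option k, φ ((heckeG p s)⁻¹ * g) ≠ 0 := by
      by_contra hcon
      push Not at hcon
      exact hg (by simp [heckeFun, hcon])
    obtain ⟨x, hx, n, u, hu⟩ := hS _ hs
    obtain ⟨t, h, ht⟩ := exists_heckeMat_mul
      (heckeMat p s * (u : Matrix (Fin 2) (Fin 2) (Zq p k)))ᵀ (Matrix.GeneralLinearGroup.det u) (by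
        rw [Matrix.det_transpose, Matrix.det_mul, det_heckeMat]; rfl)
    have ht' : heckeMat p s * (u : Matrix (Fin 2) (Fin 2) (Zq p k))
        = (h : Matrix (Fin 2) (Fin 2) (Zq p k))ᵀ * (heckeMat p t)ᵀ := by
      rw [← Matrix.transpose_mul, ← ht, Matrix.transpose_transpose]
    let h' : GrpK p k := Matrix.GeneralLinearGroup.mk'' (h : Matrix (Fin 2) (Fin 2) (Zq p k))ᵀ (by
      rw [Matrix.det_transpose]
      exact (Matrix.isUnit_iff_isUnit_det _).mp h.isUnit)
    have e1 : heckeG p s * incl p k u = incl p k h' * tG t := by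
      apply Units.ext
      change (heckeMat p s).map (algebraMap (Zq p k) (Qq p k))
          * (u : Matrix (Fin 2) (Fin 2) (Zq p k)).map (algebraMap (Zq p k) (Qq p k))
        = (h : Matrix (Fin 2) (Fin 2) (Zq p k))ᵀ.map (algebraMap (Zq p k) (Qq p k))
          * (heckeMat p t)ᵀ.map (algebraMap (Zq p k) (Qq p k))
      rw [← Matrix.map_mul, ← Matrix.map_mul, ht']
    refine ⟨tG t * x, ?_, n, h', ?_⟩
    · rw [Set.Finite.mem_toFinset]
      exact ⟨(x, t), ⟨hx, trivial⟩, rfl⟩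
    · rw [inv_mul_eq_iff_eq_mul] at hu
      rw [hu, ← mul_assoc, ← mul_assoc, ← scalarP_zpow_mul, mul_assoc (scalarP p k ^ n), e1]
      simp only [mul_assoc]

/-- The Hecke operator `T` on `ind_{KZ}^G (⊗_i Sym^{r_i} R²)`. -/
def hecke : cInd ι r →ₗ[R] cInd ι r where
  toFun φ := ⟨heckeFun ι r φ, heckeFun_mem ι r φ.2⟩
  map_add' φ ψ := by
    apply Subtype.ext
    funext g
    simp only [heckeFun, Submodule.coe_add, Pi.add_apply, map_add]
    exact finsum_add_distrib (Set.toFinite _) (Set.toFinite _)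
  map_smul' c φ := by
    apply Subtype.ext
    funext g
    simp only [heckeFun, Submodule.coe_smul, Pi.smul_apply, map_smul, RingHom.id_apply]
    exact (smul_finsum' c (Set.toFinite _)).symm

lemma hecke_comm (h : GrpG p k) (φ : cInd ι r) :
    hecke ι r (cIndRep ι r h φ) = cIndRep ι r h (hecke ι r φ) := by
  apply Subtype.ext
  funext g
  change heckeFun ι r (transRep R (GrpG p k) (SymV R r) h φ) g = heckeFun ι r φ (g * h)
  simp [heckeFun, mul_assoc]

end Operator

end HeckeOp

end Hecke

section Padic

variable (p : ℕ) [Fact p.Prime]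

/-- `ℤ̄_p`, the ring of integers of the algebraic closure `ℚ̄_p` of `ℚ_p`. -/
abbrev Zpbar : ValuationSubring (PadicAlgCl p) :=
  (Valued.v : Valuation (PadicAlgCl p) NNReal).valuationSubring

/-- `𝔽̄_p`, the residue field of `ℤ̄_p`. -/
abbrev Fpbar : Type := IsLocalRing.ResidueField (Zpbar p)

variable {p}

/-- The `p`-adic valuation normalised by `v(p) = 1`, for nonzero elements of `ℚ̄_p`. -/
def padicSlope (x : PadicAlgCl p) : ℝ := -Real.logb p ‖x‖

end Padic

section Theta

variable {p : ℕ} [Fact p.Prime] {k : Type} [Field k] [CharP k p] {f : ℕ}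
variable {O : Type} [CommRing O] (E : Type) [Field E] [Algebra O E] (F : Type) [Field F]
  [Algebra O F]

/-- The field `E ⊇ O` as a `ℤ_q`-algebra, given `O` as a `ℤ_q`-algebra. -/
def iotaE (ι : Zq p k →+* O) : Zq p k →+* E := (algebraMap O E).comp ι

/-- The map `⊗ Sym^{r_i} O² → ⊗ Sym^{r_i} E²` on coefficients. -/
def symMap (r : Fin f → ℕ) : SymV O r →ₛₗ[algebraMap O E] SymV E r where
  toFun P := ⟨MvPolynomial.map (algebraMap O E) P.1, fun d hd => P.2 fun h0 => hd (by
    rw [MvPolynomial.coeff_map, h0, map_zero])⟩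
  map_add' P Q := Subtype.ext (map_add (MvPolynomial.map (algebraMap O E)) P.1 Q.1)
  map_smul' c P := Subtype.ext (by
    change MvPolynomial.map (algebraMap O E) (c • P.1)
      = algebraMap O E c • MvPolynomial.map (algebraMap O E) P.1
    rw [MvPolynomial.smul_eq_C_mul, map_mul, MvPolynomial.map_C, MvPolynomial.smul_eq_C_mul])

lemma symMap_symRep (ι : Zq p k →+* O) (r : Fin f → ℕ)
    (m : Matrix (Fin 2) (Fin 2) (Zq p k)) (P : SymV O r) :
    symMap E r (symRep ι r m P) = symRep (iotaE E ι) r m (symMap E r P) := by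
  apply Subtype.ext
  change MvPolynomial.map (algebraMap O E) (substHom ι f m P.1)
    = substHom (iotaE E ι) f m (MvPolynomial.map (algebraMap O E) P.1)
  generalize P.1 = P'
  induction P' using MvPolynomial.induction_on with
  | C a => simp [substHom, MvPolynomial.algebraMap_eq]
  | add P Q hP hQ => simp only [map_add, hP, hQ]
  | mul_X P v hP =>
    rw [map_mul, map_mul, map_mul, map_mul, hP]
    congr 1
    simp [substHom, iotaE]

/-- The map `ind_{KZ}^G (⊗ Sym^{r_i} O²) → ind_{KZ}^G (⊗ Sym^{r_i} E²)`. -/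
def cIndMap (ι : Zq p k →+* O) (r : Fin f → ℕ) :
    cInd ι r →ₛₗ[algebraMap O E] cInd (iotaE E ι) r where
  toFun φ := ⟨fun g => symMap E r (φ.1 g), by
    obtain ⟨φ, h1, h2, S, hS⟩ := φ
    refine ⟨fun u g => by simp [h1, symMap_symRep], fun g => by simp [h2], S, fun g hg => ?_⟩
    exact hS g fun h => hg (by simp [h])⟩
  map_add' φ ψ := by
    apply Subtype.ext
    funext g
    simp
  map_smul' c φ := by
    apply Subtype.ext
    funext g
    simp

variable [Finite k]

/-- The submodule `(T - a_p) ind_{KZ}^G (⊗ Sym^{r_i} E²)`. -/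
def heckeRange (ι : Zq p k →+* O) (r : Fin f → ℕ) (a : E) : Submodule E (cInd (iotaE E ι) r) :=
  LinearMap.range (hecke (iotaE E ι) r - a • LinearMap.id)

/-- The locally algebraic representation
`Π_{k, a_p} = ind_{KZ}^G (⊗ Sym^{r_i} E²) / (T - a_p)`, where `r_i = k_i - 2`. -/
abbrev PiSpace (ι : Zq p k →+* O) (r : Fin f → ℕ) (a : E) : Type :=
  cInd (iotaE E ι) r ⧸ heckeRange E ι r a

/-- The action of `G` on `Π_{k, a_p}`. -/
def piRep (ι : Zq p k →+* O) (r : Fin f → ℕ) (a : E) :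
    Representation E (GrpG p k) (PiSpace E ι r a) :=
  (cIndRep (iotaE E ι) r).quotient (heckeRange E ι r a) (by
    rintro h _ ⟨φ, rfl⟩
    refine ⟨cIndRep (iotaE E ι) r h φ, ?_⟩
    simp [hecke_comm])

/-- The map `ind_{KZ}^G (⊗ Sym^{r_i} O²) → Π_{k, a_p}`. -/
def latticeMap (ι : Zq p k →+* O) (r : Fin f → ℕ) (a : E) :
    cInd ι r →ₛₗ[algebraMap O E] PiSpace E ι r a :=
  (heckeRange E ι r a).mkQ.comp (cIndMap E ι r)

/-- `Θ_{k, a_p}`, the image of `ind_{KZ}^G (⊗ Sym^{r_i} O²)` in `Π_{k, a_p}`, that is, the quotient of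
`ind_{KZ}^G (⊗ Sym^{r_i} O²)` by
`(T - a_p) ind_{KZ}^G (⊗ Sym^{r_i} E²) ∩ ind_{KZ}^G (⊗ Sym^{r_i} O²)`. -/
abbrev Theta (ι : Zq p k →+* O) (r : Fin f → ℕ) (a : E) : Type :=
  cInd ι r ⧸ LinearMap.ker (latticeMap E ι r a)

/-- The action of `G` on `Θ_{k, a_p}`. -/
def thetaRep (ι : Zq p k →+* O) (r : Fin f → ℕ) (a : E) :
    Representation O (GrpG p k) (Theta E ι r a) :=
  (cIndRep ι r).quotient (LinearMap.ker (latticeMap E ι r a)) (by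
    intro h φ hφ
    have h1 : latticeMap E ι r a (cIndRep ι r h φ) = piRep E ι r a h (latticeMap E ι r a φ) := rfl
    rw [Submodule.mem_comap, LinearMap.mem_ker, h1, LinearMap.mem_ker.mp hφ, map_zero])

/-- The reduction `Θ̄_{k, a_p} = F ⊗ Θ_{k, a_p}` along the map from `O` to its residue field. -/
abbrev ThetaBar (ι : Zq p k →+* O) (r : Fin f → ℕ) (a : E) : Type :=
  TensorProduct O F (Theta E ι r a)

/-- The action of `G` on `Θ̄_{k, a_p}`. -/
def thetaBarRep (ι : Zq p k →+* O) (r : Fin f → ℕ) (a : E) :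
    Representation F (GrpG p k) (ThetaBar E F ι r a) where
  toFun g := (thetaRep E ι r a g).baseChange F
  map_one' := by
    rw [map_one]
    exact LinearMap.baseChange_id
  map_mul' g h := by
    rw [map_mul]
    exact LinearMap.baseChange_comp _ _

end Theta

section Supercuspidal

variable {p : ℕ} [Fact p.Prime] {k : Type} [Field k] [CharP k p]
variable {F : Type} [Field F]

/-- A representation of `G` is smooth if every vector is fixed by an open subgroup. -/
def IsSmooth {V : Type} [AddCommGroup V] [Module F V] (π : Representation F (GrpG p k) V) : Prop :=
  ∀ v : V, ∃ n : ℕ, ∀ u : GrpK p k, CongrOne p k n u → π (incl p k u) v = v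

/-- A character of `ℚ_q^×` is smooth if it is trivial on `1 + p^n ℤ_q` for some `n`. -/
def IsSmoothChar (χ : (Qq p k)ˣ →* Fˣ) : Prop :=
  ∃ n : ℕ, ∀ x : (Zq p k)ˣ, (p : Zq p k) ^ n ∣ (x : Zq p k) - 1 →
    χ (Units.map (algebraMap (Zq p k) (Qq p k)).toMonoidHom x) = 1

/-- The upper triangular matrix `(a b; 0 d)` in `G`. -/
def borel (a d : (Qq p k)ˣ) (b : Qq p k) : GrpG p k :=
  Matrix.GeneralLinearGroup.mkOfDetNeZero !![(a : Qq p k), b; 0, (d : Qq p k)] (by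
    simp [Matrix.det_fin_two])

lemma exists_pow_mul_int (x : Qq p k) [Finite k] :
    ∃ (c : ℕ) (y : Zq p k), algebraMap (Zq p k) (Qq p k) p ^ c * x
      = algebraMap (Zq p k) (Qq p k) y := by
  obtain ⟨y, z, hz, rfl⟩ := IsFractionRing.div_surjective (A := Zq p k) x
  obtain ⟨c, e, he⟩ := WittVector.exists_eq_pow_p_mul' z (nonZeroDivisors.ne_zero hz)
  refine ⟨c, ↑e⁻¹ * y, ?_⟩
  have h1 : algebraMap (Zq p k) (Qq p k) z ≠ 0 :=
    IsFractionRing.to_map_ne_zero_of_mem_nonZeroDivisors hz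
  rw [mul_div_assoc', div_eq_iff h1, ← map_pow, ← map_mul, ← map_mul, he]
  congr 1
  rw [show (↑e⁻¹ * y * ((p : Zq p k) ^ c * (e : Zq p k)))
    = (p : Zq p k) ^ c * y * ((e⁻¹ : (Zq p k)ˣ) * (e : Zq p k)) by ring]
  simp

lemma exists_pow_mul_int_matrix [Finite k] (A : Matrix (Fin 2) (Fin 2) (Qq p k)) :
    ∃ (c : ℕ) (B : Matrix (Fin 2) (Fin 2) (Zq p k)),
      algebraMap (Zq p k) (Qq p k) p ^ c • A = B.map (algebraMap (Zq p k) (Qq p k)) := by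
  choose c y h using fun x : Fin 2 × Fin 2 => exists_pow_mul_int (A x.1 x.2)
  refine ⟨∑ x, c x, fun i j => (p : Zq p k) ^ (∑ x ∈ Finset.univ.erase (i, j), c x) * y (i, j), ?_⟩
  ext i j
  change algebraMap (Zq p k) (Qq p k) p ^ (∑ x, c x) * A i j = algebraMap (Zq p k) (Qq p k)
    ((p : Zq p k) ^ (∑ x ∈ Finset.univ.erase (i, j), c x) * y (i, j))
  rw [map_mul, ← h (i, j), map_pow,
    ← Finset.add_sum_erase Finset.univ c (Finset.mem_univ (i, j)), pow_add,
    mul_comm (algebraMap (Zq p k) (Qq p k) p ^ c (i, j)), mul_assoc]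

/-- Conjugates of open subgroups are open. -/
lemma exists_conj_congr [Finite k] (h : GrpG p k) (n : ℕ) : ∃ m : ℕ, ∀ u : GrpK p k,
    CongrOne p k m u → ∃ u' : GrpK p k, CongrOne p k n u' ∧
      h⁻¹ * incl p k u * h = incl p k u' := by
  obtain ⟨c₁, B₁, e₁⟩ := exists_pow_mul_int_matrix
    ((h⁻¹ : GrpG p k) : Matrix (Fin 2) (Fin 2) (Qq p k))
  obtain ⟨c₂, B₂, e₂⟩ := exists_pow_mul_int_matrix (h : Matrix (Fin 2) (Fin 2) (Qq p k))
  refine ⟨n + c₁ + c₂, fun u hu => ?_⟩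
  choose x hx using hu
  have hux : (u : Matrix (Fin 2) (Fin 2) (Zq p k))
      = 1 + (p : Zq p k) ^ (n + c₁ + c₂) • (Matrix.of x) := by
    refine Matrix.ext fun i j => ?_
    rw [Matrix.add_apply, Matrix.smul_apply, Matrix.of_apply, smul_eq_mul, ← hx i j,
      add_sub_cancel]
  let M : Matrix (Fin 2) (Fin 2) (Zq p k) := 1 + (p : Zq p k) ^ n • (B₁ * Matrix.of x * B₂)
  have hM : M.map (algebraMap (Zq p k) (Qq p k))
      = ((h⁻¹ : GrpG p k) : Matrix (Fin 2) (Fin 2) (Qq p k))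
        * (u : Matrix (Fin 2) (Fin 2) (Zq p k)).map (algebraMap (Zq p k) (Qq p k))
        * (h : Matrix (Fin 2) (Fin 2) (Qq p k)) := by
    have f1 : ∀ A B : Matrix (Fin 2) (Fin 2) (Zq p k),
        (A + B).map (algebraMap (Zq p k) (Qq p k))
          = A.map (algebraMap (Zq p k) (Qq p k)) + B.map (algebraMap (Zq p k) (Qq p k)) :=
      fun A B => (RingHom.mapMatrix (algebraMap (Zq p k) (Qq p k))).map_add A B
    have f2 : ∀ (c : Zq p k) (B : Matrix (Fin 2) (Fin 2) (Zq p k)),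
        (c • B).map (algebraMap (Zq p k) (Qq p k))
          = algebraMap (Zq p k) (Qq p k) c • B.map (algebraMap (Zq p k) (Qq p k)) := by
      intro c B
      ext i j
      exact map_mul (algebraMap (Zq p k) (Qq p k)) c (B i j)
    have f3 : (1 : Matrix (Fin 2) (Fin 2) (Zq p k)).map (algebraMap (Zq p k) (Qq p k)) = 1 :=
      (RingHom.mapMatrix (algebraMap (Zq p k) (Qq p k))).map_one
    rw [hux, f1, f1, f2, f2, f3, Matrix.map_mul, Matrix.map_mul, ← e₁, ← e₂, mul_add, add_mul,
      mul_one, Units.inv_mul, map_pow, map_pow]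
    simp only [Matrix.smul_mul, Matrix.mul_smul, smul_smul, pow_add]
    congr 2
    rw [mul_comm (algebraMap (Zq p k) (Qq p k) p ^ c₂), ← mul_assoc]
  have hdet : M.det = (u : Matrix (Fin 2) (Fin 2) (Zq p k)).det := by
    apply IsFractionRing.injective (Zq p k) (Qq p k)
    rw [RingHom.map_det, RingHom.map_det, RingHom.mapMatrix_apply, RingHom.mapMatrix_apply, hM,
      Matrix.det_mul, Matrix.det_mul, mul_right_comm, ← Matrix.det_mul, Units.inv_mul,
      Matrix.det_one, one_mul]
  refine ⟨Matrix.GeneralLinearGroup.mk'' M (hdet ▸ (Matrix.isUnit_iff_isUnit_det _).mp u.isUnit),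
    fun i j => ?_, ?_⟩
  · change (p : Zq p k) ^ n ∣ M i j - (1 : Matrix (Fin 2) (Fin 2) (Zq p k)) i j
    simp only [M, Matrix.add_apply, Matrix.smul_apply, smul_eq_mul, add_sub_cancel_left]
    exact dvd_mul_right _ _
  · apply Units.ext
    exact hM.symm

/-- The parabolic induction `Ind_B^G (χ₁ ⊗ χ₂)` from the upper triangular Borel subgroup: functions
`φ` on `G` with `φ((a b; 0 d) g) = χ₁(a) χ₂(d) φ(g)` that are invariant under right translation by
an open subgroup. -/
def princ [Finite k] (χ₁ χ₂ : (Qq p k)ˣ →* Fˣ) : Submodule F (GrpG p k → F) where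
  carrier := {φ | (∀ (a d : (Qq p k)ˣ) (b : Qq p k) (g : GrpG p k),
      φ (borel a d b * g) = (χ₁ a : F) * (χ₂ d : F) * φ g) ∧
    ∃ n : ℕ, ∀ u : GrpK p k, CongrOne p k n u → ∀ g, φ (g * incl p k u) = φ g}
  zero_mem' := ⟨by simp, 0, by simp⟩
  add_mem' := by
    rintro φ ψ ⟨h1, n, hn⟩ ⟨h1', n', hn'⟩
    refine ⟨fun a d b g => by simp [h1, h1', mul_add], max n n', fun u hu g => ?_⟩
    have e1 := hn u (fun i j => (pow_dvd_pow _ (le_max_left n n')).trans (hu i j)) g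
    have e2 := hn' u (fun i j => (pow_dvd_pow _ (le_max_right n n')).trans (hu i j)) g
    simp [e1, e2]
  smul_mem' := by
    rintro c φ ⟨h1, n, hn⟩
    refine ⟨fun a d b g => ?_, n, fun u hu g => by simp [hn u hu g]⟩
    simp only [Pi.smul_apply, h1, smul_eq_mul]
    ring

/-- `G` acts on the parabolic induction by right translation. -/
def princRep [Finite k] (χ₁ χ₂ : (Qq p k)ˣ →* Fˣ) :
    Representation F (GrpG p k) (princ χ₁ χ₂) :=
  (transRep F (GrpG p k) F).subrepresentation (princ χ₁ χ₂) (by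
    rintro h φ ⟨h1, n, hn⟩
    refine ⟨fun a d b g => by simp [mul_assoc, h1], ?_⟩
    obtain ⟨m, hm⟩ := exists_conj_congr h n
    refine ⟨m, fun u hu g => ?_⟩
    obtain ⟨u', hu', e⟩ := hm u hu
    have := hn u' hu' (g * h)
    rw [← e] at this
    simpa [mul_assoc] using this)

/-- The quotient of a representation by a subrepresentation. -/
abbrev quotRep {V : Type} [AddCommGroup V] [Module F V] {G : Type} [Group G]
    (π : Representation F G V) (W : Subrepresentation π) :
    Representation F G (V ⧸ W.toSubmodule) :=
  π.quotient W.toSubmodule fun g _ hv => W.apply_mem_toSubmodule g hv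

/-- A representation of `G` is supercuspidal if it is irreducible, smooth, and not isomorphic to a
subquotient of a representation parabolically induced from a smooth character of the torus. -/
structure IsSupercuspidal [Finite k] {V : Type} [AddCommGroup V] [Module F V]
    (π : Representation F (GrpG p k) V) : Prop where
  irreducible : π.IsIrreducible
  smooth : IsSmooth π
  not_subquotient : ∀ χ₁ χ₂ : (Qq p k)ˣ →* Fˣ, IsSmoothChar χ₁ → IsSmoothChar χ₂ →
    ∀ (W₁ : Subrepresentation (princRep χ₁ χ₂)) (W₂ : Subrepresentation W₁.toRepresentation),
      IsEmpty (π.Equiv (quotRep (V := W₁.toSubmodule) W₁.toRepresentation W₂))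

/-- All irreducible quotients of the representation `π` are supercuspidal. -/
def IrredQuotientsSupercuspidal [Finite k] {V : Type} [AddCommGroup V] [Module F V]
    (π : Representation F (GrpG p k) V) : Prop :=
  ∀ W : Subrepresentation π, (quotRep π W).IsIrreducible → IsSupercuspidal (quotRep π W)

end Supercuspidal

end GL2Red
end

/-! Supercuspidality is read off from a single vector. Let `Q : M → V` be a surjection onto `V ≠ 0`
from a subrepresentation `M` of a principal series. A nonzero function in the kernel of `Q` that
vanishes at `1` would generate the whole principal series (`princ_le`) and force `Q = 0`. So an
element of the kernel is determined by its value at `1`, and likewise by its value at `w = (0 1; 1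
0)`. Consequently invariance under unipotents, and to some extent Hecke relations, lift from `V` to
`M`. If `v = n x - x` with `n ∈ N(ℤ_q)` is invariant under `N(ℤ_q)` and `N⁻(p ℤ_q)` and killed by
`U_p`, a suitable lift vanishes at `1`, then at `w`, then everywhere (`isEmpty_equiv_of_Up`). If `v`
is invariant under `SL₂(ℤ_q)` and killed by `T`, every lift is a `T`-eigenvector with eigenvalue
`χ₂(p) ≠ 0`, which is absurd (`isEmpty_equiv_of_spherical`). A generator has nonzero image in every
irreducible quotient, so it suffices to find generators of this kind.

The relations in `Θ̄` come from applying `T - a_p` to integral functions and dividing by `a_p`,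
`a_p²` or `p` (`thetaReduction`, `thetaReduction_isSteep`). The first one shows that the image of
`[1, v]` depends only on the function `ev v` on `k²` obtained by reducing modulo `p` and setting
`X_i = x^(p^i)`, `Y_i = y^(p^i)` (`Reduction.vec_eq_zero`). These functions are homogeneous of
degree `r_0 + p r_1`, a number that matters only modulo `q - 1`.

Let `c > 0` represent this class. The vector `δ` attached to `(1 - x^(q-1)) y^c`, which is supported
on the line `x = 0`, generates `Θ̄`, and `T [1, δ]` is modulo `p` a single elementary function. A
combination of translates of `δ` is therefore mapped by `T` to a vector at the base vertex modulo
`p`, and a second application of `T` is controlled by power sums over `k` modulo `p²`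
(`exists_correction`). For `c = q - 1` this shows that `δ` is spherical and killed by `T`.

For `1 ≤ c ≤ p - 1` the subrepresentation `F` is generated by the vector of `x^(q-1+c-p) y^p`. Power
sums weighted by `μ^(p-c)` together with `v(a_p) > 1/2` show that `U_p` kills it, and the unweighted
ones show that `U_p` kills `δ`, which generates `Θ̄ / F`. Binomial expansions with Lucas' congruence
express both generators as `n x - x`. The classes `c p` reduce to the classes `c` by exchanging the
tensor factors with a Frobenius twist. -/

noncomputable section

namespace GL2Red

/-! ### Elementary functions and the Hecke operator on them -/

section Elementary

variable {p : ℕ} [Fact p.Prime] {k : Type} [Field k] [CharP k p] [Finite k]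

lemma coe_scalarP_mul (g : GrpG p k) :
    ((scalarP p k * g : GrpG p k) : Matrix (Fin 2) (Fin 2) (Qq p k))
      = algebraMap (Zq p k) (Qq p k) p • (g : Matrix (Fin 2) (Fin 2) (Qq p k)) := by
  ext i j
  fin_cases i <;> fin_cases j <;>
    simp [scalarP, ofInt, Matrix.mul_apply, Matrix.GeneralLinearGroup.mkOfDetNeZero]

lemma coe_scalarP_zpow_mul (n : ℤ) (g : GrpG p k) :
    ((scalarP p k ^ n * g : GrpG p k) : Matrix (Fin 2) (Fin 2) (Qq p k))
      = algebraMap (Zq p k) (Qq p k) p ^ n • (g : Matrix (Fin 2) (Fin 2) (Qq p k)) := by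
  have hp := algebraMap_p_ne_zero p k
  induction n using Int.induction_on with
  | zero => simp
  | succ n ih =>
    rw [_root_.zpow_add_one, mul_assoc, scalarP_mul, ← mul_assoc, ← scalarP_mul, coe_scalarP_mul, ih,
      smul_smul, zpow_add_one₀ hp, mul_comm]
  | pred n ih =>
    have h1 : scalarP p k * (scalarP p k ^ (-(n : ℤ) - 1) * g) = scalarP p k ^ (-(n : ℤ)) * g := by
      rw [← mul_assoc, ← _root_.zpow_one_add]
      congr 2
      ring
    rw [← h1, coe_scalarP_mul] at ih
    have h2 := congrArg (fun M => (algebraMap (Zq p k) (Qq p k) p)⁻¹ • M) ih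
    simp only [smul_smul, inv_mul_cancel₀ hp, one_smul] at h2
    rw [h2, zpow_sub_one₀ hp, mul_comm]

lemma not_isUnit_natCast_p : ¬ IsUnit (p : Zq p k) := by
  rw [isUnit_iff_coeff, not_not]
  exact (dvd_iff_coeff _).mp dvd_rfl

/-- The power of `p` and the integral matrix are determined by their product, if the determinant is
known up to a unit. -/
lemma zpow_smul_map_inj {d : ℕ} {A B : Matrix (Fin 2) (Fin 2) (Zq p k)} {e e' : (Zq p k)ˣ}
    (hA : A.det = (p : Zq p k) ^ d * e) (hB : B.det = (p : Zq p k) ^ d * e') {n m : ℤ}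
    (h : algebraMap (Zq p k) (Qq p k) p ^ n • A.map (algebraMap (Zq p k) (Qq p k))
      = algebraMap (Zq p k) (Qq p k) p ^ m • B.map (algebraMap (Zq p k) (Qq p k))) :
    n = m ∧ A = B := by
  have hinj := IsFractionRing.injective (Zq p k) (Qq p k)
  have hp := algebraMap_p_ne_zero p k
  have key : ∀ {A B : Matrix (Fin 2) (Fin 2) (Zq p k)} {e e' : (Zq p k)ˣ},
      A.det = (p : Zq p k) ^ d * e → B.det = (p : Zq p k) ^ d * e' → ∀ (n : ℤ) (c : ℕ),
      algebraMap (Zq p k) (Qq p k) p ^ n • A.map (algebraMap (Zq p k) (Qq p k))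
        = algebraMap (Zq p k) (Qq p k) p ^ (n + c) • B.map (algebraMap (Zq p k) (Qq p k)) →
      c = 0 ∧ A = B := by
    intro A B e e' hA hB n c h
    have h1 : A = (p : Zq p k) ^ c • B := by
      ext i j
      have h2 := congrFun (congrFun h i) j
      simp only [Matrix.smul_apply, Matrix.map_apply, smul_eq_mul] at h2
      rw [zpow_add₀ hp, mul_assoc, zpow_natCast] at h2
      have h3 := mul_left_cancel₀ (zpow_ne_zero n hp) h2
      rw [← map_pow, ← map_mul] at h3
      rw [Matrix.smul_apply, smul_eq_mul, hinj h3]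
    -- The determinants of `A` and `B` have the same valuation `d`, whereas a factor `p ^ c` changes
    -- the valuation by `2 c`.
    have h2 : c = 0 := by
      by_contra hc
      have h3 : A.det = (p : Zq p k) ^ (2 * c) * ((p : Zq p k) ^ d * e') := by
        rw [h1, Matrix.det_smul, Fintype.card_fin, hB, ← pow_mul, mul_comm c]
      rw [hA, mul_left_comm] at h3
      have h4 := mul_left_cancel₀ (pow_ne_zero d (natCast_p_ne_zero p k)) h3
      have h5 : IsUnit ((p : Zq p k) ^ (2 * c) * e') := h4 ▸ e.isUnit
      exact not_isUnit_natCast_p ((isUnit_pow_iff (by omega)).mp (isUnit_of_mul_isUnit_left h5))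
    exact ⟨h2, by rw [h1, h2, pow_zero, one_smul]⟩
  rcases le_total n m with hnm | hnm
  · obtain ⟨c, rfl⟩ := Int.le.dest hnm
    obtain ⟨rfl, h2⟩ := key hA hB n c h
    exact ⟨by simp, h2⟩
  · obtain ⟨c, rfl⟩ := Int.le.dest hnm
    obtain ⟨rfl, h2⟩ := key hB hA m c h.symm
    exact ⟨by simp, h2.symm⟩

lemma det_coe_isUnit (u : GrpK p k) : ∃ e : (Zq p k)ˣ,
    (u : Matrix (Fin 2) (Fin 2) (Zq p k)).det = e :=
  ⟨Matrix.GeneralLinearGroup.det u, rfl⟩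

lemma coe_eq_of_eq_scalarP_zpow_mul {n : ℤ} {g x : GrpG p k} (h : g = scalarP p k ^ n * x) :
    (g : Matrix (Fin 2) (Fin 2) (Qq p k))
      = algebraMap (Zq p k) (Qq p k) p ^ n • (x : Matrix (Fin 2) (Fin 2) (Qq p k)) := by
  rw [h, coe_scalarP_zpow_mul]

/-- `KZ` is the direct product of the powers of `p` and `K`; this makes the choice in `elFun`
harmless. -/
lemma scalarP_zpow_mul_incl_inj {n m : ℤ} {u u' : GrpK p k}
    (h : scalarP p k ^ n * incl p k u = scalarP p k ^ m * incl p k u') : n = m ∧ u = u' := by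
  obtain ⟨e, he⟩ := det_coe_isUnit u
  obtain ⟨e', he'⟩ := det_coe_isUnit u'
  have h1 := congrArg (fun g : GrpG p k => (g : Matrix (Fin 2) (Fin 2) (Qq p k))) h
  simp only [coe_scalarP_zpow_mul] at h1
  obtain ⟨h2, h3⟩ := zpow_smul_map_inj (d := 0) (e := e) (e' := e')
    (by simpa using he) (by simpa using he') h1
  exact ⟨h2, Units.ext h3⟩

section Fun

variable {R : Type} [CommRing R] {f : ℕ} (ι : Zq p k →+* R) (r : Fin f → ℕ)

open Classical in
/-- The function supported on `KZ` that maps `p ^ n * u` to `u · v`. -/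
def elFun (v : SymV R r) (g : GrpG p k) : SymV R r :=
  if h : ∃ x : ℤ × GrpK p k, g = scalarP p k ^ x.1 * incl p k x.2 then
    symRep ι r (h.choose.2 : Matrix (Fin 2) (Fin 2) (Zq p k)) v else 0

lemma elFun_of {v : SymV R r} {g : GrpG p k} (n : ℤ) (u : GrpK p k)
    (hg : g = scalarP p k ^ n * incl p k u) :
    elFun ι r v g = symRep ι r (u : Matrix (Fin 2) (Fin 2) (Zq p k)) v := by
  have h : ∃ x : ℤ × GrpK p k, g = scalarP p k ^ x.1 * incl p k x.2 := ⟨(n, u), hg⟩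
  rw [elFun, dif_pos h]
  have h1 := h.choose_spec
  rw [(scalarP_zpow_mul_incl_inj (hg.symm.trans h1)).2]

lemma elFun_zero {v : SymV R r} {g : GrpG p k}
    (hg : ∀ (n : ℤ) (u : GrpK p k), g ≠ scalarP p k ^ n * incl p k u) : elFun ι r v g = 0 := by
  rw [elFun, dif_neg]
  rintro ⟨x, hx⟩
  exact hg _ _ hx

lemma elFun_mem (v : SymV R r) : elFun ι r v ∈ cInd ι r := by
  refine ⟨fun u g => ?_, fun g => ?_, {1}, fun g hg => ?_⟩
  · by_cases h : ∃ (n : ℤ) (u : GrpK p k), g = scalarP p k ^ n * incl p k u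
    · obtain ⟨n, u', hn⟩ := h
      rw [elFun_of ι r n u' hn, elFun_of ι r n (u * u'), Units.val_mul, map_mul,
        Module.End.mul_apply]
      rw [hn, map_mul, ← mul_assoc, ← scalarP_zpow_mul, mul_assoc]
    · push Not at h
      rw [elFun_zero ι r h, map_zero, elFun_zero]
      intro n u' hn
      refine h n (u⁻¹ * u') ?_
      rw [map_mul, ← mul_assoc, scalarP_zpow_mul, mul_assoc, ← hn, map_inv, inv_mul_cancel_left]
  · by_cases h : ∃ (n : ℤ) (u : GrpK p k), g = scalarP p k ^ n * incl p k u
    · obtain ⟨n, u', hn⟩ := h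
      rw [elFun_of ι r n u' hn, elFun_of ι r (1 + n) u']
      rw [hn, _root_.zpow_one_add, mul_assoc]
    · push Not at h
      rw [elFun_zero ι r h, elFun_zero]
      intro n u' hn
      refine h (n - 1) u' ?_
      rw [sub_eq_neg_add, _root_.zpow_add, mul_assoc, ← hn, _root_.zpow_neg_one, inv_mul_cancel_left]
  · by_contra hc
    refine hg (elFun_zero ι r fun n u hn => hc ⟨1, by simp, n, u, by simpa using hn⟩)

/-- The elementary function `[1, v]` of the compact induction. -/
def el : SymV R r →ₗ[R] cInd ι r where
  toFun v := ⟨elFun ι r v, elFun_mem ι r v⟩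
  map_add' v w := by
    apply Subtype.ext
    funext g
    change elFun ι r (v + w) g = elFun ι r v g + elFun ι r w g
    by_cases h : ∃ (n : ℤ) (u : GrpK p k), g = scalarP p k ^ n * incl p k u
    · obtain ⟨n, u, hn⟩ := h
      simp only [elFun_of ι r n u hn, map_add]
    · push Not at h
      simp only [elFun_zero ι r h, add_zero]
  map_smul' c v := by
    apply Subtype.ext
    funext g
    change elFun ι r (c • v) g = c • elFun ι r v g
    by_cases h : ∃ (n : ℤ) (u : GrpK p k), g = scalarP p k ^ n * incl p k u
    · obtain ⟨n, u, hn⟩ := h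
      simp only [elFun_of ι r n u hn, map_smul]
    · push Not at h
      simp only [elFun_zero ι r h, smul_zero]

lemma el_apply (v : SymV R r) (g : GrpG p k) : (el ι r v).1 g = elFun ι r v g := rfl

lemma cIndRep_apply (h : GrpG p k) (φ : cInd ι r) (g : GrpG p k) :
    (cIndRep ι r h φ).1 g = φ.1 (g * h) := rfl

lemma cIndRep_scalarP (φ : cInd ι r) : cIndRep ι r (scalarP p k) φ = φ := by
  apply Subtype.ext
  funext g
  rw [cIndRep_apply, ← scalarP_mul, φ.2.2.1]

lemma cIndRep_incl_el (u : GrpK p k) (v : SymV R r) : cIndRep ι r (incl p k u) (el ι r v)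
    = el ι r (symRep ι r (u : Matrix (Fin 2) (Fin 2) (Zq p k)) v) := by
  apply Subtype.ext
  funext g
  rw [cIndRep_apply, el_apply, el_apply]
  by_cases h : ∃ (n : ℤ) (u : GrpK p k), g = scalarP p k ^ n * incl p k u
  · obtain ⟨n, u', hn⟩ := h
    rw [elFun_of ι r n u' hn, elFun_of ι r n (u' * u) (by rw [hn, map_mul, mul_assoc]),
      Units.val_mul, map_mul, Module.End.mul_apply]
  · push Not at h
    rw [elFun_zero ι r h, elFun_zero]
    intro n u' hn
    refine h n (u' * u⁻¹) ?_
    rw [map_mul, map_inv, ← mul_assoc, ← hn, mul_inv_cancel_right]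

/-- The compact induction is spanned by the translates of elementary functions. -/
lemma cInd_induction {P : cInd ι r → Prop} (zero : P 0) (add : ∀ φ ψ, P φ → P ψ → P (φ + ψ))
    (basic : ∀ (g : GrpG p k) (v : SymV R r), P (cIndRep ι r g (el ι r v))) (φ : cInd ι r) :
    P φ := by
  classical
  obtain ⟨S, hS⟩ := φ.2.2.2
  induction S using Finset.induction_on generalizing φ with
  | empty =>
    have : φ = 0 := by
      apply Subtype.ext
      funext g
      by_contra hg
      obtain ⟨s, hs, _⟩ := hS g hg
      simp at hs
    rw [this]
    exact zero
  | insert s S hs ih =>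
    have h1 : φ = (φ - cIndRep ι r s⁻¹ (el ι r (φ.1 s))) + cIndRep ι r s⁻¹ (el ι r (φ.1 s)) := by
      simp
    rw [h1]
    refine add _ _ (ih _ fun g hg => ?_) (basic _ _)
    have hφ : ∀ (n : ℤ) (g : GrpG p k), φ.1 (scalarP p k ^ n * g) = φ.1 g := by
      intro n g
      induction n using Int.induction_on with
      | zero => simp
      | succ n ih => rw [_root_.zpow_add_one, mul_assoc, scalarP_mul, ← mul_assoc, ← scalarP_mul,
          φ.2.2.1, ih]
      | pred n ih =>
        rw [← ih, ← φ.2.2.1 (scalarP p k ^ (-(n : ℤ) - 1) * g), ← mul_assoc, ← _root_.zpow_one_add,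
          add_sub_cancel]
    change φ.1 g - elFun ι r (φ.1 s) (g * s⁻¹) ≠ 0 at hg
    by_cases h : ∃ (n : ℤ) (u : GrpK p k), g * s⁻¹ = scalarP p k ^ n * incl p k u
    · obtain ⟨n, u, hn⟩ := h
      refine absurd ?_ hg
      rw [elFun_of ι r n u hn, ← φ.2.1, sub_eq_zero, ← hφ n (incl p k u * s), ← mul_assoc, ← hn,
        inv_mul_cancel_right]
    · have h' := h
      push Not at h'
      rw [elFun_zero ι r h', sub_zero] at hg
      obtain ⟨x, hx, n, u, hu⟩ := hS g hg
      rcases Finset.mem_insert.mp hx with rfl | hx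
      · exact absurd ⟨n, u, by rw [hu, mul_inv_cancel_right]⟩ h
      · exact ⟨x, hx, n, u, hu⟩

/-- The matrices `p * y⁻¹` for the representatives `y` of `KZ α⁻¹ KZ / KZ`. -/
def heckeAdj (s : Option k) : Matrix (Fin 2) (Fin 2) (Zq p k) := (heckeMat p s).adjugate

lemma heckeAdj_some (lam : k) : heckeAdj (some lam)
    = !![1, -WittVector.teichmuller p lam; 0, (p : Zq p k)] := by
  simp [heckeAdj, heckeMat, Matrix.adjugate_fin_two]

lemma heckeAdj_none : heckeAdj (none : Option k) = !![(p : Zq p k), 0; 0, 1] := by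
  simp [heckeAdj, heckeMat, Matrix.adjugate_fin_two]

lemma adjugate_inj {A B : Matrix (Fin 2) (Fin 2) (Zq p k)} (h : A.adjugate = B.adjugate) :
    A = B := by
  have := congrArg Matrix.adjugate h
  simpa [Matrix.adjugate_adjugate'] using this

/-- The adjugate of an element of `K`. -/
def adjK (u : GrpK p k) : GrpK p k :=
  Matrix.GeneralLinearGroup.mk'' (u : Matrix (Fin 2) (Fin 2) (Zq p k)).adjugate (by
    rw [Matrix.det_adjugate]
    exact ((Matrix.isUnit_iff_isUnit_det _).mp u.isUnit).pow _)

lemma coe_adjK (u : GrpK p k) : (adjK u : Matrix (Fin 2) (Fin 2) (Zq p k))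
    = (u : Matrix (Fin 2) (Fin 2) (Zq p k)).adjugate := rfl

/-- The inverse of a representative `y` is `p⁻¹` times its adjugate, which accounts for the exponent
`j - 1`. -/
lemma coe_of_mul_heckeG_eq {g : GrpG p k} {s : Option k} {j : ℤ} {u : GrpK p k}
    (hu : g * heckeG p s = scalarP p k ^ j * incl p k u) :
    (g : Matrix (Fin 2) (Fin 2) (Qq p k)) = algebraMap (Zq p k) (Qq p k) p ^ (j - 1) •
      ((u : Matrix (Fin 2) (Fin 2) (Zq p k)) * heckeAdj s).map (algebraMap (Zq p k) (Qq p k)) := by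
  have h3 := coe_eq_of_eq_scalarP_zpow_mul hu
  simp only [Units.val_mul, coe_heckeG, coe_incl] at h3
  have h4 := congrArg (fun M => M * (heckeAdj s).map (algebraMap (Zq p k) (Qq p k))) h3
  simp only [mul_assoc, Matrix.smul_mul, ← Matrix.map_mul] at h4
  have h5 : heckeMat p s * heckeAdj s = (p : Zq p k) • 1 := by
    rw [heckeAdj, Matrix.mul_adjugate, det_heckeMat]
  have h6 : ((p : Zq p k) • (1 : Matrix (Fin 2) (Fin 2) (Zq p k))).map
      (algebraMap (Zq p k) (Qq p k)) = algebraMap (Zq p k) (Qq p k) p • 1 := by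
    ext i j
    fin_cases i <;> fin_cases j <;> simp
  rw [h5, h6, Matrix.mul_smul, mul_one] at h4
  have h7 := congrArg (fun M => (algebraMap (Zq p k) (Qq p k) p)⁻¹ • M) h4
  simp only [smul_smul, inv_mul_cancel₀ (algebraMap_p_ne_zero p k), one_smul] at h7
  rw [h7, zpow_sub_one₀ (algebraMap_p_ne_zero p k), mul_comm]

variable [Fintype k]

/-- The value of `T [1, v]` at an integral matrix `m` whose determinant has valuation one is
`m · v`; on the other cosets of `Z` it is zero. -/
lemma hecke_el (v : SymV R r) : hecke ι r (el ι r v)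
    = ∑ s : Option k, cIndRep ι r (heckeG p s) (el ι r (symRep ι r (heckeAdj s) v)) := by
  classical
  apply Subtype.ext
  funext g
  rw [AddSubmonoidClass.coe_finsetSum, Finset.sum_apply]
  change heckeFun ι r (elFun ι r v) g
    = ∑ s : Option k, elFun ι r (symRep ι r (heckeAdj s) v) (g * heckeG p s)
  rw [heckeFun, finsum_eq_sum_of_fintype]
  by_cases hP : ∃ (n : ℤ) (m : Matrix (Fin 2) (Fin 2) (Zq p k)) (e : (Zq p k)ˣ),
      m.det = (p : Zq p k) * e ∧ (g : Matrix (Fin 2) (Fin 2) (Qq p k))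
        = algebraMap (Zq p k) (Qq p k) p ^ n • m.map (algebraMap (Zq p k) (Qq p k))
  · obtain ⟨n, m, e, hm, hg⟩ := hP
    -- Only one coset contributes on either side. On the left it comes from a factorization `m = y
    -- κ` with `y` a representative and `κ ∈ K`; on the right from `m = κ' (p y⁻¹)`, obtained by
    -- factoring the adjugate of `m`.
    trans symRep ι r m v
    · obtain ⟨s, κ, hs⟩ := exists_heckeMat_mul m e hm
      have h1 : (heckeG p s)⁻¹ * g = scalarP p k ^ n * incl p k κ := by
        rw [inv_mul_eq_iff_eq_mul, ← mul_assoc, ← scalarP_zpow_mul, mul_assoc]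
        apply Units.ext
        rw [coe_scalarP_zpow_mul, hg, Units.val_mul, coe_heckeG, coe_incl, ← Matrix.map_mul, hs]
      rw [Finset.sum_eq_single s, elFun_of ι r n κ h1, hs, map_mul, Module.End.mul_apply]
      · intro t _ hts
        rw [elFun_zero, map_zero]
        intro j u hu
        apply hts
        rw [inv_mul_eq_iff_eq_mul, ← mul_assoc, ← scalarP_zpow_mul, mul_assoc] at hu
        have h2 := coe_eq_of_eq_scalarP_zpow_mul hu
        simp only [Units.val_mul, coe_heckeG, coe_incl, hg, ← Matrix.map_mul] at h2
        obtain ⟨e', he'⟩ := det_coe_isUnit u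
        obtain ⟨-, h3⟩ := zpow_smul_map_inj (d := 1) (e := e) (e' := e') (by rw [hm, pow_one])
          (by rw [Matrix.det_mul, det_heckeMat, pow_one, he']) h2
        refine heckeMat_injective t s (u * κ⁻¹) ?_
        rw [Units.val_mul, ← mul_assoc, ← h3, hs, mul_assoc, Units.mul_inv, mul_one]
      · simp
    · have hm' : m.adjugate.det = (p : Zq p k) * e := by
        rw [Matrix.det_adjugate, hm]; simp
      obtain ⟨s, κ, hs⟩ := exists_heckeMat_mul m.adjugate e hm'
      have hm2 : m = (adjK κ : Matrix (Fin 2) (Fin 2) (Zq p k)) * heckeAdj s := by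
        apply adjugate_inj
        rw [Matrix.adjugate_mul_distrib, heckeAdj, coe_adjK, hs]
        simp [Matrix.adjugate_adjugate']
      have h0 : heckeAdj s * heckeMat p s = (p : Zq p k) • 1 := by
        rw [heckeAdj, Matrix.adjugate_mul, det_heckeMat]
      have h1 : g * heckeG p s = scalarP p k ^ (n + 1) * incl p k (adjK κ) := by
        apply Units.ext
        rw [coe_scalarP_zpow_mul, Units.val_mul, hg, coe_heckeG, coe_incl, Matrix.smul_mul,
          ← Matrix.map_mul, hm2, mul_assoc, h0, zpow_add_one₀ (algebraMap_p_ne_zero p k),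
          ← smul_smul]
        congr 1
        ext i j
        simp
      rw [Finset.sum_eq_single s, elFun_of ι r _ _ h1, hm2, map_mul, Module.End.mul_apply]
      · intro t _ hts
        rw [elFun_zero]
        intro j u hu
        apply hts
        have h2 := coe_of_mul_heckeG_eq hu
        rw [hg] at h2
        obtain ⟨e', he'⟩ := det_coe_isUnit u
        obtain ⟨-, h3⟩ := zpow_smul_map_inj (d := 1) (e := e) (e' := e') (by rw [hm, pow_one])
          (by rw [Matrix.det_mul, heckeAdj, Matrix.det_adjugate, det_heckeMat, he', mul_comm]; simp)
          h2
        have h4 := congrArg Matrix.adjugate h3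
        rw [Matrix.adjugate_mul_distrib, heckeAdj, Matrix.adjugate_adjugate', hs,
          ← coe_adjK] at h4
        simp only [Fintype.card_fin, Nat.sub_self, pow_zero, one_smul] at h4
        refine heckeMat_injective t s (adjK u * κ⁻¹) ?_
        rw [Units.val_mul, ← mul_assoc, ← h4, mul_assoc, Units.mul_inv, mul_one]
      · simp
  · rw [Finset.sum_eq_zero, Finset.sum_eq_zero]
    · intro s _
      rw [elFun_zero]
      intro j u hu
      apply hP
      obtain ⟨e', he'⟩ := det_coe_isUnit u
      refine ⟨j - 1, (u : Matrix (Fin 2) (Fin 2) (Zq p k)) * heckeAdj s, e', ?_, ?_⟩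
      · rw [Matrix.det_mul, heckeAdj, Matrix.det_adjugate, det_heckeMat, he', mul_comm]; simp
      · exact coe_of_mul_heckeG_eq hu
    · intro s _
      rw [elFun_zero, map_zero]
      intro j u hu
      apply hP
      obtain ⟨e', he'⟩ := det_coe_isUnit u
      refine ⟨j, heckeMat p s * (u : Matrix (Fin 2) (Fin 2) (Zq p k)), e', ?_, ?_⟩
      · rw [Matrix.det_mul, det_heckeMat, he']
      · rw [inv_mul_eq_iff_eq_mul, ← mul_assoc, ← scalarP_zpow_mul, mul_assoc] at hu
        rw [hu, coe_scalarP_zpow_mul, Units.val_mul, coe_heckeG, coe_incl, ← Matrix.map_mul]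

end Fun

end Elementary

end GL2Red
end

noncomputable section

namespace GL2Red

/-! ### Functions in a principal series, restricted to the big cell -/

section PrincipalSeries

variable {p : ℕ} [Fact p.Prime] {k : Type} [Field k] [CharP k p] [Finite k]

/-- The matrix `(1 b; 0 1)` in `K`. -/
def upK (b : Zq p k) : GrpK p k := Matrix.GeneralLinearGroup.mk'' !![1, b; 0, 1] (by simp)

/-- The matrix `(1 0; b 1)` in `K`. -/
def loK (b : Zq p k) : GrpK p k := Matrix.GeneralLinearGroup.mk'' !![1, 0; b, 1] (by simp)

/-- The matrix `(0 1; 1 0)` in `K`. -/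
def wK : GrpK p k := Matrix.GeneralLinearGroup.mk'' !![0, 1; 1, 0] (by simp)

lemma coe_upK (b : Zq p k) : (upK b : Matrix (Fin 2) (Fin 2) (Zq p k)) = !![1, b; 0, 1] := rfl

lemma coe_loK (b : Zq p k) : (loK b : Matrix (Fin 2) (Fin 2) (Zq p k)) = !![1, 0; b, 1] := rfl

lemma coe_wK : ((wK : GrpK p k) : Matrix (Fin 2) (Fin 2) (Zq p k)) = !![0, 1; 1, 0] := rfl

/-- The matrix `(1 b; 0 1)` in `G`. -/
def upG (b : Qq p k) : GrpG p k := borel 1 1 b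

/-- The matrix `(1 0; b 1)` in `G`. -/
def loG (b : Qq p k) : GrpG p k :=
  Matrix.GeneralLinearGroup.mkOfDetNeZero !![1, 0; b, 1] (by simp)

/-- The matrix `(0 1; 1 0)` in `G`. -/
def wG : GrpG p k := Matrix.GeneralLinearGroup.mkOfDetNeZero !![0, 1; 1, 0] (by simp)

/-- `p` as a unit of `ℚ_q`. -/
def pU : (Qq p k)ˣ := Units.mk0 (algebraMap (Zq p k) (Qq p k) p) (algebraMap_p_ne_zero p k)

lemma coe_borel (a d : (Qq p k)ˣ) (b : Qq p k) :
    (borel a d b : Matrix (Fin 2) (Fin 2) (Qq p k)) = !![(a : Qq p k), b; 0, (d : Qq p k)] := rfl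

lemma coe_upG (b : Qq p k) : (upG b : Matrix (Fin 2) (Fin 2) (Qq p k)) = !![1, b; 0, 1] := rfl

lemma coe_loG (b : Qq p k) : (loG b : Matrix (Fin 2) (Fin 2) (Qq p k)) = !![1, 0; b, 1] := rfl

lemma coe_wG : ((wG : GrpG p k) : Matrix (Fin 2) (Fin 2) (Qq p k)) = !![0, 1; 1, 0] := rfl

lemma coe_pU : ((pU : (Qq p k)ˣ) : Qq p k) = algebraMap (Zq p k) (Qq p k) p := rfl

lemma incl_upK (b : Zq p k) : incl p k (upK b) = upG (algebraMap _ _ b) := by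
  apply Units.ext
  rw [coe_incl, coe_upK, coe_upG]
  ext i j; fin_cases i <;> fin_cases j <;> simp

lemma incl_loK (b : Zq p k) : incl p k (loK b) = loG (algebraMap _ _ b) := by
  apply Units.ext
  rw [coe_incl, coe_loK, coe_loG]
  ext i j; fin_cases i <;> fin_cases j <;> simp

lemma upG_mul (a b : Qq p k) : (upG a * upG b : GrpG p k) = upG (a + b) := by
  apply Units.ext
  simp [coe_upG, add_comm]

lemma upG_zero : (upG 0 : GrpG p k) = 1 := by
  apply Units.ext
  rw [coe_upG, Units.val_one, Matrix.one_fin_two]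

lemma upG_pow (b : Qq p k) (n : ℕ) : (upG b : GrpG p k) ^ n = upG ((n : Qq p k) * b) := by
  induction n with
  | zero => simp [upG_zero]
  | succ n ih => rw [pow_succ, ih, upG_mul]; congr 1; push_cast; ring

/-- The point `x ≠ 0` of the big cell seen in the chart around `1`: large `x` correspond to lower
unipotents close to `1`. -/
lemma wG_mul_upG (x : (Qq p k)ˣ) :
    (wG * upG x : GrpG p k) = borel (-x⁻¹) x 1 * loG (x⁻¹ : (Qq p k)ˣ) := by
  apply Units.ext
  simp [coe_upG, coe_wG, coe_borel, coe_loG]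

lemma wG_mul_loG (y : Qq p k) : (wG * loG y : GrpG p k) = upG y * wG := by
  apply Units.ext
  simp [coe_upG, coe_wG, coe_loG]

/-- Lets invariance under integral unipotents of both kinds be transported from `1` to `w`. -/
lemma loG_mul_upG_mul_loG : (loG 1 * upG (-1) * loG 1 : GrpG p k) = borel (-1) 1 0 * wG := by
  apply Units.ext
  simp [coe_upG, coe_wG, coe_loG, coe_borel]

lemma wG_mul_wG : (wG * wG : GrpG p k) = 1 := by
  apply Units.ext
  simp [coe_wG, Matrix.one_fin_two]

lemma wG_mul_upG_mul_borel (a d : (Qq p k)ˣ) (x : Qq p k) :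
    (wG * upG x * borel a d 0 : GrpG p k) = borel d a 0 * (wG * upG (x * (d : Qq p k) / (a : Qq p k))) := by
  apply Units.ext
  simp [coe_upG, coe_wG, coe_borel]
  field_simp

lemma heckeG_some (lam : k) : (heckeG p (some lam) : GrpG p k)
    = borel pU 1 (algebraMap _ _ (WittVector.teichmuller p lam)) := by
  apply Units.ext
  rw [coe_heckeG, coe_borel, coe_pU]
  ext i j; fin_cases i <;> fin_cases j <;> simp [heckeMat]

lemma heckeG_none : (heckeG p (none : Option k) : GrpG p k) = borel 1 pU 0 := by
  apply Units.ext
  rw [coe_heckeG, coe_borel, coe_pU]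
  ext i j; fin_cases i <;> fin_cases j <;> simp [heckeMat]

/-- Used to evaluate `U_p f` at `w`: the term of `λ` is a multiple of the value of `f` at the point
`[λ] / p` of the big cell. -/
lemma wG_mul_heckeG_some (lam : k) : (wG * heckeG p (some lam) : GrpG p k)
    = borel 1 pU 0 * (wG * upG (algebraMap (Zq p k) (Qq p k) (WittVector.teichmuller p lam)
      / algebraMap (Zq p k) (Qq p k) p)) := by
  rw [heckeG_some]
  apply Units.ext
  have := algebraMap_p_ne_zero p k
  simp only [Units.val_mul, coe_upG, coe_wG, coe_borel, coe_pU]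
  ext i j; fin_cases i <;> fin_cases j <;> simp [Matrix.mul_apply]
  rw [map_natCast] at this
  field_simp

/-- Bruhat decomposition. -/
lemma bruhat (g : GrpG p k) : (∃ a d b, g = borel a d b) ∨
    ∃ a d b x, g = borel a d b * (wG * upG x) := by
  have hdet : (g : Matrix (Fin 2) (Fin 2) (Qq p k)).det ≠ 0 :=
    ((Matrix.isUnit_iff_isUnit_det _).mp g.isUnit).ne_zero
  rw [Matrix.det_fin_two] at hdet
  by_cases hc : (g : Matrix (Fin 2) (Fin 2) (Qq p k)) 1 0 = 0
  · left
    rw [hc, mul_zero, sub_zero] at hdet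
    refine ⟨Units.mk0 _ (left_ne_zero_of_mul hdet), Units.mk0 _ (right_ne_zero_of_mul hdet),
      (g : Matrix (Fin 2) (Fin 2) (Qq p k)) 0 1, ?_⟩
    apply Units.ext
    rw [coe_borel]
    ext i j; fin_cases i <;> fin_cases j <;> simp [hc]
  · right
    refine ⟨Units.mk0 (-((g : Matrix (Fin 2) (Fin 2) (Qq p k)) 0 0
        * (g : Matrix (Fin 2) (Fin 2) (Qq p k)) 1 1 - (g : Matrix (Fin 2) (Fin 2) (Qq p k)) 0 1
        * (g : Matrix (Fin 2) (Fin 2) (Qq p k)) 1 0) / (g : Matrix (Fin 2) (Fin 2) (Qq p k)) 1 0)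
        (div_ne_zero (neg_ne_zero.mpr hdet) hc), Units.mk0 _ hc,
      (g : Matrix (Fin 2) (Fin 2) (Qq p k)) 0 0, (g : Matrix (Fin 2) (Fin 2) (Qq p k)) 1 1
        / (g : Matrix (Fin 2) (Fin 2) (Qq p k)) 1 0, ?_⟩
    apply Units.ext
    rw [Units.val_mul, Units.val_mul, coe_borel, coe_wG, coe_upG]
    ext i j
    fin_cases i <;> fin_cases j <;> simp [Matrix.mul_apply, Fin.sum_univ_two] <;> field_simp
    ring

lemma congrOne_upK {n : ℕ} {b : Zq p k} (hb : (p : Zq p k) ^ n ∣ b) : CongrOne p k n (upK b) := by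
  intro i j
  rw [coe_upK]
  fin_cases i <;> fin_cases j <;> simp [hb]

lemma congrOne_loK {n : ℕ} {b : Zq p k} (hb : (p : Zq p k) ^ n ∣ b) : CongrOne p k n (loK b) := by
  intro i j
  rw [coe_loK]
  fin_cases i <;> fin_cases j <;> simp [hb]

lemma isInteger_or (N : ℕ) (x : Qq p k) :
    (∃ z : Zq p k, algebraMap (Zq p k) (Qq p k) p ^ N * x = algebraMap _ _ z) ∨
    (x ≠ 0 ∧ ∃ z : Zq p k, x⁻¹ = algebraMap _ _ ((p : Zq p k) ^ N * z)) := by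
  by_cases hx : x = 0
  · exact Or.inl ⟨0, by simp [hx]⟩
  rcases ValuationRing.isInteger_or_isInteger (Zq p k)
    (algebraMap (Zq p k) (Qq p k) p ^ N * x) with ⟨z, hz⟩ | ⟨z, hz⟩
  · exact Or.inl ⟨z, hz.symm⟩
  · refine Or.inr ⟨hx, z, ?_⟩
    have := pow_ne_zero N (algebraMap_p_ne_zero p k)
    rw [map_mul, hz, map_pow, mul_inv, mul_inv_cancel_left₀ this]

variable (p k) in
-- Expansions with Teichmüller digits of length `m` give finitely many representatives.
lemma finite_quotient_pow (m : ℕ) : Finite (Zq p k ⧸ Ideal.span {(p : Zq p k) ^ m}) := by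
  classical
  have := Fintype.ofFinite k
  have key : ∃ s : Finset (Zq p k), ∀ b, ∃ c ∈ s, (p : Zq p k) ^ m ∣ b - c := by
    induction m with
    | zero => exact ⟨{0}, fun b => ⟨0, by simp, by simp⟩⟩
    | succ m ih =>
      obtain ⟨s, hs⟩ := ih
      refine ⟨(s ×ˢ (Finset.univ : Finset k)).image
        fun x => x.1 + (p : Zq p k) ^ m * WittVector.teichmuller p x.2, fun b => ?_⟩
      obtain ⟨c, hc, z, hz⟩ := hs b
      refine ⟨c + (p : Zq p k) ^ m * WittVector.teichmuller p (z.coeff 0),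
        Finset.mem_image.mpr ⟨(c, z.coeff 0), by simp [hc], rfl⟩, ?_⟩
      have h1 : (p : Zq p k) ∣ z - WittVector.teichmuller p (z.coeff 0) := by
        rw [dvd_iff_coeff, ← WittVector.constantCoeff_apply, map_sub]
        simp
      obtain ⟨y, hy⟩ := h1
      refine ⟨y, ?_⟩
      rw [pow_succ, mul_assoc, ← hy, mul_sub, ← hz]
      ring
  obtain ⟨s, hs⟩ := key
  refine Finite.of_surjective (fun c : s => Ideal.Quotient.mk (Ideal.span {(p : Zq p k) ^ m}) c.1) ?_
  intro x
  obtain ⟨b, rfl⟩ := Ideal.Quotient.mk_surjective x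
  obtain ⟨c, hc, h⟩ := hs b
  exact ⟨⟨c, hc⟩, (Ideal.Quotient.eq.mpr (Ideal.mem_span_singleton.mpr h)).symm⟩

variable {F : Type} [Field F] {χ₁ χ₂ : (Qq p k)ˣ →* Fˣ}

lemma princ_borel {f : GrpG p k → F} (hf : f ∈ princ χ₁ χ₂) (a d : (Qq p k)ˣ) (b : Qq p k)
    (g : GrpG p k) : f (borel a d b * g) = χ₁ a * χ₂ d * f g := hf.1 a d b g

lemma princ_upG_mul {f : GrpG p k → F} (hf : f ∈ princ χ₁ χ₂) (b : Qq p k) (g : GrpG p k) :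
    f (upG b * g) = f g := by
  rw [upG, princ_borel hf]; simp

lemma princ_borel_one {f : GrpG p k → F} (hf : f ∈ princ χ₁ χ₂) (a d : (Qq p k)ˣ) (b : Qq p k) :
    f (borel a d b) = χ₁ a * χ₂ d * f 1 := by
  rw [← princ_borel hf a d b 1, mul_one]

lemma transRep_mem_princ {f : GrpG p k → F} (hf : f ∈ princ χ₁ χ₂) (g : GrpG p k) :
    transRep F (GrpG p k) F g f ∈ princ χ₁ χ₂ :=
  (princRep χ₁ χ₂ g ⟨f, hf⟩).2

lemma princ_ext {f f' : GrpG p k → F} (hf : f ∈ princ χ₁ χ₂) (hf' : f' ∈ princ χ₁ χ₂)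
    (h1 : f 1 = f' 1) (h2 : ∀ x, f (wG * upG x) = f' (wG * upG x)) : f = f' := by
  funext g
  rcases bruhat g with ⟨a, d, b, rfl⟩ | ⟨a, d, b, x, rfl⟩
  · rw [princ_borel_one hf, princ_borel_one hf', h1]
  · rw [princ_borel hf, princ_borel hf', h2]

/-- If `f` is invariant under level `p ^ N` and `x⁻¹ ∈ p ^ N ℤ_q`, then `wG_mul_upG` makes the value
at `x` a multiple of `f 1 = 0`. The same `N` serves for the support and for the invariance. -/
lemma exists_support {f : GrpG p k → F} (hf : f ∈ princ χ₁ χ₂) (h1 : f 1 = 0) :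
    ∃ N : ℕ, (∀ x, f (wG * upG x) ≠ 0 →
      ∃ z : Zq p k, algebraMap (Zq p k) (Qq p k) p ^ N * x = algebraMap _ _ z) ∧
      ∀ b g, f (g * upG (algebraMap _ _ ((p : Zq p k) ^ N * b))) = f g := by
  obtain ⟨N, hN⟩ := hf.2
  refine ⟨N, fun x hx => ?_, fun b g => ?_⟩
  · rcases isInteger_or N x with h | ⟨hx0, z, hz⟩
    · exact h
    · refine absurd ?_ hx
      have h2 := wG_mul_upG (Units.mk0 x hx0)
      rw [Units.val_mk0] at h2
      rw [h2, princ_borel hf, ← one_mul (loG _), Units.val_inv_eq_inv_val, Units.val_mk0, hz,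
        ← incl_loK, hN _ (congrOne_loK (dvd_mul_right _ _)), h1, mul_zero]
  · rw [← incl_upK, hN _ (congrOne_upK (dvd_mul_right _ _))]

/-- The function `f ∈ Ind` vanishes at `1` and its restriction to the big cell is supported on
`ℤ_q`. -/
def IsIntSupp (f : GrpG p k → F) : Prop :=
  f 1 = 0 ∧ ∀ x, f (wG * upG x) ≠ 0 → ∃ z : Zq p k, x = algebraMap _ _ z

lemma transRep_borel_bigCell {f : GrpG p k → F} (hf : f ∈ princ χ₁ χ₂) (a d : (Qq p k)ˣ)
    (x : Qq p k) : transRep F (GrpG p k) F (borel a d 0) f (wG * upG x)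
      = χ₁ d * χ₂ a * f (wG * upG (x * (d : Qq p k) / (a : Qq p k))) := by
  rw [transRep_apply, wG_mul_upG_mul_borel, princ_borel hf]

/-- A power of the torus element `(p 0; 0 1)` rescales the bounded support into `ℤ_q`. -/
lemma exists_isIntSupp {f : GrpG p k → F} (hf : f ∈ princ χ₁ χ₂) (h1 : f 1 = 0) :
    ∃ g : GrpG p k, IsIntSupp (transRep F (GrpG p k) F g f) := by
  obtain ⟨N, hN, -⟩ := exists_support hf h1
  refine ⟨borel (pU ^ N) 1 0, ?_, fun x hx => ?_⟩
  · rw [transRep_apply, one_mul, princ_borel_one hf, h1, mul_zero]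
  · rw [transRep_borel_bigCell hf] at hx
    obtain ⟨z, hz⟩ := hN _ (right_ne_zero_of_mul hx)
    refine ⟨z, ?_⟩
    rw [← hz, Units.val_pow_eq_pow_val, coe_pU, Units.val_one, mul_one,
      mul_div_cancel₀ _ (pow_ne_zero N (algebraMap_p_ne_zero p k))]

/-- A nonzero sum of differences of translates that is invariant under `N(ℤ_q)`. -/
lemma exists_invariant [CharP F p] {A : Submodule F (GrpG p k → F)}
    (hA : ∀ g, ∀ f ∈ A, transRep F (GrpG p k) F g f ∈ A) (hle : A ≤ princ χ₁ χ₂) {f : GrpG p k → F}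
    (hf : f ∈ A) (hf0 : f ≠ 0) (hs : IsIntSupp f) : ∃ f' ∈ A, f' ≠ 0 ∧ IsIntSupp f' ∧
      ∀ b : Zq p k, transRep F (GrpG p k) F (upG (algebraMap _ _ b)) f' = f' := by
  classical
  obtain ⟨m, -, hm⟩ := exists_support (hle hf) hs.1
  let U : Zq p k → Module.End F (GrpG p k → F) := fun b => transRep F (GrpG p k) F (upG (algebraMap _ _ b))
  have hU : ∀ a b f, U a (U b f) = U (a + b) f := by
    intro a b f
    simp only [U]
    rw [← Module.End.mul_apply, ← map_mul, upG_mul, map_add]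
  have hUs : ∀ b f, IsIntSupp f → f ∈ princ χ₁ χ₂ → IsIntSupp (U b f) := by
    intro b f hf hfp
    refine ⟨?_, fun x hx => ?_⟩
    · simp only [U]
      rw [transRep_apply, one_mul, upG, princ_borel_one hfp, hf.1, mul_zero]
    · simp only [U] at hx
      rw [transRep_apply, mul_assoc, upG_mul] at hx
      obtain ⟨z, hz⟩ := hf.2 _ hx
      exact ⟨z - b, by rw [map_sub, ← hz]; ring⟩
  have key : ∀ s : Finset (Zq p k), ∃ f' ∈ A, f' ≠ 0 ∧ IsIntSupp f' ∧
      (∀ b, U ((p : Zq p k) ^ m * b) f' = f') ∧ ∀ b ∈ s, U b f' = f' := by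
    intro s
    induction s using Finset.induction_on with
    | empty => exact ⟨f, hf, hf0, hs, fun b => funext fun g => hm b g, by simp⟩
    | insert b s hb ih =>
      obtain ⟨f', h1, h2, h3, h4, h5⟩ := ih
      have hD : ∀ i : ℕ, ((U b - 1) ^ i) f' ∈ A ∧ IsIntSupp (((U b - 1) ^ i) f') ∧
          (∀ c, U ((p : Zq p k) ^ m * c) (((U b - 1) ^ i) f') = ((U b - 1) ^ i) f') ∧
          ∀ c ∈ s, U c (((U b - 1) ^ i) f') = ((U b - 1) ^ i) f' := by
        intro i
        induction i with
        | zero => exact ⟨h1, h3, h4, h5⟩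
        | succ i ih =>
          obtain ⟨i1, i2, i3, i4⟩ := ih
          rw [pow_succ', Module.End.mul_apply, LinearMap.sub_apply, Module.End.one_apply]
          have hc : ∀ c, U c (((U b - 1) ^ i) f') = ((U b - 1) ^ i) f' →
              U c (U b (((U b - 1) ^ i) f') - ((U b - 1) ^ i) f')
                = U b (((U b - 1) ^ i) f') - ((U b - 1) ^ i) f' := by
            intro c hc
            rw [map_sub, hU, add_comm, ← hU, hc]
          have h6 := hUs b _ i2 (hle i1)
          refine ⟨A.sub_mem (hA _ _ i1) i1, ⟨?_, fun x hx => ?_⟩, fun c => hc _ (i3 c),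
            fun c hcs => hc _ (i4 c hcs)⟩
          · rw [Pi.sub_apply, h6.1, i2.1, sub_zero]
          · by_contra hcon
            refine hx ?_
            rw [Pi.sub_apply, not_not.mp (mt (h6.2 x) hcon), not_not.mp (mt (i2.2 x) hcon),
              sub_zero]
      -- In characteristic `p`, `(U b - 1) ^ (p ^ m) = U (p ^ m b) - 1`, which kills `f'`. The last
      -- nonzero `(U b - 1) ^ i f'` is then fixed by `U b`, and the invariances already obtained
      -- survive since the operators commute.
      have hex : ∃ i : ℕ, ((U b - 1) ^ (i + 1)) f' = 0 := by
        have : CharP (Module.End F (GrpG p k → F)) p := 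
          charP_of_injective_algebraMap (algebraMap F (Module.End F (GrpG p k → F))).injective p
        refine ⟨p ^ m - 1, ?_⟩
        rw [Nat.sub_add_cancel (pow_pos (Fact.out : p.Prime).pos m),
          sub_pow_char_pow_of_commute _ _ (Commute.one_right _), one_pow]
        have h6 : U b ^ p ^ m = U ((p : Zq p k) ^ m * b) := by
          simp only [U]
          rw [← map_pow, upG_pow]
          rw [map_mul, map_pow, map_natCast, Nat.cast_pow]
        rw [LinearMap.sub_apply, h6, h4, Module.End.one_apply, sub_self]
      have hf1 := Nat.find_spec hex
      have hf2 : ((U b - 1) ^ (Nat.find hex)) f' ≠ 0 := by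
        intro h0
        rcases Nat.eq_zero_or_pos (Nat.find hex) with h | h
        · rw [h, pow_zero] at h0
          exact h2 h0
        · refine Nat.find_min hex (Nat.sub_lt h one_pos) ?_
          change ((U b - 1) ^ (Nat.find hex - 1 + 1)) f' = 0
          rw [show Nat.find hex - 1 + 1 = Nat.find hex by omega]
          exact h0
      obtain ⟨i1, i2, i3, i4⟩ := hD (Nat.find hex)
      refine ⟨_, i1, hf2, i2, i3, fun c hc => ?_⟩
      rcases Finset.mem_insert.mp hc with rfl | hc
      · rw [pow_succ', Module.End.mul_apply, LinearMap.sub_apply, Module.End.one_apply,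
          sub_eq_zero] at hf1
        exact hf1
      · exact i4 c hc
  -- Invariance under `p ^ m ℤ_q` is already available, so representatives modulo `p ^ m` suffice.
  have := finite_quotient_pow p k m
  have := Fintype.ofFinite (Zq p k ⧸ Ideal.span {(p : Zq p k) ^ m})
  obtain ⟨f', h1, h2, h3, h4, h5⟩ := key
    (Finset.univ.image fun x : Zq p k ⧸ Ideal.span {(p : Zq p k) ^ m} => x.out)
  refine ⟨f', h1, h2, h3, fun b => ?_⟩
  obtain ⟨c, hc⟩ := Ideal.mem_span_singleton.mp (Ideal.Quotient.eq.mp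
    (Ideal.Quotient.mk_out (Ideal.Quotient.mk (Ideal.span {(p : Zq p k) ^ m}) b)))
  have h6 := h5 _ (Finset.mem_image_of_mem _ (Finset.mem_univ
    (Ideal.Quotient.mk (Ideal.span {(p : Zq p k) ^ m}) b)))
  have h7 := h4 (-c)
  rw [mul_neg, ← hc] at h7
  conv_lhs at h7 => rw [← h6]
  rw [hU, neg_sub, sub_add_cancel] at h7
  exact h7

/-- A stable subspace of a principal series with a nonzero element vanishing at `1` is everything. -/
lemma princ_le [CharP F p] {A : Submodule F (GrpG p k → F)}
    (hA : ∀ g, ∀ f ∈ A, transRep F (GrpG p k) F g f ∈ A) (hle : A ≤ princ χ₁ χ₂) {f : GrpG p k → F}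
    (hf : f ∈ A) (hf0 : f ≠ 0) (hf1 : f 1 = 0) : princ χ₁ χ₂ ≤ A := by
  classical
  have htr : ∀ (g : GrpG p k) (f : GrpG p k → F),
      transRep F (GrpG p k) F g⁻¹ (transRep F (GrpG p k) F g f) = f := by
    intro g f
    rw [← Module.End.mul_apply, ← map_mul, inv_mul_cancel, map_one, Module.End.one_apply]
  have hA' : ∀ (g : GrpG p k) (f : GrpG p k → F), transRep F (GrpG p k) F g f ∈ A → f ∈ A := by
    intro g f h
    rw [← htr g f]
    exact hA _ _ h
  -- On the big cell `e` is the characteristic function of `ℤ_q`: an `N(ℤ_q)`-invariant function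
  -- supported on `ℤ_q` is constant there.
  obtain ⟨e, he, he1, hew, hes⟩ : ∃ e ∈ A, e 1 = 0 ∧
      (∀ z : Zq p k, e (wG * upG (algebraMap _ _ z)) = 1) ∧
      ∀ x, e (wG * upG x) ≠ 0 → ∃ z : Zq p k, x = algebraMap _ _ z := by
    obtain ⟨g, hg⟩ := exists_isIntSupp (hle hf) hf1
    obtain ⟨f', h1, h2, h3, h4⟩ := exists_invariant hA hle (hA g f hf) (fun h => hf0 (by
      rw [← htr g f, h, map_zero])) hg
    have h5 : ∀ z : Zq p k, f' (wG * upG (algebraMap _ _ z)) = f' wG := fun z =>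
      congrFun (h4 z) wG
    have h6 : f' wG ≠ 0 := by
      intro h6
      refine h2 (princ_ext (hle h1) (zero_mem _) h3.1 fun x => ?_)
      by_contra hx
      obtain ⟨z, rfl⟩ := h3.2 x hx
      exact hx (by rw [h5, h6]; rfl)
    refine ⟨(f' wG)⁻¹ • f', A.smul_mem _ h1, by simp [h3.1], fun z => by simp [h5, h6],
      fun x hx => h3.2 x fun h => hx (by simp [h])⟩
  have hzero : ∀ h ∈ princ χ₁ χ₂, h 1 = 0 → h ∈ A := by
    intro h hh h1
    obtain ⟨g, hg⟩ := exists_isIntSupp hh h1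
    refine hA' g h ?_
    have hh' := transRep_mem_princ hh g
    generalize transRep F (GrpG p k) F g h = h' at hg hh'
    obtain ⟨m, -, hm⟩ := exists_support hh' hg.1
    have := finite_quotient_pow p k m
    have := Fintype.ofFinite (Zq p k ⧸ Ideal.span {(p : Zq p k) ^ m})
    let em : GrpG p k → F := transRep F (GrpG p k) F (borel (pU ^ m) 1 0) e
    have hem : em ∈ A := hA _ _ he
    have hem1 : em 1 = 0 := by
      simp only [em]
      rw [transRep_apply, one_mul, princ_borel_one (hle he), he1, mul_zero]
    have hpm := pow_ne_zero m (algebraMap_p_ne_zero p k)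
    have hem2 : ∀ x, em (wG * upG x) = (χ₂ (pU ^ m) : F) *
        e (wG * upG (x / algebraMap (Zq p k) (Qq p k) p ^ m)) := by
      intro x
      simp only [em]
      rw [transRep_borel_bigCell (hle he)]
      rw [map_one, Units.val_one, Units.val_one, Units.val_pow_eq_pow_val, coe_pU, one_mul, mul_one]
    -- A function on `ℤ_q` that is invariant under `p ^ m ℤ_q` is the sum, over the cosets, of its
    -- values times characteristic functions. Up to the factor `χ₂(p ^ m)`, which is divided out,
    -- `em` is the characteristic function of `p ^ m ℤ_q`.
    let t : (Zq p k ⧸ Ideal.span {(p : Zq p k) ^ m}) → GrpG p k → F := fun x =>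
      ((χ₂ (pU ^ m) : F)⁻¹ * h' (wG * upG (algebraMap _ _ x.out))) •
        transRep F (GrpG p k) F (upG (-algebraMap _ _ x.out)) em
    have ht : ∑ x, t x ∈ A := A.sum_mem fun x _ => A.smul_mem _ (hA _ _ hem)
    suffices h' = ∑ x, t x by rw [this]; exact ht
    refine princ_ext hh' (hle ht) ?_ fun x => ?_
    · rw [hg.1, Finset.sum_apply, Finset.sum_eq_zero]
      intro x _
      simp only [t]
      rw [Pi.smul_apply, transRep_apply, one_mul, upG.eq_1 (-_), princ_borel_one (hle hem), hem1]
      simp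
    · rw [Finset.sum_apply]
      have htx : ∀ y, t y (wG * upG x) = h' (wG * upG (algebraMap _ _ y.out)) *
          e (wG * upG ((x - algebraMap _ _ y.out) / algebraMap (Zq p k) (Qq p k) p ^ m)) := by
        intro y
        simp only [t]
        rw [Pi.smul_apply, transRep_apply, mul_assoc, upG_mul, hem2, smul_eq_mul, ← sub_eq_add_neg]
        field_simp
      by_cases hx : ∃ b : Zq p k, x = algebraMap _ _ b
      · obtain ⟨b, rfl⟩ := hx
        rw [Finset.sum_eq_single (Ideal.Quotient.mk (Ideal.span {(p : Zq p k) ^ m}) b)]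
        · obtain ⟨c, hc⟩ := Ideal.mem_span_singleton.mp (Ideal.Quotient.eq.mp
            (Ideal.Quotient.mk_out (Ideal.Quotient.mk (Ideal.span {(p : Zq p k) ^ m}) b)))
          rw [htx]
          have h2 : b - (Ideal.Quotient.mk (Ideal.span {(p : Zq p k) ^ m}) b).out
              = (p : Zq p k) ^ m * (-c) := by
            rw [mul_neg, ← hc]; ring
          rw [← map_sub, h2, map_mul, map_pow, mul_div_cancel_left₀ _ hpm, hew, mul_one,
            ← hm (-c) (wG * upG (algebraMap _ _ (Quotient.out _))), mul_assoc, upG_mul, ← map_add,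
            ← h2, add_sub_cancel]
        · intro y _ hy
          rw [htx]
          by_contra hne
          obtain ⟨z, hz⟩ := hes _ (right_ne_zero_of_mul hne)
          rw [div_eq_iff hpm, ← map_sub, ← map_pow, ← map_mul] at hz
          have h2 := IsFractionRing.injective (Zq p k) (Qq p k) hz
          apply hy
          rw [← Ideal.Quotient.mk_out y, eq_comm, Ideal.Quotient.eq, Ideal.mem_span_singleton, h2]
          exact dvd_mul_left _ _
        · simp
      · rw [not_not.mp (mt (hg.2 x) hx), Finset.sum_eq_zero]
        intro y _
        rw [htx]
        by_contra hne
        obtain ⟨z, hz⟩ := hes _ (right_ne_zero_of_mul hne)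
        rw [div_eq_iff hpm] at hz
        exact hx ⟨z * (p : Zq p k) ^ m + y.out, by
          rw [map_add, map_mul, map_pow, ← hz, sub_add_cancel]⟩
  intro h hh
  -- The translate of `e` by `w` takes the value `e w = 1` at `1`, so it corrects the value of `h`
  -- there.
  have h1 : h - h 1 • transRep F (GrpG p k) F wG e ∈ A := by
    refine hzero _ (sub_mem hh (Submodule.smul_mem _ _ (hle (hA _ _ he)))) ?_
    have h2 := hew 0
    rw [map_zero, upG_zero, mul_one] at h2
    rw [Pi.sub_apply, Pi.smul_apply, transRep_apply, one_mul, h2, smul_eq_mul, mul_one, sub_self]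
  have h2 := A.add_mem h1 (A.smul_mem (h 1) (hA wG _ he))
  rwa [sub_add_cancel] at h2

end PrincipalSeries

end GL2Red
end

noncomputable section

namespace GL2Red

/-! ### Two criteria excluding subquotients of principal series -/

section Subquotient

variable {p : ℕ} [Fact p.Prime] {k : Type} [Field k] [CharP k p] [Finite k]
variable {F : Type} [Field F] {χ₁ χ₂ : (Qq p k)ˣ →* Fˣ}
variable {M : Type} [AddCommGroup M] [Module F M] {V : Type} [AddCommGroup V] [Module F V]

/-- An equivariant embedding of `ρ` into the principal series attached to `χ₁, χ₂`. -/
structure PrincEmbedding (χ₁ χ₂ : (Qq p k)ˣ →* Fˣ) (ρ : Representation F (GrpG p k) M) where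
  /-- the embedding as a linear map to functions -/
  toFun : M →ₗ[F] (GrpG p k → F)
  inj : Function.Injective toFun
  mem : ∀ m, toFun m ∈ princ χ₁ χ₂
  equivariant : ∀ g m x, toFun (ρ g m) x = toFun m (x * g)

/-- The tautological embedding of a subrepresentation. -/
def PrincEmbedding.ofSub (W₁ : Subrepresentation (princRep χ₁ χ₂)) :
    PrincEmbedding (M := W₁.toSubmodule) χ₁ χ₂ W₁.toRepresentation where
  toFun := (princ χ₁ χ₂).subtype ∘ₗ W₁.toSubmodule.subtype
  inj := Subtype.val_injective.comp Subtype.val_injective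
  mem m := m.1.2
  equivariant _ _ _ := rfl

variable {ρ : Representation F (GrpG p k) M} {π : Representation F (GrpG p k) V}

lemma bigCell_eq_zero (j : PrincEmbedding χ₁ χ₂ ρ) {f : M} (h1 : j.toFun f 1 = 0) {x : Qq p k}
    (hx0 : x ≠ 0) (hlo : ρ (loG x⁻¹) f = f) : j.toFun f (wG * upG x) = 0 := by
  have h2 := wG_mul_upG (Units.mk0 x hx0)
  rw [Units.val_mk0] at h2
  have h3 : j.toFun f (1 * loG x⁻¹) = j.toFun f 1 := by rw [← j.equivariant, hlo]
  rw [h2, princ_borel (j.mem f), ← one_mul (loG _), Units.val_inv_eq_inv_val, Units.val_mk0, h3,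
    h1, mul_zero]

lemma PrincEmbedding.eq_zero (j : PrincEmbedding χ₁ χ₂ ρ) {f : M} (h1 : j.toFun f 1 = 0)
    (h2 : ∀ x, j.toFun f (wG * upG x) = 0) : f = 0 := by
  apply j.inj
  rw [map_zero]
  exact princ_ext (j.mem f) (zero_mem _) h1 h2

variable [CharP F p]

section Kernel

variable (j : PrincEmbedding χ₁ χ₂ ρ) {Q : M →ₗ[F] V} (hQ : ∀ g f, Q (ρ g f) = π g (Q f))
  (hV : ∃ f, Q f ≠ 0)

include j hQ hV

/-- Otherwise `princ_le`, applied to the image of the kernel of `Q`, puts all of `M` into the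
kernel. -/
lemma ker_eq_zero_of_one {h : M} (hh : Q h = 0) (h1 : j.toFun h 1 = 0) : h = 0 := by
  by_contra h0
  obtain ⟨f, hf⟩ := hV
  let A : Submodule F (GrpG p k → F) := (LinearMap.ker Q).map j.toFun
  have hA : ∀ g, ∀ f ∈ A, transRep F (GrpG p k) F g f ∈ A := by
    rintro g _ ⟨f, hf, rfl⟩
    refine ⟨ρ g f, ?_, funext fun x => j.equivariant g f x⟩
    change Q _ = 0
    rw [hQ, show Q f = 0 from hf, map_zero]
  have hle : A ≤ princ χ₁ χ₂ := by
    rintro _ ⟨f, -, rfl⟩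
    exact j.mem f
  obtain ⟨f', hf', he⟩ := princ_le hA hle ⟨h, hh, rfl⟩
    (fun h' => h0 (j.inj (by rw [h', map_zero]))) h1 (j.mem f)
  exact hf (j.inj he ▸ hf')

lemma ker_eq_zero_of_wG {h : M} (hh : Q h = 0) (h1 : j.toFun h wG = 0) : h = 0 := by
  have h2 : ρ wG h = 0 := by
    refine ker_eq_zero_of_one j hQ hV (by rw [hQ, hh, map_zero]) ?_
    rw [j.equivariant, one_mul, h1]
  have h3 := congrArg (ρ wG) h2
  rwa [← Module.End.mul_apply, ← map_mul, wG_mul_wG, map_one, Module.End.one_apply, map_zero] at h3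

/-- The difference lies in the kernel of `Q`, and it vanishes at `1` because functions in the
principal series are left invariant under `N`. -/
lemma upG_eq_of_ker {f : M} {b : Qq p k} (hf : π (upG b) (Q f) = Q f) : ρ (upG b) f = f := by
  rw [← sub_eq_zero]
  refine ker_eq_zero_of_one j hQ hV (by rw [map_sub, hQ, hf, sub_self]) ?_
  rw [map_sub, Pi.sub_apply, j.equivariant, one_mul, ← mul_one (upG b), princ_upG_mul (j.mem f),
    sub_self]

/-- As for `upG_eq_of_ker`, with `w` in place of `1`: conjugation by `w` carries `N⁻` to `N`. -/
lemma loG_eq_of_ker {f : M} {b : Qq p k} (hf : π (loG b) (Q f) = Q f) : ρ (loG b) f = f := by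
  rw [← sub_eq_zero]
  refine ker_eq_zero_of_wG j hQ hV (by rw [map_sub, hQ, hf, sub_self]) ?_
  rw [map_sub, Pi.sub_apply, j.equivariant, wG_mul_loG, princ_upG_mul (j.mem f), sub_self]

end Kernel

/-- An element vanishing at `1` that is invariant under `SL₂(ℤ_q)` is zero. -/
lemma eq_zero_of_invariant (j : PrincEmbedding χ₁ χ₂ ρ) {f : M} (h1 : j.toFun f 1 = 0)
    (hup : ∀ b : Zq p k, ρ (upG (algebraMap _ _ b)) f = f)
    (hlo : ∀ b : Zq p k, ρ (loG (algebraMap _ _ b)) f = f) : f = 0 := by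
  have hw : j.toFun f wG = 0 := by
    have h2 : ρ (loG 1 * upG (-1) * loG 1) f = f := by
      have h3 := hlo 1
      have h4 := hup (-1)
      rw [map_neg, map_one] at h4
      rw [map_one] at h3
      rw [map_mul, map_mul, Module.End.mul_apply, Module.End.mul_apply, h3, h4, h3]
    have h3 : j.toFun f (1 * (loG 1 * upG (-1) * loG 1)) = j.toFun f 1 := by
      rw [← j.equivariant, h2]
    rw [one_mul, loG_mul_upG_mul_loG, princ_borel (j.mem f), h1, mul_eq_zero] at h3
    exact h3.resolve_left (by simp)
  refine j.eq_zero h1 fun x => ?_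
  rcases isInteger_or 0 x with ⟨z, hz⟩ | ⟨hx0, z, hz⟩
  · rw [pow_zero, one_mul] at hz
    rw [hz, ← j.equivariant, hup, hw]
  · exact bigCell_eq_zero j h1 hx0 (by rw [hz]; exact hlo _)

lemma exists_model {W : Subrepresentation ρ} (e : π.Equiv (quotRep ρ W)) :
    ∃ Q : M →ₗ[F] V, Function.Surjective Q ∧ ∀ g f, Q (ρ g f) = π g (Q f) := by
  refine ⟨e.symm.toLinearMap ∘ₗ W.toSubmodule.mkQ, ?_, fun g f => ?_⟩
  · exact e.symm.toLinearEquiv.surjective.comp (Submodule.mkQ_surjective _)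
  · exact LinearMap.congr_fun (e.symm.isIntertwining' g) (W.toSubmodule.mkQ f)

variable [Fintype k]

/-- A representation with a nonzero vector `v = n x - x`, `n ∈ N(ℤ_q)`, that is invariant under
`N(ℤ_q)` and `N⁻(p ℤ_q)` and killed by `U_p` is not a quotient of a subrepresentation of a
principal series. -/
theorem isEmpty_equiv_of_Up {v x : V} (hv : v ≠ 0)
    (hup : ∀ b : Zq p k, π (incl p k (upK b)) v = v)
    (hlo : ∀ b : Zq p k, π (incl p k (loK (p * b))) v = v) (b₀ : Zq p k)
    (hx : π (incl p k (upK b₀)) x - x = v) (hU : ∑ lam : k, π (heckeG p (some lam)) v = 0)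
    (j : PrincEmbedding χ₁ χ₂ ρ) (W : Subrepresentation ρ) : IsEmpty (π.Equiv (quotRep ρ W)) := by
  refine ⟨fun e => ?_⟩
  obtain ⟨Q, hsurj, hQ⟩ := exists_model e
  obtain ⟨x', rfl⟩ := hsurj x
  have hV : ∃ f, Q f ≠ 0 := by
    obtain ⟨f, hf⟩ := hsurj v
    exact ⟨f, hf ▸ hv⟩
  obtain ⟨f, hf⟩ : ∃ f, f = ρ (incl p k (upK b₀)) x' - x' := ⟨_, rfl⟩
  have hfv : Q f = v := by rw [hf, map_sub, hQ, hx]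
  -- This is the purpose of writing `v` as `n x - x`: the lift `n x' - x'` vanishes at `1`, which an
  -- arbitrary lift need not do.
  have hf1 : j.toFun f 1 = 0 := by
    rw [hf, map_sub, Pi.sub_apply, j.equivariant, one_mul, incl_upK, ← mul_one (upG _),
      princ_upG_mul (j.mem x'), sub_self]
  have hfup : ∀ b : Zq p k, ρ (upG (algebraMap _ _ b)) f = f := fun b =>
    upG_eq_of_ker j hQ hV (by rw [hfv, ← incl_upK, hup])
  have hflo : ∀ b : Zq p k, ρ (loG (algebraMap _ _ ((p : Zq p k) * b))) f = f := fun b =>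
    loG_eq_of_ker j hQ hV (by rw [hfv, ← incl_loK, hlo])
  -- The sum lies in the kernel of `Q`, and at `1` each term is a multiple of `f 1 = 0`, the
  -- matrices being upper triangular.
  have hfU : ∑ lam : k, ρ (heckeG p (some lam)) f = 0 := by
    refine ker_eq_zero_of_one j hQ hV (by simp_rw [map_sum, hQ, hfv, hU]) ?_
    rw [map_sum, Finset.sum_apply]
    refine Finset.sum_eq_zero fun lam _ => ?_
    rw [j.equivariant, one_mul, heckeG_some, princ_borel_one (j.mem f), hf1, mul_zero]
  -- Evaluate `U_p f = 0` at `w`. For `λ ≠ 0` the relevant point `[λ] / p` has its inverse in `p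
  -- ℤ_q`, so `N⁻(p ℤ_q)`-invariance makes the term zero. The term `λ = 0` is a nonzero multiple of
  -- the value of `f` at `w`.
  have hfw : j.toFun f wG = 0 := by
    have h1 : ∑ lam : k, j.toFun f (wG * heckeG p (some lam)) = 0 := by
      have h2 := congrArg (fun f => j.toFun f wG) hfU
      simpa only [map_sum, Finset.sum_apply, j.equivariant, map_zero, Pi.zero_apply] using h2
    rw [Finset.sum_eq_single (0 : k)] at h1
    · rw [wG_mul_heckeG_some, WittVector.teichmuller_zero, map_zero, zero_div, upG_zero, mul_one,
        princ_borel (j.mem f), mul_eq_zero] at h1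
      exact h1.resolve_left (by simp)
    · intro lam _ hlam
      rw [wG_mul_heckeG_some, princ_borel (j.mem f), bigCell_eq_zero j hf1, mul_zero]
      · refine div_ne_zero (fun h => hlam ?_) (algebraMap_p_ne_zero p k)
        have h2 := (map_eq_zero_iff _ (IsFractionRing.injective (Zq p k) (Qq p k))).mp h
        have h3 := congrArg (fun x : Zq p k => x.coeff 0) h2
        simpa using h3
      · have h2 : (algebraMap (Zq p k) (Qq p k) (WittVector.teichmuller p lam)
            / algebraMap (Zq p k) (Qq p k) p)⁻¹
            = algebraMap _ _ ((p : Zq p k) * WittVector.teichmuller p lam⁻¹) := by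
          rw [inv_div, map_mul, div_eq_mul_inv]
          congr 1
          refine inv_eq_of_mul_eq_one_right ?_
          rw [← map_mul, ← map_mul, mul_inv_cancel₀ hlam, map_one, map_one]
        rw [h2, hflo]
    · simp
  have hf0 : f = 0 := by
    refine j.eq_zero hf1 fun x => ?_
    rcases isInteger_or 0 x with ⟨z, hz⟩ | ⟨hx0, z, hz⟩
    · rw [pow_zero, one_mul] at hz
      rw [hz, ← j.equivariant, hfup, hfw]
    · rw [pow_zero, one_mul] at hz
      -- Here `x⁻¹ = z` is integral. If it is a unit, `x` is integral and `N(ℤ_q)` moves the point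
      -- to `w`; otherwise `N⁻(p ℤ_q)` applies.
      by_cases hzu : IsUnit z
      · obtain ⟨u, rfl⟩ := hzu
        have hx : x = algebraMap _ _ ((u⁻¹ : (Zq p k)ˣ) : Zq p k) := by
          rw [← inv_inv x, hz]
          refine inv_eq_of_mul_eq_one_right ?_
          rw [← map_mul, Units.mul_inv, map_one]
        rw [hx, ← j.equivariant, hfup, hfw]
      · rw [isUnit_iff_coeff, not_not, ← dvd_iff_coeff] at hzu
        obtain ⟨y, rfl⟩ := hzu
        exact bigCell_eq_zero j hf1 hx0 (by rw [hz, hflo])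
  exact hv (by rw [← hfv, hf0, map_zero])

/-- A representation with a nonzero vector that is invariant under `SL₂(ℤ_q)` and killed by `T` is
not a quotient of a subrepresentation of a principal series. -/
theorem isEmpty_equiv_of_spherical {v : V} (hv : v ≠ 0)
    (hup : ∀ b : Zq p k, π (incl p k (upK b)) v = v)
    (hlo : ∀ b : Zq p k, π (incl p k (loK b)) v = v)
    (hT : ∑ s : Option k, π (heckeG p s) v = 0) (hcard : (Fintype.card k : F) = 0)
    (j : PrincEmbedding χ₁ χ₂ ρ) (W : Subrepresentation ρ) : IsEmpty (π.Equiv (quotRep ρ W)) := by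
  refine ⟨fun e => ?_⟩
  obtain ⟨Q, hsurj, hQ⟩ := exists_model e
  obtain ⟨f, rfl⟩ := hsurj v
  have hV : ∃ f, Q f ≠ 0 := ⟨f, hv⟩
  have hfup : ∀ b : Zq p k, ρ (upG (algebraMap _ _ b)) f = f := fun b =>
    upG_eq_of_ker j hQ hV (by rw [← incl_upK, hup])
  have hflo : ∀ b : Zq p k, ρ (loG (algebraMap _ _ b)) f = f := fun b =>
    loG_eq_of_ker j hQ hV (by rw [← incl_loK, hlo])
  obtain ⟨h, hh⟩ : ∃ h, h = ∑ s : Option k, ρ (heckeG p s) f := ⟨_, rfl⟩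
  have hQh : Q h = 0 := by rw [hh, map_sum]; simp_rw [hQ]; exact hT
  -- The `q` terms with `λ ∈ k` contribute equally, hence zero in characteristic `p`; only the
  -- matrix `(1 0; 0 p)` remains.
  have hh1 : j.toFun h 1 = χ₂ pU * j.toFun f 1 := by
    rw [hh, Fintype.sum_option, map_add, map_sum, Pi.add_apply, Finset.sum_apply]
    simp_rw [j.equivariant, one_mul, heckeG_none, heckeG_some, princ_borel_one (j.mem f)]
    rw [Finset.sum_const, Finset.card_univ, nsmul_eq_mul, hcard]
    simp
  -- The element `h` lies in the kernel of `Q`, so its image is trivially invariant and `h` itself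
  -- is invariant under the integral unipotents. Then `h - χ₂(p) f` is an invariant element
  -- vanishing at `1`.
  have hdiff : h = (χ₂ pU : F) • f := by
    rw [← sub_eq_zero]
    refine eq_zero_of_invariant j ?_ (fun b => ?_) (fun b => ?_)
    · rw [map_sub, map_smul, Pi.sub_apply, Pi.smul_apply, hh1, smul_eq_mul, sub_self]
    · rw [map_sub, map_smul, hfup, upG_eq_of_ker j hQ hV (by rw [hQh, map_zero])]
    · rw [map_sub, map_smul, hflo, loG_eq_of_ker j hQ hV (by rw [hQh, map_zero])]
  rw [hdiff, map_smul, smul_eq_zero] at hQh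
  exact hQh.elim (by simp) hv

/-- Criterion for an irreducible representation to be supercuspidal. -/
theorem isSupercuspidal_of_Up (hirr : π.IsIrreducible) (hsm : IsSmooth π) {v x : V} (hv : v ≠ 0)
    (hup : ∀ b : Zq p k, π (incl p k (upK b)) v = v)
    (hlo : ∀ b : Zq p k, π (incl p k (loK (p * b))) v = v) (b₀ : Zq p k)
    (hx : π (incl p k (upK b₀)) x - x = v) (hU : ∑ lam : k, π (heckeG p (some lam)) v = 0) :
    IsSupercuspidal π :=
  ⟨hirr, hsm, fun _ _ _ _ W₁ W₂ =>
    isEmpty_equiv_of_Up (M := W₁.toSubmodule) hv hup hlo b₀ hx hU (PrincEmbedding.ofSub W₁) W₂⟩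

/-- Criterion for an irreducible representation to be supercuspidal. -/
theorem isSupercuspidal_of_spherical (hirr : π.IsIrreducible) (hsm : IsSmooth π) {v : V}
    (hv : v ≠ 0) (hup : ∀ b : Zq p k, π (incl p k (upK b)) v = v)
    (hlo : ∀ b : Zq p k, π (incl p k (loK b)) v = v)
    (hT : ∑ s : Option k, π (heckeG p s) v = 0) (hcard : (Fintype.card k : F) = 0) :
    IsSupercuspidal π :=
  ⟨hirr, hsm, fun _ _ _ _ W₁ W₂ =>
    isEmpty_equiv_of_spherical (M := W₁.toSubmodule) hv hup hlo hT hcard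
      (PrincEmbedding.ofSub W₁) W₂⟩

end Subquotient

end GL2Red
end

noncomputable section

namespace GL2Red

/-! ### Functoriality of compact induction in the coefficients -/

section Post

variable {p : ℕ} [Fact p.Prime] {k : Type} [Field k] [CharP k p] {f f' : ℕ}
variable {R R' : Type} [CommRing R] [CommRing R'] {ι : Zq p k →+* R} {ι' : Zq p k →+* R'}
variable {r : Fin f → ℕ} {r' : Fin f' → ℕ}

/-- The map on compact inductions induced by an equivariant map on coefficients. -/
def cIndPost (t : SymV R r →+ SymV R' r')
    (ht : ∀ m v, t (symRep ι r m v) = symRep ι' r' m (t v)) : cInd ι r →+ cInd ι' r' where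
  toFun φ := ⟨fun g => t (φ.1 g), fun u g => by dsimp only; rw [φ.2.1, ht],
    fun g => by dsimp only; rw [φ.2.2.1], by
    obtain ⟨S, hS⟩ := φ.2.2.2
    exact ⟨S, fun g hg => hS g fun h => hg (by dsimp only; rw [h, map_zero])⟩⟩
  map_zero' := Subtype.ext (funext fun _ => map_zero t)
  map_add' φ ψ := Subtype.ext (funext fun _ => map_add t _ _)

variable (t : SymV R r →+ SymV R' r') (ht : ∀ m v, t (symRep ι r m v) = symRep ι' r' m (t v))

lemma cIndPost_cIndRep (g : GrpG p k) (φ : cInd ι r) :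
    cIndPost t ht (cIndRep ι r g φ) = cIndRep ι' r' g (cIndPost t ht φ) := rfl

lemma cIndPost_smul {c : R} {c' : R'} (h : ∀ v, t (c • v) = c' • t v) (φ : cInd ι r) :
    cIndPost t ht (c • φ) = c' • cIndPost t ht φ :=
  Subtype.ext (funext fun _ => h _)

variable [Finite k]

lemma cIndPost_hecke (φ : cInd ι r) :
    cIndPost t ht (hecke ι r φ) = hecke ι' r' (cIndPost t ht φ) := by
  apply Subtype.ext
  funext g
  change t (heckeFun ι r φ.1 g) = heckeFun ι' r' (fun g => t (φ.1 g)) g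
  rw [heckeFun, heckeFun, map_finsum _ (Set.toFinite _)]
  simp_rw [ht]

lemma cIndPost_el (v : SymV R r) : cIndPost t ht (el ι r v) = el ι' r' (t v) := by
  apply Subtype.ext
  funext g
  change t (elFun ι r v g) = elFun ι' r' (t v) g
  by_cases h : ∃ (n : ℤ) (u : GrpK p k), g = scalarP p k ^ n * incl p k u
  · obtain ⟨n, u, hn⟩ := h
    rw [elFun_of ι r n u hn, elFun_of ι' r' n u hn, ht]
  · push Not at h
    rw [elFun_zero ι r h, elFun_zero ι' r' h, map_zero]

end Post

section Base

variable {p : ℕ} [Fact p.Prime] {k : Type} [Field k] [CharP k p] {f : ℕ}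
variable {R : Type} [CommRing R] (ι : Zq p k →+* R) (r : Fin f → ℕ)

/-- Change of coefficients on `⊗ Sym^{r_i}`. -/
def symBase : SymV (Zq p k) r →+ SymV R r where
  toFun P := ⟨MvPolynomial.map ι P.1, fun d hd => P.2 fun h0 => hd (by
    rw [MvPolynomial.coeff_map, h0, map_zero])⟩
  map_zero' := Subtype.ext (map_zero (MvPolynomial.map ι))
  map_add' P Q := Subtype.ext (map_add (MvPolynomial.map ι) P.1 Q.1)

lemma symBase_smul (c : Zq p k) (v : SymV (Zq p k) r) :
    symBase ι r (c • v) = ι c • symBase ι r v := Subtype.ext (by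
  change MvPolynomial.map ι (c • v.1) = ι c • MvPolynomial.map ι v.1
  rw [MvPolynomial.smul_eq_C_mul, map_mul, MvPolynomial.map_C, MvPolynomial.smul_eq_C_mul])

lemma symBase_symRep (m : Matrix (Fin 2) (Fin 2) (Zq p k)) (P : SymV (Zq p k) r) :
    symBase ι r (symRep (RingHom.id _) r m P) = symRep ι r m (symBase ι r P) := by
  apply Subtype.ext
  change MvPolynomial.map ι (substHom (RingHom.id _) f m P.1)
    = substHom ι f m (MvPolynomial.map ι P.1)
  generalize P.1 = P'
  induction P' using MvPolynomial.induction_on with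
  | C a => simp [substHom, MvPolynomial.algebraMap_eq]
  | add P Q hP hQ => simp only [map_add, hP, hQ]
  | mul_X P v hP =>
    rw [map_mul, map_mul, map_mul, map_mul, hP]
    congr 1
    simp [substHom]

/-- Change of coefficients on the compact induction. -/
def cIndBase : cInd (RingHom.id (Zq p k)) r →+ cInd ι r :=
  cIndPost (symBase ι r) (symBase_symRep ι r)

lemma cIndBase_smul (c : Zq p k) (φ : cInd (RingHom.id (Zq p k)) r) :
    cIndBase ι r (c • φ) = ι c • cIndBase ι r φ :=
  cIndPost_smul _ _ (symBase_smul ι r c) φ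

/-- A monomial of multidegree `r`. -/
def monoV {r : Fin f → ℕ} (d : Fin f × Fin 2 →₀ ℕ) (hd : Finsupp.weight (multiDeg f) d = r) :
    SymV R r :=
  ⟨MvPolynomial.monomial d 1, MvPolynomial.isWeightedHomogeneous_monomial _ _ _ hd⟩

lemma symV_induction {r : Fin f → ℕ} {P : SymV R r → Prop} (zero : P 0)
    (add : ∀ v w, P v → P w → P (v + w))
    (mono : ∀ (c : R) d hd, P (c • monoV d hd)) (v : SymV R r) : P v := by
  have key : ∀ s : Finset (Fin f × Fin 2 →₀ ℕ), ∀ v : SymV R r,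
      (MvPolynomial.support v.1 ⊆ s) → P v := by
    intro s
    induction s using Finset.induction_on with
    | empty =>
      intro v hv
      have : v = 0 := Subtype.ext (MvPolynomial.support_eq_empty.mp (Finset.subset_empty.mp hv))
      rw [this]
      exact zero
    | insert d s hds ih =>
      intro v hv
      by_cases hd : MvPolynomial.coeff d v.1 = 0
      · refine ih v fun e he => ?_
        rcases Finset.mem_insert.mp (hv he) with rfl | h
        · exact absurd hd (MvPolynomial.mem_support_iff.mp he)
        · exact h
      · have hd' : Finsupp.weight (multiDeg f) d = r := v.2 hd
        have h1 : v = (v - MvPolynomial.coeff d v.1 • monoV d hd')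
            + MvPolynomial.coeff d v.1 • monoV d hd' := by simp
        rw [h1]
        refine add _ _ (ih _ fun e he => ?_) (mono _ _ _)
        have h2 : MvPolynomial.coeff e (v.1 - MvPolynomial.coeff d v.1 •
            MvPolynomial.monomial d (1 : R)) ≠ 0 := MvPolynomial.mem_support_iff.mp he
        rw [MvPolynomial.coeff_sub, MvPolynomial.coeff_smul, MvPolynomial.coeff_monomial] at h2
        by_cases hed : d = e
        · subst hed
          simp at h2
        · rw [if_neg hed, smul_zero, sub_zero] at h2
          exact (Finset.mem_insert.mp (hv (MvPolynomial.mem_support_iff.mpr h2))).resolve_left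
            (Ne.symm hed)
  exact key _ v subset_rfl

lemma symBase_monoV {r : Fin f → ℕ} (d : Fin f × Fin 2 →₀ ℕ)
    (hd : Finsupp.weight (multiDeg f) d = r) : symBase ι r (monoV d hd) = monoV d hd :=
  Subtype.ext (by
    change MvPolynomial.map ι (MvPolynomial.monomial d 1) = MvPolynomial.monomial d 1
    rw [MvPolynomial.map_monomial, map_one])

end Base

/-! ### Relations in the reduction of the lattice -/

section Reduction

variable {p : ℕ} [Fact p.Prime] {k : Type} [Field k] [CharP k p] [Finite k] {f : ℕ}

/-- A representation generated by the image of the compact induction over `ℤ_q`, with the relations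
that hold in `Θ̄_{k, a_p}` if `v(a_p) ∈ (0, 1)`. -/
structure Reduction (r : Fin f → ℕ) {F V : Type} [Field F] [AddCommGroup V] [Module F V]
    (π : Representation F (GrpG p k) V) where
  /-- the map from the compact induction -/
  red : cInd (RingHom.id (Zq p k)) r →+ V
  /-- the map on coefficients -/
  coeff : Zq p k →+* F
  smul : ∀ c Ψ, red (c • Ψ) = coeff c • red Ψ
  equivariant : ∀ g Ψ, red (cIndRep _ r g Ψ) = π g (red Ψ)
  span_eq_top : Submodule.span F (Set.range red) = ⊤
  eq_zero_of_hecke : ∀ Ψ Ξ, hecke _ r Ψ = (p : Zq p k) • Ξ → red Ψ = 0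
  red_hecke : ∀ Ψ, red (hecke _ r Ψ) = 0
  eq_zero_of_hecke_sq : ∀ Ψ Z Ω, hecke _ r (hecke _ r Ψ - (p : Zq p k) • Z)
    = (p : Zq p k) ^ 2 • Ω → red Ψ = 0

/-- The additional relations that hold if `v(a_p) > 1 / 2`. -/
def Reduction.IsSteep {r : Fin f → ℕ} {F V : Type} [Field F] [AddCommGroup V] [Module F V]
    {π : Representation F (GrpG p k) V} (D : Reduction r π) : Prop :=
  ∀ Ψ Ξ Ω, hecke _ r (hecke _ r Ψ - (p : Zq p k) • Ξ) = (p : Zq p k) • Ω → D.red Ω = 0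

variable {O : Type} [CommRing O] {E : Type} [Field E] [Algebra O E] {F : Type} [Field F]
  [Algebra O F] (ι : Zq p k →+* O) (r : Fin f → ℕ)

/-- The map from the compact induction over `O` to `Θ̄_{k, a_p}`. -/
def thetaRed (a : E) : cInd ι r →+ ThetaBar E F ι r a where
  toFun φ := (1 : F) ⊗ₜ[O] (LinearMap.ker (latticeMap E ι r a)).mkQ φ
  map_zero' := by rw [map_zero, TensorProduct.tmul_zero]
  map_add' φ ψ := by rw [map_add, TensorProduct.tmul_add]

lemma thetaRed_smul (a : E) (c : O) (φ : cInd ι r) :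
    thetaRed (F := F) ι r a (c • φ) = algebraMap O F c • thetaRed (F := F) ι r a φ := by
  change (1 : F) ⊗ₜ[O] (LinearMap.ker (latticeMap E ι r a)).mkQ (c • φ)
    = algebraMap O F c • ((1 : F) ⊗ₜ[O] (LinearMap.ker (latticeMap E ι r a)).mkQ φ)
  rw [map_smul, TensorProduct.tmul_smul, algebraMap_smul]

lemma cIndMap_hecke (φ : cInd ι r) :
    cIndMap E ι r (hecke ι r φ) = hecke (iotaE E ι) r (cIndMap E ι r φ) := by
  apply Subtype.ext
  funext g
  change symMap E r (heckeFun ι r φ.1 g)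
    = heckeFun (iotaE E ι) r (fun g => symMap E r (φ.1 g)) g
  rw [heckeFun, heckeFun, map_finsum _ (Set.toFinite _)]
  simp_rw [symMap_symRep]

/-- The basic source of relations in `Θ̄_{k, a_p}`. -/
lemma thetaRed_eq_zero {a s c c' : O} (hs : algebraMap O E s ≠ 0) (hc : algebraMap O F c = 0)
    (hc' : algebraMap O F c' = 0) {ψ φ χ χ' : cInd ι r}
    (h : hecke ι r ψ - a • ψ = s • (φ + c • χ + c' • χ')) :
    thetaRed (F := F) ι r (algebraMap O E a) φ = 0 := by
  have h1 : φ + c • χ + c' • χ' ∈ LinearMap.ker (latticeMap E ι r (algebraMap O E a)) := by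
    rw [LinearMap.mem_ker]
    change (heckeRange E ι r (algebraMap O E a)).mkQ (cIndMap E ι r (φ + c • χ + c' • χ')) = 0
    rw [Submodule.mkQ_apply, Submodule.Quotient.mk_eq_zero]
    refine ⟨(algebraMap O E s)⁻¹ • cIndMap E ι r ψ, ?_⟩
    rw [map_smul, LinearMap.sub_apply, ← cIndMap_hecke, LinearMap.smul_apply, LinearMap.id_apply]
    have h2 := congrArg (cIndMap E ι r) h
    rw [map_sub, LinearMap.map_smulₛₗ, LinearMap.map_smulₛₗ] at h2
    rw [h2, inv_smul_smul₀ hs]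
  have h2 : thetaRed (F := F) ι r (algebraMap O E a) (φ + c • χ + c' • χ') = 0 := by
    change (1 : F) ⊗ₜ[O] (LinearMap.ker (latticeMap E ι r (algebraMap O E a))).mkQ _ = 0
    rw [Submodule.mkQ_apply, (Submodule.Quotient.mk_eq_zero _).mpr h1, TensorProduct.tmul_zero]
  rwa [map_add, map_add, thetaRed_smul, thetaRed_smul, hc, hc', zero_smul, zero_smul, add_zero,
    add_zero] at h2

/-- Symmetric powers over `O` are spanned by monomials, which are defined over `ℤ_q`; scalars from
`O` become scalars of `F`. -/
lemma span_thetaRed (a : E) : Submodule.span F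
    (Set.range ((thetaRed (F := F) ι r a).comp (cIndBase ι r))) = ⊤ := by
  rw [eq_top_iff]
  rintro x -
  induction x using TensorProduct.induction_on with
  | zero => exact zero_mem _
  | add x y hx hy => exact add_mem hx hy
  | tmul c θ =>
    obtain ⟨φ, rfl⟩ := Submodule.mkQ_surjective _ θ
    have h1 : c ⊗ₜ[O] (LinearMap.ker (latticeMap E ι r a)).mkQ φ
        = c • thetaRed (F := F) ι r a φ := by
      change _ = c • ((1 : F) ⊗ₜ[O] _)
      rw [TensorProduct.smul_tmul', smul_eq_mul, mul_one]
    rw [h1]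
    refine Submodule.smul_mem _ _ ?_
    induction φ using cInd_induction with
    | zero => rw [map_zero]; exact zero_mem _
    | add φ ψ hφ hψ =>
      rw [map_add]
      refine add_mem (hφ ?_) (hψ ?_)
      all_goals
        change _ = c • ((1 : F) ⊗ₜ[O] _)
        rw [TensorProduct.smul_tmul', smul_eq_mul, mul_one]
    | basic g v =>
      clear h1
      induction v using symV_induction with
      | zero => rw [map_zero, map_zero, map_zero]; exact zero_mem _
      | add v w hv hw => rw [map_add, map_add, map_add]; exact add_mem hv hw
      | mono c d hd =>
        rw [map_smul, map_smul, thetaRed_smul]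
        refine Submodule.smul_mem _ _ (Submodule.subset_span
          ⟨cIndRep _ r g (el _ r (monoV d hd)), ?_⟩)
        rw [AddMonoidHom.comp_apply, cIndBase, cIndPost_cIndRep, cIndPost_el, symBase_monoV]

/-- The relations in `Θ̄_{k, a_p}` if `v(a_p) ∈ (0, 1)`. -/
def thetaReduction {a c : O} (ha : algebraMap O E a ≠ 0) (ha' : algebraMap O F a = 0)
    (hc : algebraMap O F c = 0) (hac : (p : O) = a * c) :
    Reduction r (thetaBarRep E F ι r (algebraMap O E a)) where
  red := (thetaRed (F := F) ι r (algebraMap O E a)).comp (cIndBase ι r)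
  coeff := (algebraMap O F).comp ι
  smul c Ψ := by
    rw [AddMonoidHom.comp_apply, cIndBase_smul, thetaRed_smul]
    rfl
  equivariant g Ψ := rfl
  span_eq_top := span_thetaRed ι r _
  eq_zero_of_hecke Ψ Ξ h := by
    have h1 : thetaRed (F := F) ι r (algebraMap O E a) (-cIndBase ι r Ψ) = 0 := by
      -- With `p = a c`, the relation reads `(T - a) Ψ = a (-Ψ + c Ξ)`.
      refine thetaRed_eq_zero ι r ha hc (map_zero _) (ψ := cIndBase ι r Ψ) (χ := cIndBase ι r Ξ)
        (c' := 0) (χ' := 0) ?_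
      rw [cIndBase, ← cIndPost_hecke, h, ← cIndBase, cIndBase_smul, map_natCast, hac]
      module
    rwa [map_neg, neg_eq_zero] at h1
  red_hecke Ψ := by
    refine thetaRed_eq_zero ι r (s := 1) (by simp) ha' (map_zero _) (ψ := cIndBase ι r Ψ)
      (χ := -cIndBase ι r Ψ) (c' := 0) (χ' := 0) ?_
    rw [cIndBase, cIndPost_hecke]
    module
  eq_zero_of_hecke_sq Ψ Z Ω h := by
    have h1 : thetaRed (F := F) ι r (algebraMap O E a) (-cIndBase ι r Ψ) = 0 := by
      have h2 : hecke ι r (hecke ι r (cIndBase ι r Ψ)) = (p : O) • hecke ι r (cIndBase ι r Z)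
          + (p : O) ^ 2 • cIndBase ι r Ω := by
        have h3 := congrArg (cIndBase ι r) h
        rw [cIndBase_smul, map_pow, map_natCast, cIndBase, cIndPost_hecke, map_sub, cIndPost_hecke,
          ← cIndBase, cIndBase_smul, map_natCast, map_sub, map_smul, sub_eq_iff_eq_add] at h3
        rw [h3, add_comm]
      -- Adding `a Ψ` to `T Ψ - p Z` cancels the terms `a T Ψ`: the image under `T - a` is `p² Ω + a
      -- p Z - a² Ψ = a² (-Ψ + c (Z + c Ω))`.
      refine thetaRed_eq_zero ι r (s := a ^ 2) (by simpa using ha) hc (map_zero _)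
        (ψ := hecke ι r (cIndBase ι r Ψ) - (p : O) • cIndBase ι r Z + a • cIndBase ι r Ψ)
        (χ := cIndBase ι r Z + c • cIndBase ι r Ω) (c' := 0) (χ' := 0) ?_
      rw [map_add, map_sub, map_smul, map_smul, h2, hac]
      module
    rwa [map_neg, neg_eq_zero] at h1

/-- The test function `T Ψ - p Ξ + a Ψ` from the `a²` relation is used again. Its image under `T -
a` is `p Ω + a p Ξ - a² Ψ`, which can now be divided by `p`: the condition `v(a) > 1/2` enters as
`a² = p c'` with `c'` reducing to zero, so that `Ω` alone remains. -/
lemma thetaReduction_isSteep {a c c' : O} (ha : algebraMap O E a ≠ 0)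
    (ha' : algebraMap O F a = 0) (hc : algebraMap O F c = 0) (hac : (p : O) = a * c)
    (hc' : algebraMap O F c' = 0) (hac' : a ^ 2 = p * c') (hp : algebraMap O E p ≠ 0) :
    (thetaReduction ι r ha ha' hc hac).IsSteep := by
  intro Ψ Ξ Ω h
  have h2 : hecke ι r (hecke ι r (cIndBase ι r Ψ)) = (p : O) • hecke ι r (cIndBase ι r Ξ)
      + (p : O) • cIndBase ι r Ω := by
    have h3 := congrArg (cIndBase ι r) h
    rw [cIndBase_smul, map_natCast, cIndBase, cIndPost_hecke, map_sub, cIndPost_hecke,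
      ← cIndBase, cIndBase_smul, map_natCast, map_sub, map_smul, sub_eq_iff_eq_add] at h3
    rw [h3, add_comm]
  refine thetaRed_eq_zero ι r (s := (p : O)) hp ha' hc'
    (ψ := hecke ι r (cIndBase ι r Ψ) - (p : O) • cIndBase ι r Ξ + a • cIndBase ι r Ψ)
    (χ := cIndBase ι r Ξ) (χ' := -cIndBase ι r Ψ) ?_
  rw [map_add, map_sub, map_smul, map_smul, h2]
  have h4 : ((p : O) * c') • cIndBase ι r Ψ = a ^ 2 • cIndBase ι r Ψ := by rw [hac']
  have h5 : a • a • cIndBase ι r Ψ = (p : O) • c' • cIndBase ι r Ψ := by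
    rw [smul_smul, smul_smul, ← sq, hac']
  rw [smul_add, h5]
  module

end Reduction

end GL2Red
end

noncomputable section

namespace GL2Red

/-! ### Reduction modulo `p` as functions on `k²` -/

section Eval

variable {p : ℕ} [Fact p.Prime] {k : Type} [Field k] [CharP k p] {f : ℕ} {r : Fin f → ℕ}

lemma weight_multiDeg (d : Fin f × Fin 2 →₀ ℕ) (i : Fin f) :
    Finsupp.weight (multiDeg f) d i = d (i, 0) + d (i, 1) := by
  rw [Finsupp.weight_apply, Finsupp.sum_fintype _ _ (by simp), Finset.sum_apply,
    Fintype.sum_prod_type, Finset.sum_eq_single i]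
  · simp [multiDeg]
  · intro j _ hj
    simp [multiDeg, hj.symm]
  · simp

/-- Reduction of coefficients modulo `p`, followed by evaluation at
`X_i = x ^ (p ^ i), Y_i = y ^ (p ^ i)`. -/
def evHom (f : ℕ) (x : Fin 2 → k) : MvPolynomial (Fin f × Fin 2) (Zq p k) →+* k :=
  MvPolynomial.eval₂Hom WittVector.constantCoeff fun v => x v.2 ^ p ^ v.1.val

/-- The function on `k²` attached to an element of `⊗ Sym^{r_i}`. -/
def ev (v : SymV (Zq p k) r) (x y : k) : k := evHom f ![x, y] v.1

lemma ev_add (v w : SymV (Zq p k) r) (x y : k) : ev (v + w) x y = ev v x y + ev w x y :=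
  map_add (evHom f ![x, y]) v.1 w.1

lemma ev_sub (v w : SymV (Zq p k) r) (x y : k) : ev (v - w) x y = ev v x y - ev w x y :=
  map_sub (evHom f ![x, y]) v.1 w.1

lemma ev_zero (x y : k) : ev (0 : SymV (Zq p k) r) x y = 0 := map_zero (evHom f ![x, y])

lemma ev_smul (c : Zq p k) (v : SymV (Zq p k) r) (x y : k) :
    ev (c • v) x y = WittVector.constantCoeff c * ev v x y := by
  change evHom f ![x, y] (c • v.1) = _ * evHom f ![x, y] v.1
  rw [MvPolynomial.smul_eq_C_mul, map_mul, evHom, MvPolynomial.coe_eval₂Hom, MvPolynomial.eval₂_C]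

lemma ev_sum {α : Type} (s : Finset α) (v : α → SymV (Zq p k) r) (x y : k) :
    ev (∑ i ∈ s, v i) x y = ∑ i ∈ s, ev (v i) x y := by
  classical
  induction s using Finset.induction_on with
  | empty => simp [ev_zero]
  | insert i s hi ih => rw [Finset.sum_insert hi, Finset.sum_insert hi, ev_add, ih]

lemma constantCoeff_frobenius_pow (n : ℕ) (x : Zq p k) :
    WittVector.constantCoeff (((WittVector.frobenius : Zq p k →+* Zq p k) ^ n) x)
      = (WittVector.constantCoeff x) ^ p ^ n := by
  induction n generalizing x with
  | zero => simp
  | succ n ih =>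
    rw [pow_succ, RingHom.mul_def, RingHom.comp_apply, ih, WittVector.constantCoeff_apply,
      WittVector.coeff_frobenius_charP, ← WittVector.constantCoeff_apply, ← pow_mul, pow_succ' p]

/-- Evaluating the `i`-th variables at `p ^ i`-th powers absorbs the Frobenius twists, since `(∑ a
x) ^ (p ^ i) = ∑ a ^ (p ^ i) x ^ (p ^ i)` in characteristic `p`. -/
lemma evHom_substHom (m : Matrix (Fin 2) (Fin 2) (Zq p k)) (x : Fin 2 → k)
    (P : MvPolynomial (Fin f × Fin 2) (Zq p k)) :
    evHom f x (substHom (RingHom.id _) f m P)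
      = evHom f (fun j => ∑ l, WittVector.constantCoeff (m l j) * x l) P := by
  induction P using MvPolynomial.induction_on with
  | C a => simp [substHom, evHom, MvPolynomial.algebraMap_eq]
  | add P Q hP hQ => simp only [map_add, hP, hQ]
  | mul_X P v hP =>
    rw [map_mul, map_mul, map_mul, hP]
    congr 1
    simp only [substHom, evHom, MvPolynomial.aeval_X, map_sum, map_mul, MvPolynomial.coe_eval₂Hom,
      MvPolynomial.eval₂_C, MvPolynomial.eval₂_X, RingHom.id_apply, constantCoeff_frobenius_pow]
    rw [sum_pow_char_pow]
    simp only [mul_pow]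

lemma ev_symRep (m : Matrix (Fin 2) (Fin 2) (Zq p k)) (v : SymV (Zq p k) r) (x y : k) :
    ev (symRep (RingHom.id _) r m v) x y
      = ev v (WittVector.constantCoeff (m 0 0) * x + WittVector.constantCoeff (m 1 0) * y)
        (WittVector.constantCoeff (m 0 1) * x + WittVector.constantCoeff (m 1 1) * y) := by
  change evHom f ![x, y] (substHom (RingHom.id _) f m v.1) = evHom f _ v.1
  rw [evHom_substHom]
  congr 2
  funext j
  fin_cases j <;> simp

variable [Finite k]

lemma exists_smul_pow {n : ℕ} {v : SymV (Zq p k) r}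
    (h : MvPolynomial.C ((p : Zq p k) ^ n) ∣ v.1) : ∃ w, v = (p : Zq p k) ^ n • w := by
  obtain ⟨Q, hQ⟩ := h
  have hp : (p : Zq p k) ^ n ≠ 0 := pow_ne_zero n (natCast_p_ne_zero p k)
  refine ⟨⟨Q, fun d hd => v.2 ?_⟩, Subtype.ext ?_⟩
  · rw [hQ, MvPolynomial.coeff_C_mul]
    exact mul_ne_zero hp hd
  · change v.1 = (p : Zq p k) ^ n • Q
    rw [hQ, MvPolynomial.smul_eq_C_mul]

lemma exists_smul_of_map {v w : SymV (Zq p k) r}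
    (h : MvPolynomial.map (WittVector.constantCoeff : Zq p k →+* k) v.1
      = MvPolynomial.map WittVector.constantCoeff w.1) : ∃ u, v = w + (p : Zq p k) • u := by
  have h1 : MvPolynomial.C ((p : Zq p k) ^ 1) ∣ (v - w).1 := by
    rw [MvPolynomial.C_dvd_iff_dvd_coeff]
    intro d
    rw [pow_one, dvd_iff_coeff, ← WittVector.constantCoeff_apply]
    have h2 := congrArg (MvPolynomial.coeff d) h
    rw [MvPolynomial.coeff_map, MvPolynomial.coeff_map] at h2
    change WittVector.constantCoeff (MvPolynomial.coeff d (v.1 - w.1)) = 0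
    rw [MvPolynomial.coeff_sub, map_sub, h2, sub_self]
  obtain ⟨u, hu⟩ := exists_smul_pow h1
  exact ⟨u, by rw [← sub_eq_iff_eq_add', hu, pow_one]⟩

/-- The element `∏ X_i ^ r_i` (for `l = 0`) or `∏ Y_i ^ r_i` (for `l = 1`). -/
def topV (r : Fin f → ℕ) (l : Fin 2) : SymV (Zq p k) r :=
  ⟨∏ i, MvPolynomial.X (i, l) ^ r i, by
    have h := MvPolynomial.IsWeightedHomogeneous.prod (R := Zq p k) (w := multiDeg f) Finset.univ
      (fun i => MvPolynomial.X (i, l) ^ r i) (fun i => r i • multiDeg f (i, l))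
      (fun i _ => MvPolynomial.IsWeightedHomogeneous.pow
        (MvPolynomial.isWeightedHomogeneous_X _ _ _) _)
    have h2 : ∑ i, r i • multiDeg f (i, l) = r := by
      funext j
      simp [multiDeg, Finset.sum_apply, Pi.single_apply]
    rw [h2] at h
    exact h⟩

lemma symV_val_add {R : Type} [CommRing R] (v w : SymV R r) : (v + w).1 = v.1 + w.1 := rfl

/-- A matrix of rank one modulo `p` maps everything to multiples of a power of a linear form modulo
`p`. -/
lemma map_substHom_rankOne {m : Matrix (Fin 2) (Fin 2) (Zq p k)} {s : Fin 2 → k} {t : Fin 2}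
    (hm : ∀ l j, WittVector.constantCoeff (m l j) = if l = t then s j else 0)
    (v : SymV (Zq p k) r) :
    MvPolynomial.map WittVector.constantCoeff (symRep (RingHom.id _) r m v).1
      = MvPolynomial.C (evHom f s v.1) * ∏ i, MvPolynomial.X (i, t) ^ r i := by
  induction v using symV_induction with
  | zero =>
    rw [map_zero]
    change MvPolynomial.map _ 0 = MvPolynomial.C (evHom f s 0) * _
    simp
  | add v w hv hw =>
    have h1 : symRep (RingHom.id _) r m (v + w)
        = symRep (RingHom.id _) r m v + symRep (RingHom.id _) r m w := LinearMap.map_add _ v w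
    rw [h1, symV_val_add, symV_val_add, (MvPolynomial.map _).map_add, (evHom f s).map_add, hv, hw,
      MvPolynomial.C_add, add_mul]
  | mono c d hd =>
    have h1 : (c • monoV d hd : SymV (Zq p k) r).1 = c • MvPolynomial.monomial d (1 : Zq p k) := rfl
    have h2 : (symRep (RingHom.id (Zq p k)) r m (c • monoV d hd)).1
        = substHom (RingHom.id (Zq p k)) f m (c • monoV d hd : SymV (Zq p k) r).1 := rfl
    rw [h2, h1]
    rw [MvPolynomial.smul_monomial, smul_eq_mul, mul_one, substHom, MvPolynomial.aeval_monomial,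
      evHom, MvPolynomial.coe_eval₂Hom, MvPolynomial.eval₂_monomial, map_mul,
      MvPolynomial.algebraMap_eq, MvPolynomial.map_C, map_mul, mul_assoc]
    congr 1
    rw [Finsupp.prod, map_prod, Finsupp.prod, map_prod]
    have h1 : ∀ v : Fin f × Fin 2, MvPolynomial.map WittVector.constantCoeff
        ((∑ l : Fin 2, MvPolynomial.C ((RingHom.id (Zq p k))
          (((WittVector.frobenius : Zq p k →+* Zq p k) ^ v.1.val) (m l v.2)))
          * MvPolynomial.X (v.1, l)) ^ d v)
        = MvPolynomial.C ((s v.2 ^ p ^ v.1.val) ^ d v) * MvPolynomial.X (v.1, t) ^ d v := by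
      intro v
      have hp : p ^ v.1.val ≠ 0 := pow_ne_zero _ (Fact.out : p.Prime).ne_zero
      rw [map_pow, Fin.sum_univ_two, map_add, map_mul, map_mul, MvPolynomial.map_C,
        MvPolynomial.map_C, MvPolynomial.map_X, MvPolynomial.map_X, RingHom.id_apply,
        RingHom.id_apply, constantCoeff_frobenius_pow, constantCoeff_frobenius_pow, hm, hm]
      fin_cases t <;> simp [zero_pow hp, mul_pow]
    rw [Finset.prod_congr rfl fun v _ => h1 v, Finset.prod_mul_distrib]
    congr 1
    have h2 : ∀ i, d (i, 0) + d (i, 1) = r i := fun i => by rw [← hd, weight_multiDeg]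
    have h3 : ∏ v ∈ d.support, (MvPolynomial.X (v.1, t) : MvPolynomial (Fin f × Fin 2) k) ^ d v
        = ∏ v : Fin f × Fin 2, MvPolynomial.X (v.1, t) ^ d v := by
      refine Finset.prod_subset (Finset.subset_univ _) fun v _ hv => ?_
      rw [Finsupp.notMem_support_iff.mp hv, pow_zero]
    rw [h3, Fintype.prod_prod_type]
    refine Finset.prod_congr rfl fun i _ => ?_
    rw [Fin.prod_univ_two, ← pow_add, h2]

lemma map_topV (c : Zq p k) (l : Fin 2) :
    MvPolynomial.map (WittVector.constantCoeff : Zq p k →+* k) (c • topV r l : SymV (Zq p k) r).1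
      = MvPolynomial.C (WittVector.constantCoeff c) * ∏ i, MvPolynomial.X (i, l) ^ r i := by
  change MvPolynomial.map _ (c • ∏ i, MvPolynomial.X (i, l) ^ r i) = _
  simp [MvPolynomial.smul_eq_C_mul]

/-- Modulo `p` the matrix has rank one with only nonzero row `(1, -λ)`, so all that survives of `v`
is the value of its function at that point. Any lift `c` of this value is allowed. -/
lemma heckeAdj_some_mod (lam : k) (v : SymV (Zq p k) r) {c : Zq p k}
    (hc : WittVector.constantCoeff c = ev v 1 (-lam)) :
    ∃ w, symRep (RingHom.id _) r (heckeAdj (some lam)) v = c • topV r 0 + (p : Zq p k) • w := by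
  apply exists_smul_of_map
  have hp : (WittVector.constantCoeff (p : Zq p k) : k) = 0 := by simp
  rw [map_substHom_rankOne (s := ![1, -lam]) (t := 0), map_topV, hc, ev]
  intro l j
  rw [heckeAdj_some]
  have h1 : WittVector.constantCoeff (-WittVector.teichmuller p lam) = -lam := by
    rw [map_neg]
    simp
  fin_cases l <;> fin_cases j <;> simp [-WittVector.constantCoeff_apply, h1]

lemma heckeAdj_none_mod (v : SymV (Zq p k) r) {c : Zq p k}
    (hc : WittVector.constantCoeff c = ev v 0 1) :
    ∃ w, symRep (RingHom.id _) r (heckeAdj (none : Option k)) v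
      = c • topV r 1 + (p : Zq p k) • w := by
  apply exists_smul_of_map
  rw [map_substHom_rankOne (s := ![0, 1]) (t := 1), map_topV, hc, ev]
  intro l j
  rw [heckeAdj_none]
  fin_cases l <;> fin_cases j <;> simp

/-- The twists combine the multidegree into the single degree `∑ p ^ i r_i`. -/
lemma ev_homogeneous (v : SymV (Zq p k) r) (a x y : k) :
    ev v (a * x) (a * y) = a ^ (∑ i, p ^ i.val * r i) * ev v x y := by
  induction v using symV_induction with
  | zero => simp [ev_zero]
  | add v w hv hw => rw [ev_add, ev_add, hv, hw, mul_add]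
  | mono c d hd =>
    rw [ev_smul, ev_smul]
    have h2 : ∀ i, d (i, 0) + d (i, 1) = r i := fun i => by rw [← hd, weight_multiDeg]
    have h3 : ∀ x : Fin 2 → k, evHom f x (MvPolynomial.monomial d (1 : Zq p k))
        = ∏ i, (x 0 ^ p ^ i.val) ^ d (i, 0) * (x 1 ^ p ^ i.val) ^ d (i, 1) := by
      intro x
      rw [evHom, MvPolynomial.coe_eval₂Hom, MvPolynomial.eval₂_monomial, map_one, one_mul,
        Finsupp.prod_fintype _ _ (by simp), Fintype.prod_prod_type]
      simp
    change _ * evHom f ![a * x, a * y] (MvPolynomial.monomial d 1)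
      = _ * (_ * evHom f ![x, y] (MvPolynomial.monomial d 1))
    rw [h3, h3, ← Finset.prod_pow_eq_pow_sum, mul_left_comm, ← Finset.prod_mul_distrib]
    congr 1
    refine Finset.prod_congr rfl fun i _ => ?_
    rw [← h2]
    simp only [Matrix.cons_val_zero, Matrix.cons_val_one, mul_pow]
    ring

end Eval

end GL2Red
end

noncomputable section

namespace GL2Red

/-! ### Generators, quotients and smoothness -/

section Criteria

variable {p : ℕ} [Fact p.Prime] {k : Type} [Field k] [CharP k p] [Fintype k]
variable {F V : Type} [Field F] [AddCommGroup V] [Module F V]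
  {π : Representation F (GrpG p k) V}

lemma IsSmooth.sub (hsm : IsSmooth π) (W : Subrepresentation π) :
    IsSmooth (V := W.toSubmodule) W.toRepresentation := by
  intro v
  obtain ⟨n, hn⟩ := hsm v.1
  exact ⟨n, fun u hu => Subtype.ext (hn u hu)⟩

lemma IsSmooth.quot (hsm : IsSmooth π) (W : Subrepresentation π) : IsSmooth (quotRep π W) := by
  intro v
  obtain ⟨v, rfl⟩ := Submodule.mkQ_surjective _ v
  obtain ⟨n, hn⟩ := hsm v
  exact ⟨n, fun u hu => congrArg W.toSubmodule.mkQ (hn u hu)⟩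

lemma isSmooth_of_span {S : Set V} (hS : Submodule.span F S = ⊤)
    (h : ∀ v ∈ S, ∃ n : ℕ, ∀ u : GrpK p k, CongrOne p k n u → π (incl p k u) v = v) :
    IsSmooth π := by
  intro v
  have hv : v ∈ Submodule.span F S := hS ▸ Submodule.mem_top
  induction hv using Submodule.span_induction with
  | mem v hv => exact h v hv
  | zero => exact ⟨0, fun u _ => map_zero _⟩
  | add v w _ _ hv hw =>
    obtain ⟨n, hn⟩ := hv
    obtain ⟨m, hm⟩ := hw
    refine ⟨max n m, fun u hu => ?_⟩
    rw [map_add, hn u fun i j => (pow_dvd_pow _ (le_max_left n m)).trans (hu i j),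
      hm u fun i j => (pow_dvd_pow _ (le_max_right n m)).trans (hu i j)]
  | smul c v _ hv =>
    obtain ⟨n, hn⟩ := hv
    exact ⟨n, fun u hu => by rw [map_smul, hn u hu]⟩

/-- A subrepresentation with irreducible quotient does not contain a generator. -/
lemma mk_ne_zero_of_irreducible {v : V}
    (hgen : ∀ W : Subrepresentation π, v ∈ W.toSubmodule → W.toSubmodule = ⊤)
    (W : Subrepresentation π) (hW : (quotRep π W).IsIrreducible) : W.toSubmodule.mkQ v ≠ 0 := by
  intro h
  rw [Submodule.mkQ_apply, Submodule.Quotient.mk_eq_zero] at h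
  have h1 := hgen W h
  have h2 : (⊥ : Subrepresentation (quotRep π W)) ≠ ⊤ := bot_ne_top
  refine h2 (SetLike.ext fun x => ?_)
  obtain ⟨x, rfl⟩ := Submodule.mkQ_surjective _ x
  have h3 : W.toSubmodule.mkQ x = 0 := by
    rw [Submodule.mkQ_apply, Submodule.Quotient.mk_eq_zero, h1]
    trivial
  rw [h3]
  exact ⟨fun _ => trivial, fun _ => rfl⟩

variable [CharP F p]

lemma irredQuotientsSupercuspidal_of_Up (hsm : IsSmooth π) {v x : V}
    (hgen : ∀ W : Subrepresentation π, v ∈ W.toSubmodule → W.toSubmodule = ⊤)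
    (hup : ∀ b : Zq p k, π (incl p k (upK b)) v = v)
    (hlo : ∀ b : Zq p k, π (incl p k (loK (p * b))) v = v) (b₀ : Zq p k)
    (hx : π (incl p k (upK b₀)) x - x = v) (hU : ∑ lam : k, π (heckeG p (some lam)) v = 0) :
    IrredQuotientsSupercuspidal π := by
  intro W hW
  have hmk : ∀ g v, quotRep π W g (W.toSubmodule.mkQ v) = W.toSubmodule.mkQ (π g v) :=
    fun g v => rfl
  refine isSupercuspidal_of_Up hW (hsm.quot W) (mk_ne_zero_of_irreducible hgen W hW)
    (x := W.toSubmodule.mkQ x) (fun b => ?_) (fun b => ?_) b₀ ?_ ?_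
  · rw [hmk, hup]
  · rw [hmk, hlo]
  · rw [hmk, ← map_sub, hx]
  · simp_rw [hmk]
    rw [← map_sum, hU, map_zero]

lemma irredQuotientsSupercuspidal_of_spherical (hsm : IsSmooth π) {v : V}
    (hgen : ∀ W : Subrepresentation π, v ∈ W.toSubmodule → W.toSubmodule = ⊤)
    (hup : ∀ b : Zq p k, π (incl p k (upK b)) v = v)
    (hlo : ∀ b : Zq p k, π (incl p k (loK b)) v = v)
    (hT : ∑ s : Option k, π (heckeG p s) v = 0) (hcard : (Fintype.card k : F) = 0) :
    IrredQuotientsSupercuspidal π := by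
  intro W hW
  have hmk : ∀ g v, quotRep π W g (W.toSubmodule.mkQ v) = W.toSubmodule.mkQ (π g v) :=
    fun g v => rfl
  refine isSupercuspidal_of_spherical hW (hsm.quot W) (mk_ne_zero_of_irreducible hgen W hW)
    (fun b => ?_) (fun b => ?_) ?_ hcard
  · rw [hmk, hup]
  · rw [hmk, hlo]
  · simp_rw [hmk]
    rw [← map_sum, hT, map_zero]

/-- The subrepresentation generated by a vector. -/
def genSub (π : Representation F (GrpG p k) V) (v : V) : Subrepresentation π where
  toSubmodule := Submodule.span F (Set.range fun g => π g v)
  apply_mem_toSubmodule g x hx := by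
    induction hx using Submodule.span_induction with
    | mem x hx =>
      obtain ⟨h, rfl⟩ := hx
      refine Submodule.subset_span ⟨g * h, ?_⟩
      simp
    | zero => rw [map_zero]; exact zero_mem _
    | add x y _ _ hx hy => rw [map_add]; exact add_mem hx hy
    | smul c x _ hx => rw [map_smul]; exact Submodule.smul_mem _ c hx

lemma mem_genSub (v : V) : v ∈ (genSub π v).toSubmodule :=
  Submodule.subset_span ⟨1, by simp⟩

lemma genSub_generated (v : V) (W : Subrepresentation (genSub π v).toRepresentation)
    (hW : (⟨v, mem_genSub v⟩ : (genSub π v).toSubmodule) ∈ W.toSubmodule) : W.toSubmodule = ⊤ := by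
  have key : ∀ x, ∀ hx : x ∈ (genSub π v).toSubmodule,
      (⟨x, hx⟩ : (genSub π v).toSubmodule) ∈ W.toSubmodule := by
    intro x hx
    induction hx using Submodule.span_induction with
    | mem x hx =>
      obtain ⟨h, rfl⟩ := hx
      exact W.apply_mem_toSubmodule h hW
    | zero => exact W.toSubmodule.zero_mem
    | add x y _ _ hx hy => exact W.toSubmodule.add_mem hx hy
    | smul c x _ hx => exact W.toSubmodule.smul_mem c hx
  exact Submodule.eq_top_iff'.mpr fun x => key x.1 x.2

lemma quot_generated {v : V} {U : Subrepresentation π}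
    (hgen : ∀ W : Subrepresentation π, v ∈ W.toSubmodule → W.toSubmodule = ⊤)
    (W : Subrepresentation (quotRep π U)) (hW : U.toSubmodule.mkQ v ∈ W.toSubmodule) :
    W.toSubmodule = ⊤ := by
  have h1 := hgen ⟨W.toSubmodule.comap U.toSubmodule.mkQ,
    fun g x hx => W.apply_mem_toSubmodule g hx⟩ hW
  refine Submodule.eq_top_iff'.mpr fun x => ?_
  obtain ⟨x, rfl⟩ := Submodule.mkQ_surjective _ x
  exact (SetLike.ext_iff.mp h1 x).mpr trivial

end Criteria

namespace Reduction

variable {p : ℕ} [Fact p.Prime] {k : Type} [Field k] [CharP k p] [Fintype k] {f : ℕ}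
  {r : Fin f → ℕ} {F V : Type} [Field F] [AddCommGroup V] [Module F V]
  {π : Representation F (GrpG p k) V} (D : Reduction r π)

/-- The image of `[1, v]`. -/
def vec : SymV (Zq p k) r →+ V := D.red.comp (el (RingHom.id (Zq p k)) r).toAddMonoidHom

lemma vec_apply (v : SymV (Zq p k) r) : D.vec v = D.red (el _ r v) := rfl

lemma vec_smul (c : Zq p k) (v : SymV (Zq p k) r) : D.vec (c • v) = D.coeff c • D.vec v := by
  rw [vec_apply, LinearMap.map_smul, D.smul, vec_apply]

lemma rep_incl_vec (u : GrpK p k) (v : SymV (Zq p k) r) :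
    π (incl p k u) (D.vec v) = D.vec (symRep (RingHom.id _) r u.1 v) := by
  rw [vec_apply, ← D.equivariant, cIndRep_incl_el, vec_apply]

/-- If the function of `v` vanishes, every term of `T [1, v]` is divisible by `p`, so that
`eq_zero_of_hecke` applies. -/
lemma vec_eq_zero {v : SymV (Zq p k) r} (h : ∀ x y, ev v x y = 0) : D.vec v = 0 := by
  have h1 : ∀ s : Option k, ∃ w, symRep (RingHom.id _) r (heckeAdj s) v = (p : Zq p k) • w := by
    intro s
    cases s with
    | none =>
      obtain ⟨w, hw⟩ := heckeAdj_none_mod v (c := 0) (by rw [h, map_zero])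
      exact ⟨w, by rw [hw, zero_smul, zero_add]⟩
    | some lam =>
      obtain ⟨w, hw⟩ := heckeAdj_some_mod lam v (c := 0) (by rw [h, map_zero])
      exact ⟨w, by rw [hw, zero_smul, zero_add]⟩
  choose w hw using h1
  refine D.eq_zero_of_hecke _ (∑ s : Option k, cIndRep _ r (heckeG p s) (el _ r (w s))) ?_
  change hecke _ r (el _ r v) = _
  rw [hecke_el, Finset.smul_sum]
  refine Finset.sum_congr rfl fun s _ => ?_
  rw [hw, map_smul, map_smul]

lemma vec_congr {v w : SymV (Zq p k) r} (h : ∀ x y, ev v x y = ev w x y) :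
    D.vec v = D.vec w := by
  rw [← sub_eq_zero, ← map_sub]
  exact D.vec_eq_zero fun x y => by rw [ev_sub, h, sub_self]

/-- `K` acts on functions on `k²` through its reduction. -/
lemma rep_vec_of_congrOne (v : SymV (Zq p k) r) {u : GrpK p k} (hu : CongrOne p k 1 u) :
    π (incl p k u) (D.vec v) = D.vec v := by
  rw [rep_incl_vec]
  refine D.vec_congr fun x y => ?_
  have h1 : ∀ i j, WittVector.constantCoeff (u.1 i j)
      = (1 : Matrix (Fin 2) (Fin 2) k) i j := by
    intro i j
    have h2 := hu i j
    rw [pow_one, dvd_iff_coeff, ← WittVector.constantCoeff_apply, map_sub, sub_eq_zero] at h2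
    rw [h2]
    fin_cases i <;> fin_cases j <;> simp
  rw [ev_symRep, h1, h1, h1, h1]
  simp

lemma isSmooth (D : Reduction r π) : IsSmooth π := by
  refine isSmooth_of_span D.span_eq_top ?_
  rintro _ ⟨Ψ, rfl⟩
  induction Ψ using cInd_induction with
  | zero => exact ⟨0, fun u _ => by rw [map_zero, map_zero]⟩
  | add Ψ Ξ hΨ hΞ =>
    obtain ⟨n, hn⟩ := hΨ
    obtain ⟨m, hm⟩ := hΞ
    refine ⟨max n m, fun u hu => ?_⟩
    rw [map_add, map_add, hn u fun i j => (pow_dvd_pow _ (le_max_left n m)).trans (hu i j),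
      hm u fun i j => (pow_dvd_pow _ (le_max_right n m)).trans (hu i j)]
  | basic g v =>
    obtain ⟨m, hm⟩ := exists_conj_congr g 1
    refine ⟨m, fun u hu => ?_⟩
    obtain ⟨u', hu', e⟩ := hm u hu
    have h1 : incl p k u * g = g * incl p k u' := by rw [← e]; group
    rw [D.equivariant, ← Module.End.mul_apply, ← map_mul, h1, map_mul, Module.End.mul_apply,
      ← vec_apply, rep_vec_of_congrOne D v hu']

lemma eq_top_of_vec_mem (W : Subrepresentation π) (h : ∀ v, D.vec v ∈ W.toSubmodule) :
    W.toSubmodule = ⊤ := by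
  rw [← top_le_iff, ← D.span_eq_top, Submodule.span_le]
  rintro _ ⟨Ψ, rfl⟩
  induction Ψ using cInd_induction with
  | zero => rw [map_zero]; exact zero_mem _
  | add Ψ Ξ hΨ hΞ => rw [map_add]; exact add_mem hΨ hΞ
  | basic g v =>
    rw [D.equivariant]
    exact W.apply_mem_toSubmodule g (h v)

lemma coeff_eq_zero [CharP F p] {c : Zq p k} (hc : WittVector.constantCoeff c = 0) :
    D.coeff c = 0 := by
  rw [WittVector.constantCoeff_apply, ← dvd_iff_coeff] at hc
  obtain ⟨d, rfl⟩ := hc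
  rw [map_mul, map_natCast, CharP.cast_eq_zero, zero_mul]

end Reduction

end GL2Red
end

noncomputable section

namespace GL2Red

/-! ### Power sums over `k` and over Teichmüller representatives -/

section PowerSums

variable {p : ℕ} [Fact p.Prime] {k : Type} [Field k] [CharP k p] [Fintype k]

lemma pow_eq_pow_of_modEq {m n : ℕ} (h : m ≡ n [MOD Fintype.card k - 1]) (hm : 0 < m) (hn : 0 < n)
    (a : k) : a ^ m = a ^ n := by
  rcases eq_or_ne a 0 with rfl | ha
  · rw [zero_pow hm.ne', zero_pow hn.ne']
  · have h1 : ∀ m n : ℕ, m ≤ n → m ≡ n [MOD Fintype.card k - 1] → a ^ m = a ^ n := by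
      intro m n hmn h
      obtain ⟨d, hd⟩ := (Nat.modEq_iff_dvd' hmn).mp h
      have h2 : n = m + (Fintype.card k - 1) * d := by omega
      rw [h2, pow_add, pow_mul, FiniteField.pow_card_sub_one_eq_one a ha, one_pow, mul_one]
    rcases le_total m n with hmn | hmn
    · exact h1 m n hmn h
    · exact (h1 n m hmn h.symm).symm

lemma sum_pow_eq_zero {n : ℕ} (hn : ¬ Fintype.card k - 1 ∣ n) : ∑ x : k, x ^ n = 0 := by
  have h1 : ∃ g : kˣ, g ^ n ≠ 1 := by
    by_contra h
    push Not at h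
    exact hn ((FiniteField.forall_pow_eq_one_iff k n).mp h)
  obtain ⟨g, hg⟩ := h1
  have h2 : ∑ x : k, x ^ n = (g : k) ^ n * ∑ x : k, x ^ n := by
    rw [Finset.mul_sum, ← Equiv.sum_comp (Units.mulLeft g)]
    refine Finset.sum_congr rfl fun x _ => ?_
    rw [Units.mulLeft_apply, mul_pow]
  have h3 : (g : k) ^ n ≠ 1 := fun h => hg (Units.ext (by simpa using h))
  by_contra h4
  exact h3 ((mul_eq_right₀ h4).mp h2.symm)

lemma sum_pow_eq_neg_one {n : ℕ} (h0 : 0 < n) (hn : Fintype.card k - 1 ∣ n) :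
    ∑ x : k, x ^ n = -1 := by
  classical
  obtain ⟨d, rfl⟩ := hn
  rw [← Finset.add_sum_erase _ _ (Finset.mem_univ (0 : k)), zero_pow h0.ne', zero_add,
    Finset.sum_congr rfl fun x hx => by
      rw [pow_mul, FiniteField.pow_card_sub_one_eq_one x (Finset.ne_of_mem_erase hx), one_pow]]
  rw [Finset.sum_const, Finset.card_erase_of_mem (Finset.mem_univ _), Finset.card_univ,
    nsmul_eq_mul, mul_one, Nat.cast_sub Fintype.card_pos, FiniteField.cast_card_eq_zero]
  simp

local notation "τ" => WittVector.teichmuller (R := k) p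

lemma teichmuller_injective : Function.Injective (τ) := fun a b h => by
  simpa using congrArg (fun x => WittVector.coeff x 0) h

lemma frobenius_teichmuller (a : k) : WittVector.frobenius (τ a) = τ a ^ p := by
  rw [WittVector.frobenius_eq_map_frobenius, WittVector.map_teichmuller, ← map_pow]
  rfl

lemma constantCoeff_teichmuller (a : k) : WittVector.constantCoeff (τ a) = a := by simp

lemma sum_teichmuller_eq_zero {n : ℕ} (hn : ¬ Fintype.card k - 1 ∣ n) :
    ∑ x : k, τ x ^ n = 0 := by
  have h1 : ∃ g : kˣ, g ^ n ≠ 1 := by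
    by_contra h
    push Not at h
    exact hn ((FiniteField.forall_pow_eq_one_iff k n).mp h)
  obtain ⟨g, hg⟩ := h1
  have h2 : ∑ x : k, τ x ^ n = τ (g : k) ^ n * ∑ x : k, τ x ^ n := by
    rw [Finset.mul_sum, ← Equiv.sum_comp (Units.mulLeft g)]
    refine Finset.sum_congr rfl fun x _ => ?_
    rw [Units.mulLeft_apply, map_mul, mul_pow]
  have h3 : τ (g : k) ^ n ≠ 1 := fun h => hg (Units.ext (teichmuller_injective (p := p) (by
    simpa using h)))
  by_contra h4
  exact h3 ((mul_eq_right₀ h4).mp h2.symm)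

/-- The exact value is needed, not only its class modulo `p`: later `q = p ^ 2` has to vanish modulo
`p²`. -/
lemma sum_teichmuller_add_one {n : ℕ} (h0 : 0 < n) (hn : Fintype.card k - 1 ∣ n) :
    ∑ x : k, τ x ^ n + 1 = Fintype.card k := by
  classical
  obtain ⟨d, rfl⟩ := hn
  rw [← Finset.add_sum_erase _ _ (Finset.mem_univ (0 : k)), WittVector.teichmuller_zero,
    zero_pow h0.ne', zero_add,
    Finset.sum_congr rfl fun x hx => by
      rw [pow_mul, ← map_pow, FiniteField.pow_card_sub_one_eq_one x (Finset.ne_of_mem_erase hx),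
        map_one, one_pow]]
  rw [Finset.sum_const, Finset.card_erase_of_mem (Finset.mem_univ _), Finset.card_univ,
    nsmul_eq_mul, mul_one, Nat.cast_sub Fintype.card_pos]
  simp

end PowerSums

/-! ### Expansions of the Hecke matrices modulo `p²` -/

section Monomials

variable {p : ℕ} [Fact p.Prime] {k : Type} [Field k] [CharP k p] [Fintype k] {r : Fin 2 → ℕ}

/-- The monomial `X_0 ^ (r_0 - a) Y_0 ^ a X_1 ^ (r_1 - b) Y_1 ^ b`. -/
def wV (r : Fin 2 → ℕ) (a b : ℕ) : SymV (Zq p k) r :=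
  ⟨MvPolynomial.X (0, 0) ^ (r 0 - a) * MvPolynomial.X (0, 1) ^ (min a (r 0))
    * (MvPolynomial.X (1, 0) ^ (r 1 - b) * MvPolynomial.X (1, 1) ^ (min b (r 1))), by
    have h := fun v n => (MvPolynomial.isWeightedHomogeneous_X (Zq p k) (multiDeg 2) v).pow n
    have h1 := ((h (0, 0) (r 0 - a)).mul (h (0, 1) (min a (r 0)))).mul
      ((h (1, 0) (r 1 - b)).mul (h (1, 1) (min b (r 1))))
    have h2 : (r 0 - a) • multiDeg 2 (0, 0) + (min a (r 0)) • multiDeg 2 (0, 1)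
        + ((r 1 - b) • multiDeg 2 (1, 0) + (min b (r 1)) • multiDeg 2 (1, 1)) = r := by
      funext j
      fin_cases j
      · simp [multiDeg]
        omega
      · simp [multiDeg]
        omega
    rw [h2] at h1
    exact h1⟩

lemma wV_val {a b : ℕ} (ha : a ≤ r 0) (hb : b ≤ r 1) : (wV r a b : SymV (Zq p k) r).1
    = MvPolynomial.X (0, 0) ^ (r 0 - a) * MvPolynomial.X (0, 1) ^ a
      * (MvPolynomial.X (1, 0) ^ (r 1 - b) * MvPolynomial.X (1, 1) ^ b) := by
  change MvPolynomial.X (0, 0) ^ (r 0 - a) * MvPolynomial.X (0, 1) ^ (min a (r 0))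
    * (MvPolynomial.X (1, 0) ^ (r 1 - b) * MvPolynomial.X (1, 1) ^ (min b (r 1))) = _
  rw [min_eq_left ha, min_eq_left hb]

lemma ev_wV {a b : ℕ} (ha : a ≤ r 0) (hb : b ≤ r 1) (x y : k) :
    ev (wV r a b : SymV (Zq p k) r) x y
      = x ^ (r 0 - a + p * (r 1 - b)) * y ^ (a + p * b) := by
  rw [ev, wV_val ha hb, evHom]
  simp only [map_mul, map_pow, MvPolynomial.coe_eval₂Hom, MvPolynomial.eval₂_X]
  simp [pow_add, pow_mul]
  ring

lemma topV_zero : (topV r 0 : SymV (Zq p k) r) = wV r 0 0 :=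
  Subtype.ext (by rw [wV_val (Nat.zero_le _) (Nat.zero_le _)]; simp [topV, Fin.prod_univ_two])

lemma topV_one : (topV r 1 : SymV (Zq p k) r) = wV r (r 0) (r 1) :=
  Subtype.ext (by rw [wV_val le_rfl le_rfl]; simp [topV, Fin.prod_univ_two])

/-- First order Taylor expansion in `P`, later taken at `P = p`. The linear term is where the
factors `r_0` and `r_1` arise, hence the divisibility conditions on them. -/
lemma exists_expand {R : Type} [CommRing R] (x₀ y₀ x₁ y₁ P : R) (n m : ℕ) : ∃ K,
    (x₀ + P * y₀) ^ n * (x₁ + P * y₁) ^ m = x₀ ^ n * x₁ ^ m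
      + P * (n * x₀ ^ (n - 1) * y₀ * x₁ ^ m + m * x₁ ^ (m - 1) * y₁ * x₀ ^ n) + P ^ 2 * K := by
  obtain ⟨K₀, h₀⟩ := Polynomial.powAddExpansion x₀ (P * y₀) n
  obtain ⟨K₁, h₁⟩ := Polynomial.powAddExpansion x₁ (P * y₁) m
  rw [h₀, h₁]
  refine ⟨K₀ * y₀ ^ 2 * (x₁ ^ m + m * x₁ ^ (m - 1) * (P * y₁) + K₁ * (P * y₁) ^ 2)
    + (n * x₀ ^ (n - 1) * y₀) * (m * x₁ ^ (m - 1) * y₁ + K₁ * P * y₁ ^ 2)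
    + x₀ ^ n * K₁ * y₁ ^ 2, ?_⟩
  ring

lemma symRep_topV_one_val (m : Matrix (Fin 2) (Fin 2) (Zq p k)) :
    (symRep (RingHom.id (Zq p k)) r m (topV r 1)).1
      = (MvPolynomial.C (m 0 1) * MvPolynomial.X (0, 0)
          + MvPolynomial.C (m 1 1) * MvPolynomial.X (0, 1)) ^ r 0
        * (MvPolynomial.C (WittVector.frobenius (m 0 1)) * MvPolynomial.X (1, 0)
          + MvPolynomial.C (WittVector.frobenius (m 1 1)) * MvPolynomial.X (1, 1)) ^ r 1 := by
  change substHom (RingHom.id (Zq p k)) 2 m (∏ i, MvPolynomial.X (i, 1) ^ r i) = _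
  simp [substHom, Fin.prod_univ_two]

lemma exists_eq_add_smul_sq {v w : SymV (Zq p k) r} {K : MvPolynomial (Fin 2 × Fin 2) (Zq p k)}
    (h : v.1 = w.1 + MvPolynomial.C (p : Zq p k) ^ 2 * K) :
    ∃ u, v = w + (p : Zq p k) ^ 2 • u := by
  have h1 : MvPolynomial.C ((p : Zq p k) ^ 2) ∣ (v - w).1 := by
    refine ⟨K, ?_⟩
    change v.1 - w.1 = _
    rw [h, add_sub_cancel_left, MvPolynomial.C_pow]
  obtain ⟨u, hu⟩ := exists_smul_pow h1
  exact ⟨u, by rw [← hu, add_sub_cancel]⟩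

lemma exists_symRep_topV_some (h0 : 1 ≤ r 0) (h1 : 1 ≤ r 1) {m : Matrix (Fin 2) (Fin 2) (Zq p k)}
    (hm : m 1 1 = p) : ∃ w, symRep (RingHom.id (Zq p k)) r m (topV r 1)
      = (m 0 1 ^ r 0 * WittVector.frobenius (m 0 1) ^ r 1) • wV r 0 0
        + (p : Zq p k) • ((r 0 * (m 0 1 ^ (r 0 - 1) * WittVector.frobenius (m 0 1) ^ r 1)) • wV r 1 0
          + (r 1 * (m 0 1 ^ r 0 * WittVector.frobenius (m 0 1) ^ (r 1 - 1))) • wV r 0 1)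
        + (p : Zq p k) ^ 2 • w := by
  obtain ⟨K, hK⟩ := exists_expand
    (MvPolynomial.C (m 0 1) * MvPolynomial.X (0, 0) : MvPolynomial (Fin 2 × Fin 2) (Zq p k))
    (MvPolynomial.X (0, 1)) (MvPolynomial.C (WittVector.frobenius (m 0 1)) * MvPolynomial.X (1, 0))
    (MvPolynomial.X (1, 1)) (MvPolynomial.C (p : Zq p k)) (r 0) (r 1)
  refine exists_eq_add_smul_sq (K := K) ?_
  have h2 := symRep_topV_one_val (r := r) m
  have hf : WittVector.frobenius (p : Zq p k) = p := map_natCast _ p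
  rw [hm, hf, hK] at h2
  rw [h2]
  generalize m 0 1 = b
  generalize WittVector.frobenius b = b'
  congr 1
  have e : ∀ (s t u v : Zq p k) , ((s • wV r 0 0 + v • (t • wV r 1 0 + u • wV r 0 1)
      : SymV (Zq p k) r)).1 = MvPolynomial.C s * (wV r 0 0 : SymV (Zq p k) r).1
        + MvPolynomial.C v * (MvPolynomial.C t * (wV r 1 0 : SymV (Zq p k) r).1
          + MvPolynomial.C u * (wV r 0 1 : SymV (Zq p k) r).1) := by
    intro s t u v
    simp only [← MvPolynomial.smul_eq_C_mul]
    rfl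
  rw [e, wV_val (Nat.zero_le _) (Nat.zero_le _), wV_val h0 (Nat.zero_le _),
    wV_val (Nat.zero_le _) h1]
  simp only [map_mul, map_pow, map_natCast, pow_zero, pow_one, mul_pow, Nat.sub_zero]
  ring

lemma exists_symRep_topV_none (h0 : 1 ≤ r 0) (h1 : 1 ≤ r 1) {m : Matrix (Fin 2) (Fin 2) (Zq p k)}
    {b : Zq p k} (hm0 : m 0 1 = p * b) (hm : m 1 1 = 1) :
    ∃ w, symRep (RingHom.id (Zq p k)) r m (topV r 1)
      = topV r 1 + (p : Zq p k) • ((r 0 * b) • wV r (r 0 - 1) (r 1)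
          + (r 1 * WittVector.frobenius b) • wV r (r 0) (r 1 - 1))
        + (p : Zq p k) ^ 2 • w := by
  obtain ⟨K, hK⟩ := exists_expand
    (MvPolynomial.X (0, 1) : MvPolynomial (Fin 2 × Fin 2) (Zq p k))
    (MvPolynomial.C b * MvPolynomial.X (0, 0)) (MvPolynomial.X (1, 1))
    (MvPolynomial.C (WittVector.frobenius b) * MvPolynomial.X (1, 0))
    (MvPolynomial.C (p : Zq p k)) (r 0) (r 1)
  refine exists_eq_add_smul_sq (K := K) ?_
  have h2 := symRep_topV_one_val (r := r) m
  have hf : WittVector.frobenius (p * b : Zq p k) = p * WittVector.frobenius b := by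
    rw [map_mul, map_natCast]
  have hf' : WittVector.frobenius (1 : Zq p k) = 1 := map_one _
  rw [hm, hm0, hf, hf', MvPolynomial.C_1, one_mul, one_mul, MvPolynomial.C_mul, MvPolynomial.C_mul, mul_assoc, mul_assoc, add_comm (_ * _) (MvPolynomial.X _),
    add_comm (_ * _) (MvPolynomial.X _), hK] at h2
  rw [h2]
  generalize WittVector.frobenius b = b'
  congr 1
  have e : ∀ (t u v : Zq p k) , ((topV r 1 + v • (t • wV r (r 0 - 1) (r 1)
      + u • wV r (r 0) (r 1 - 1)) : SymV (Zq p k) r)).1 = (topV r 1 : SymV (Zq p k) r).1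
        + MvPolynomial.C v * (MvPolynomial.C t * (wV r (r 0 - 1) (r 1) : SymV (Zq p k) r).1
          + MvPolynomial.C u * (wV r (r 0) (r 1 - 1) : SymV (Zq p k) r).1) := by
    intro t u v
    simp only [← MvPolynomial.smul_eq_C_mul]
    rfl
  rw [e, topV_one, wV_val le_rfl le_rfl, wV_val (Nat.sub_le _ _) le_rfl,
    wV_val le_rfl (Nat.sub_le _ _), Nat.sub_sub_self h0, Nat.sub_sub_self h1]
  simp only [map_mul, map_natCast, pow_zero, pow_one, Nat.sub_self]
  ring

end Monomials

end GL2Red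
end

noncomputable section

namespace GL2Red

/-! ### The Hecke operator on combinations of unipotent translates -/

section HeckeComputation

variable {p : ℕ} [Fact p.Prime] {k : Type} [Field k] [CharP k p] [Fintype k] {r : Fin 2 → ℕ}

local notation "τ" => WittVector.teichmuller (R := k) p

/-- Power sums over the differences `[μ] - [λ]`. -/
def diffSum (φ : k → Zq p k) (a b : ℕ) (lam : k) : Zq p k :=
  ∑ mu : k, φ mu * ((τ mu - τ lam) ^ a * WittVector.frobenius (τ mu - τ lam) ^ b)

lemma constantCoeff_frobenius (x : Zq p k) :
    WittVector.constantCoeff (WittVector.frobenius x) = WittVector.constantCoeff x ^ p := by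
  simp [WittVector.coeff_frobenius_charP]

lemma constantCoeff_diffSum (φ : k → Zq p k) (a b : ℕ) (lam : k) :
    WittVector.constantCoeff (diffSum φ a b lam)
      = ∑ mu : k, WittVector.constantCoeff (φ mu) * (mu - lam) ^ (a + p * b) := by
  rw [diffSum, map_sum]
  refine Finset.sum_congr rfl fun mu _ => ?_
  rw [map_mul, map_mul, map_pow, map_pow, constantCoeff_frobenius, map_sub,
    constantCoeff_teichmuller, constantCoeff_teichmuller, pow_add, pow_mul]

/-- A combination of the upper unipotent translates of `∏ Y_i ^ r_i` and of `∏ X_i ^ r_i`. -/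
def uniV (r : Fin 2 → ℕ) (φ : k → Zq p k) (ε : Zq p k) : SymV (Zq p k) r :=
  ∑ mu : k, φ mu • symRep (RingHom.id _) r (upK (τ mu)).1 (topV r 1) + ε • wV r 0 0

lemma symRep_wV_zero (m : Matrix (Fin 2) (Fin 2) (Zq p k)) (hm : m 1 0 = 0) :
    symRep (RingHom.id _) r m (wV r 0 0)
      = (m 0 0 ^ r 0 * WittVector.frobenius (m 0 0) ^ r 1) • wV r 0 0 := by
  apply Subtype.ext
  have h1 : (symRep (RingHom.id _) r m (wV r 0 0)).1
      = substHom (RingHom.id (Zq p k)) 2 m (wV r 0 0 : SymV (Zq p k) r).1 := rfl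
  have h2 : ∀ c : Zq p k, (c • wV r 0 0 : SymV (Zq p k) r).1
      = MvPolynomial.C c * (wV r 0 0 : SymV (Zq p k) r).1 := fun c => by
    rw [← MvPolynomial.smul_eq_C_mul]
    rfl
  rw [h1, h2, wV_val (Nat.zero_le _) (Nat.zero_le _)]
  simp [substHom, hm]
  ring

/-- The upper right entry of `(1 -[λ]; 0 p) (1 [μ]; 0 1)` is `[μ] - [λ]`; the coefficients modulo
`p²` are therefore weighted power sums of these differences. -/
lemma symRep_heckeAdj_some_uniV (h0 : 1 ≤ r 0) (h1 : 1 ≤ r 1) (φ : k → Zq p k) (ε : Zq p k)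
    (lam : k) : ∃ w, symRep (RingHom.id _) r (heckeAdj (some lam)) (uniV r φ ε)
      = (diffSum φ (r 0) (r 1) lam + ε) • wV r 0 0
        + (p : Zq p k) • ((r 0 * diffSum φ (r 0 - 1) (r 1) lam) • wV r 1 0
          + (r 1 * diffSum φ (r 0) (r 1 - 1) lam) • wV r 0 1) + (p : Zq p k) ^ 2 • w := by
  have h2 : ∀ mu : k, ((heckeAdj (some lam) : Matrix (Fin 2) (Fin 2) (Zq p k))
      * (upK (τ mu)).1) 0 1 = τ mu - τ lam := by
    intro mu
    rw [heckeAdj_some, coe_upK]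
    simp [Matrix.mul_apply, sub_eq_add_neg]
  have h3 : ∀ mu : k, ((heckeAdj (some lam) : Matrix (Fin 2) (Fin 2) (Zq p k))
      * (upK (τ mu)).1) 1 1 = p := by
    intro mu
    rw [heckeAdj_some, coe_upK]
    simp [Matrix.mul_apply]
  choose w hw using fun mu => exists_symRep_topV_some h0 h1 (h3 mu)
  simp_rw [h2] at hw
  refine ⟨∑ mu : k, φ mu • w mu, ?_⟩
  have h4 : symRep (RingHom.id _) r (heckeAdj (some lam)) (wV r 0 0) = wV r 0 0 := by
    rw [symRep_wV_zero _ (by rw [heckeAdj_some]; rfl), heckeAdj_some]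
    simp
  rw [uniV, map_add, map_sum, map_smul, h4]
  simp_rw [map_smul, ← Module.End.mul_apply, ← map_mul, hw]
  simp only [smul_add, Finset.sum_add_distrib, diffSum, Finset.mul_sum, Finset.sum_smul,
    Finset.smul_sum, add_smul, smul_smul]
  simp only [mul_left_comm, mul_comm]
  abel

lemma symRep_heckeAdj_none_uniV (h0 : 1 ≤ r 0) (h1 : 1 ≤ r 1) (φ : k → Zq p k) (ε : Zq p k) :
    ∃ w, symRep (RingHom.id _) r (heckeAdj (none : Option k)) (uniV r φ ε)
      = (∑ mu, φ mu) • topV r 1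
        + (p : Zq p k) • ((r 0 * ∑ mu, φ mu * τ mu) • wV r (r 0 - 1) (r 1)
          + (r 1 * ∑ mu, φ mu * τ mu ^ p) • wV r (r 0) (r 1 - 1)) + (p : Zq p k) ^ 2 • w := by
  have h2 : ∀ mu : k, ((heckeAdj (none : Option k) : Matrix (Fin 2) (Fin 2) (Zq p k))
      * (upK (τ mu)).1) 0 1 = p * τ mu := by
    intro mu
    rw [heckeAdj_none, coe_upK]
    simp [Matrix.mul_apply]
  have h3 : ∀ mu : k, ((heckeAdj (none : Option k) : Matrix (Fin 2) (Fin 2) (Zq p k))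
      * (upK (τ mu)).1) 1 1 = 1 := by
    intro mu
    rw [heckeAdj_none, coe_upK]
    simp [Matrix.mul_apply]
  choose w hw using fun mu => exists_symRep_topV_none h0 h1 (h2 mu) (h3 mu)
  simp_rw [frobenius_teichmuller] at hw
  -- The matrix `(p 0; 0 1)` multiplies `∏ X_i ^ r_i` by `p ^ (r_0 + r_1)`, which absorbs the
  -- required `p²`.
  refine ⟨∑ mu : k, φ mu • w mu + (ε * (p : Zq p k) ^ (r 0 - 1 + (r 1 - 1))) • wV r 0 0, ?_⟩
  have h4 : symRep (RingHom.id _) r (heckeAdj (none : Option k)) (wV r 0 0)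
      = ((p : Zq p k) ^ 2 * (p : Zq p k) ^ (r 0 - 1 + (r 1 - 1))) • wV r 0 0 := by
    have hf : WittVector.frobenius (p : Zq p k) = p := map_natCast _ p
    rw [symRep_wV_zero _ (by rw [heckeAdj_none]; rfl), heckeAdj_none]
    simp only [Matrix.of_apply, Matrix.cons_val_zero, Matrix.cons_val_zero]
    rw [hf, ← pow_add, ← pow_add]
    congr 2
    omega
  rw [uniV, map_add, map_sum, map_smul, h4]
  simp_rw [map_smul, ← Module.End.mul_apply, ← map_mul, hw]
  simp only [smul_add, Finset.sum_add_distrib, Finset.mul_sum, Finset.sum_smul,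
    Finset.smul_sum, smul_smul]
  simp only [mul_left_comm, mul_comm]
  abel

/-- Translates by `(p [μ]; 0 1)` of a function living on the coset of `(1 0; 0 p)` return to the
base vertex, as `p` acts trivially. The next lemma does the same for the remaining representative.
-/
lemma heckeG_some_mul_heckeG_none (mu : k) : (heckeG p (some mu) * heckeG p none : GrpG p k)
    = scalarP p k * incl p k (upK (τ mu)) := by
  apply Units.ext
  rw [coe_scalarP_mul, incl_upK, coe_upG, heckeG_some, heckeG_none, Units.val_mul, coe_borel,
    coe_borel, coe_pU]
  ext i j
  fin_cases i <;> fin_cases j <;> simp [Matrix.mul_apply, mul_comm]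

lemma heckeG_none_mul_wK_mul_heckeG_none :
    (heckeG p (none : Option k) * incl p k wK * heckeG p (none : Option k) : GrpG p k)
      = scalarP p k * incl p k wK := by
  apply Units.ext
  have h1 : (!![0, 1; 1, 0] : Matrix (Fin 2) (Fin 2) (Zq p k)).map (algebraMap (Zq p k) (Qq p k))
      = !![0, 1; 1, 0] := by
    ext i j
    fin_cases i <;> fin_cases j <;> simp
  rw [coe_scalarP_mul, coe_incl, coe_wK, heckeG_none, Units.val_mul, Units.val_mul, coe_borel,
    coe_incl, coe_wK, coe_pU, h1]
  ext i j
  fin_cases i <;> fin_cases j <;> simp [Matrix.mul_apply]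

/-- The difference of `∏ Y_i ^ r_i` and a monomial that coincides with it on `k²` away from the
line `x = 0`. -/
def deltaV (r : Fin 2 → ℕ) (c : ℕ) : SymV (Zq p k) r := topV r 1 - wV r c 0

variable {c : ℕ} (hc : 0 < c) (hcr : c < r 0)
  (hN : r 0 + p * r 1 ≡ c [MOD Fintype.card k - 1])

lemma ev_topV_one (x y : k) : ev (topV r 1 : SymV (Zq p k) r) x y = y ^ (r 0 + p * r 1) := by
  rw [topV_one, ev_wV le_rfl le_rfl]
  simp

include hc hcr hN

lemma ev_wV_eq (a : ℕ) (ha : a < r 0) (b : ℕ) (hb : 0 < b)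
    (h : a + b ≡ c [MOD Fintype.card k - 1]) (x y : k) :
    ev (wV r a 0 : SymV (Zq p k) r) x y = x ^ b * y ^ a := by
  rw [ev_wV ha.le (Nat.zero_le _), mul_zero, add_zero, Nat.sub_zero]
  congr 1
  refine pow_eq_pow_of_modEq ?_ (by omega) hb x
  refine Nat.ModEq.add_left_cancel' a ?_
  rw [← add_assoc, Nat.add_sub_cancel' ha.le]
  exact hN.trans h.symm

/-- The factor `1 - x ^ (q - 1)` is the characteristic function of the line `x = 0`. -/
lemma ev_deltaV (x y : k) : ev (deltaV r c : SymV (Zq p k) r) x y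
    = (1 - x ^ (Fintype.card k - 1)) * y ^ c := by
  have hq : 0 < Fintype.card k - 1 := by have := Fintype.one_lt_card (α := k); omega
  rw [deltaV, ev_sub, ev_topV_one, pow_eq_pow_of_modEq hN (by omega) hc,
    ev_wV_eq hc hcr hN c hcr _ hq (by simp [Nat.ModEq])]
  ring

/-- The function of `deltaV` vanishes at every `(1, -λ)` and is `1` at `(0, 1)`, so modulo `p` only
one representative contributes. -/
lemma exists_hecke_deltaV : ∃ Ξ : cInd (RingHom.id (Zq p k)) r, hecke (RingHom.id (Zq p k)) r (el _ r (deltaV r c : SymV (Zq p k) r))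
    = cIndRep _ r (heckeG p none) (el _ r (topV r 1)) + (p : Zq p k) • Ξ := by
  have h1 : ∀ lam : k, ∃ w, symRep (RingHom.id _) r (heckeAdj (some lam)) (deltaV r c)
      = (p : Zq p k) • w := by
    intro lam
    obtain ⟨w, hw⟩ := heckeAdj_some_mod lam (deltaV r c : SymV (Zq p k) r) (c := 0) (by
      rw [ev_deltaV hc hcr hN, one_pow, sub_self, zero_mul, map_zero])
    exact ⟨w, by rw [hw, zero_smul, zero_add]⟩
  obtain ⟨w, hw⟩ := heckeAdj_none_mod (deltaV r c : SymV (Zq p k) r) (c := 1) (by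
    have hq : Fintype.card k - 1 ≠ 0 := by have := Fintype.one_lt_card (α := k); omega
    rw [ev_deltaV hc hcr hN, one_pow, zero_pow hq, map_one, sub_zero, mul_one])
  choose v hv using h1
  refine ⟨cIndRep _ r (heckeG p none) (el _ r w)
    + ∑ lam : k, cIndRep _ r (heckeG p (some lam)) (el _ r (v lam)), ?_⟩
  rw [hecke_el, Fintype.sum_option, hw, one_smul, map_add, map_add, map_smul, map_smul, smul_add,
    Finset.smul_sum, add_assoc]
  congr 2
  refine Finset.sum_congr rfl fun lam _ => ?_
  rw [hv, map_smul, map_smul]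

lemma exists_hecke_sum_some (φ : k → Zq p k) : ∃ Ξ : cInd (RingHom.id (Zq p k)) r, hecke (RingHom.id (Zq p k)) r (∑ mu : k,
      φ mu • cIndRep _ r (heckeG p (some mu)) (el _ r (deltaV r c : SymV (Zq p k) r)))
    = el _ r (uniV r φ 0) + (p : Zq p k) • Ξ := by
  obtain ⟨Ξ, hΞ⟩ := exists_hecke_deltaV hc hcr hN
  refine ⟨∑ mu : k, φ mu • cIndRep _ r (heckeG p (some mu)) Ξ, ?_⟩
  rw [map_sum, uniV, zero_smul, add_zero, map_sum, Finset.smul_sum, ← Finset.sum_add_distrib]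
  refine Finset.sum_congr rfl fun mu _ => ?_
  rw [map_smul, hecke_comm, hΞ, map_add, ← Module.End.mul_apply, ← map_mul,
    heckeG_some_mul_heckeG_none, map_mul, Module.End.mul_apply, cIndRep_scalarP, cIndRep_incl_el,
    map_smul, map_smul, smul_add, smul_comm]

lemma exists_hecke_sum_option : ∃ Ξ : cInd (RingHom.id (Zq p k)) r, hecke (RingHom.id (Zq p k)) r (∑ mu : k,
      cIndRep _ r (heckeG p (some mu)) (el _ r (deltaV r c : SymV (Zq p k) r))
        + cIndRep _ r (heckeG p none) (cIndRep _ r (incl p k wK) (el _ r (deltaV r c))))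
    = el _ r (uniV r (fun _ => 1) 1) + (p : Zq p k) • Ξ := by
  obtain ⟨Ξ, hΞ⟩ := exists_hecke_deltaV hc hcr hN
  obtain ⟨Ξ', hΞ'⟩ := exists_hecke_sum_some hc hcr hN (fun _ => 1)
  refine ⟨Ξ' + cIndRep _ r (heckeG p none) (cIndRep _ r (incl p k wK) Ξ), ?_⟩
  simp only [one_smul] at hΞ'
  have h1 : symRep (RingHom.id (Zq p k)) r (wK : GrpK p k).1 (topV r 1) = wV r 0 0 := by
    apply Subtype.ext
    rw [symRep_topV_one_val, coe_wK, wV_val (Nat.zero_le _) (Nat.zero_le _)]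
    simp
  have h2 : (uniV r (fun _ => 1) 1 : SymV (Zq p k) r) = uniV r (fun _ => 1) 0 + wV r 0 0 := by
    simp [uniV]
  rw [map_add, hΞ', hecke_comm, hecke_comm, hΞ, map_add, map_add, ← Module.End.mul_apply,
    ← Module.End.mul_apply, ← map_mul, ← map_mul, heckeG_none_mul_wK_mul_heckeG_none,
    map_mul, Module.End.mul_apply, cIndRep_scalarP, cIndRep_incl_el, h1, h2, map_add, map_smul,
    map_smul, smul_add]
  abel

end HeckeComputation

end GL2Red
end

noncomputable section

namespace GL2Red

/-! ### Corrections modulo `p²` -/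

section Correction

variable {p : ℕ} [Fact p.Prime] {k : Type} [Field k] [CharP k p] [Fintype k] {r : Fin 2 → ℕ}

local notation "τ" => WittVector.teichmuller (R := k) p

lemma exists_eq_mul_of_constantCoeff {x : Zq p k} (h : WittVector.constantCoeff x = 0) :
    ∃ y, x = p * y := by
  rwa [WittVector.constantCoeff_apply, ← dvd_iff_coeff] at h

lemma sum_sub_pow (lam : k) (n : ℕ) : ∑ mu : k, (mu - lam) ^ n = ∑ mu : k, mu ^ n :=
  Equiv.sum_comp (Equiv.subRight lam) fun mu : k => mu ^ n

lemma constantCoeff_diffSum_one {a b : ℕ} (h : ¬ Fintype.card k - 1 ∣ a + p * b) (lam : k) :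
    WittVector.constantCoeff (diffSum (fun _ : k => (1 : Zq p k)) a b lam) = 0 := by
  rw [constantCoeff_diffSum]
  simp only [map_one, one_mul]
  rw [sum_sub_pow, sum_pow_eq_zero h]

lemma diffSum_one_zero (a b : ℕ) : diffSum (fun _ : k => (1 : Zq p k)) a b 0
    = ∑ mu : k, τ mu ^ (a + p * b) := by
  rw [diffSum]
  refine Finset.sum_congr rfl fun mu _ => ?_
  rw [WittVector.teichmuller_zero, sub_zero, frobenius_teichmuller, one_mul, pow_add, pow_mul]

/-- Substituting `μ ↦ λ μ` and multiplicativity of the Teichmüller lift pull out a power of `[λ]`.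
-/
lemma diffSum_one_of_ne_zero (a b : ℕ) {lam : k} (h : lam ≠ 0) :
    diffSum (fun _ : k => (1 : Zq p k)) a b lam
      = τ lam ^ (a + p * b) * diffSum (fun _ : k => (1 : Zq p k)) a b 1 := by
  rw [diffSum, diffSum, Finset.mul_sum, ← Equiv.sum_comp (Equiv.mulLeft₀ lam h)]
  refine Finset.sum_congr rfl fun mu _ => ?_
  have h1 : τ (lam * mu) - τ lam = τ lam * (τ mu - τ 1) := by
    rw [map_mul, map_one, mul_sub, mul_one]
  rw [Equiv.mulLeft₀_apply, h1]
  generalize τ mu - τ 1 = x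
  rw [map_mul, frobenius_teichmuller, pow_add, pow_mul]
  ring

/-- By homogeneity all `λ ≠ 0` are governed by the value at `λ = 1`, which with `ε` is divisible by
`p` and defines `s`. At `λ = 0` the sum with `ε` is `q = p²` or zero, which agrees modulo `p²` with
the vanishing main term. -/
lemma exists_diffSum_eq {a b : ℕ} (h0 : 0 < a + p * b) (hcard : Fintype.card k = p ^ 2) {ε : Zq p k}
    (hε : ε = 1 ∧ Fintype.card k - 1 ∣ a + p * b ∨ ε = 0 ∧ ¬ Fintype.card k - 1 ∣ a + p * b) :
    ∃ s : Zq p k, ∀ lam : k, ∃ e, diffSum (fun _ : k => (1 : Zq p k)) a b lam + ε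
      = p * (s * τ lam ^ (a + p * b)) + (p : Zq p k) ^ 2 * e := by
  have h1 : WittVector.constantCoeff (diffSum (fun _ : k => (1 : Zq p k)) a b 1 + ε) = 0 := by
    rw [map_add]
    rcases hε with ⟨rfl, h⟩ | ⟨rfl, h⟩
    · rw [constantCoeff_diffSum]
      simp only [map_one, one_mul]
      rw [sum_sub_pow,
        sum_pow_eq_neg_one h0 h, neg_add_cancel]
    · rw [constantCoeff_diffSum_one h, map_zero, zero_add]
  obtain ⟨s, hs⟩ := exists_eq_mul_of_constantCoeff h1
  refine ⟨s, fun lam => ?_⟩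
  rcases eq_or_ne lam 0 with rfl | hlam
  · rw [diffSum_one_zero, WittVector.teichmuller_zero, zero_pow h0.ne']
    rcases hε with ⟨rfl, h⟩ | ⟨rfl, h⟩
    · refine ⟨1, ?_⟩
      rw [sum_teichmuller_add_one h0 h, hcard]
      push_cast
      ring
    · exact ⟨0, by rw [sum_teichmuller_eq_zero h]; ring⟩
  · refine ⟨0, ?_⟩
    have h2 : τ lam ^ (a + p * b) * ε = ε := by
      rcases hε with ⟨rfl, d, hd⟩ | ⟨rfl, h⟩
      · rw [hd, ← map_pow, pow_mul, FiniteField.pow_card_sub_one_eq_one lam hlam, one_pow, map_one,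
          one_mul]
      · rw [mul_zero]
    have h3 : diffSum (fun _ : k => (1 : Zq p k)) a b lam + ε
        = τ lam ^ (a + p * b) * (diffSum (fun _ : k => (1 : Zq p k)) a b 1 + ε) := by
      rw [mul_add, h2, diffSum_one_of_ne_zero a b hlam]
    rw [h3, hs]
    ring

variable {c : ℕ} (hc : 0 < c) (hcr : c < r 0) (hr1 : 1 ≤ r 1)
  (hN : r 0 + p * r 1 ≡ c [MOD Fintype.card k - 1]) (hcard : Fintype.card k = p ^ 2) (hp : 2 < p)

include hc hcr hr1 hN hcard hp

/-- By `exists_diffSum_eq` the term of order `p` depends on `λ` only through `[λ] ^ (r_0 + p r_1)`,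
and `T` produces exactly this dependence from a multiple of `X_0 ^ (r_0 - c) Y_0 ^ c X_1 ^ r_1`. The
hypotheses `h0` and `h1` remove the linear Taylor terms. -/
lemma exists_correction {ε : Zq p k}
    (hε : ε = 1 ∧ Fintype.card k - 1 ∣ r 0 + p * r 1 ∨ ε = 0 ∧ ¬ Fintype.card k - 1 ∣ r 0 + p * r 1)
    (h0 : ¬ Fintype.card k - 1 ∣ r 0 - 1 + p * r 1 ∨ p ∣ r 0)
    (h1 : ¬ Fintype.card k - 1 ∣ r 0 + p * (r 1 - 1)) :
    ∃ Z : SymV (Zq p k) r, ∀ s : Option k, ∃ w,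
      symRep (RingHom.id _) r (heckeAdj s) (uniV r (fun _ => 1) ε)
        - (p : Zq p k) • symRep (RingHom.id _) r (heckeAdj s) Z = (p : Zq p k) ^ 2 • w := by
  have hpq : p < p ^ 2 - 1 := by
    have : 3 * p ≤ p ^ 2 := by nlinarith
    omega
  obtain ⟨s₁, hs₁⟩ := exists_diffSum_eq (k := k) (a := r 0) (b := r 1) (by omega) hcard hε
  -- The sign compensates for the evaluation at `(1, -λ)`, which gives `(-λ) ^ c`.
  refine ⟨((-1) ^ c * s₁) • wV r c 0, fun s => ?_⟩
  cases s with
  | none =>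
    obtain ⟨w, hw⟩ := symRep_heckeAdj_none_uniV (by omega : 1 ≤ r 0) hr1
      (fun _ : k => (1 : Zq p k)) ε
    obtain ⟨w', hw'⟩ := heckeAdj_none_mod (((-1) ^ c * s₁) • wV r c 0 : SymV (Zq p k) r) (c := 0) (by
      rw [ev_smul, ev_wV hcr.le (Nat.zero_le _), zero_pow (by omega), zero_mul, mul_zero, map_zero])
    have h2 : ∑ mu : k, τ mu = 0 := by
      have := sum_teichmuller_eq_zero (p := p) (k := k) (n := 1) (fun h => by
        have := Nat.le_of_dvd one_pos h
        omega)
      simpa using this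
    have h3 : ∑ mu : k, τ mu ^ p = 0 := sum_teichmuller_eq_zero (fun h => by
        have := Nat.le_of_dvd (by omega) h
        omega)
    simp only [one_mul, h2, h3, Finset.sum_const, Finset.card_univ, hcard, nsmul_eq_mul,
      mul_one] at hw
    rw [hw, hw']
    refine ⟨topV r 1 + w - w', ?_⟩
    push_cast
    module
  | some lam =>
    obtain ⟨w, hw⟩ := symRep_heckeAdj_some_uniV (by omega : 1 ≤ r 0) hr1
      (fun _ : k => (1 : Zq p k)) ε lam
    obtain ⟨e, he⟩ := hs₁ lam
    obtain ⟨w', hw'⟩ := heckeAdj_some_mod lam (((-1) ^ c * s₁) • wV r c 0 : SymV (Zq p k) r)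
      (c := s₁ * τ lam ^ (r 0 + p * r 1)) (by
        rw [ev_smul, ev_wV hcr.le (Nat.zero_le _), one_pow, map_mul, map_mul, map_pow, map_pow,
          constantCoeff_teichmuller, map_neg, map_one, pow_eq_pow_of_modEq hN (by omega) hc, mul_zero,
          add_zero, one_mul, mul_right_comm, ← mul_pow, neg_one_mul, neg_neg, mul_comm])
    have h2 : ∃ b, (r 0 : Zq p k) * diffSum (fun _ : k => (1 : Zq p k)) (r 0 - 1) (r 1) lam
        = p * b := by
      apply exists_eq_mul_of_constantCoeff
      rw [map_mul]
      rcases h0 with h0 | h0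
      · rw [constantCoeff_diffSum_one h0, mul_zero]
      · rw [map_natCast, (CharP.cast_eq_zero_iff k p _).mpr h0, zero_mul]
    have h3 : ∃ b, (r 1 : Zq p k) * diffSum (fun _ : k => (1 : Zq p k)) (r 0) (r 1 - 1) lam
        = p * b := by
      apply exists_eq_mul_of_constantCoeff
      rw [map_mul, constantCoeff_diffSum_one h1, mul_zero]
    obtain ⟨b₀, hb₀⟩ := h2
    obtain ⟨b₁, hb₁⟩ := h3
    rw [hw, hw', he, hb₀, hb₁, topV_zero]
    refine ⟨e • wV r 0 0 + (b₀ • wV r 1 0 + b₁ • wV r 0 1) + w - w', ?_⟩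
    module

end Correction

/-! ### Vanishing of `T` and `U_p` on the generators -/

namespace Reduction

variable {p : ℕ} [Fact p.Prime] {k : Type} [Field k] [CharP k p] [Fintype k] {r : Fin 2 → ℕ}
  {F V : Type} [Field F] [CharP F p] [AddCommGroup V] [Module F V]
  {π : Representation F (GrpG p k) V} (D : Reduction r π)

local notation "τ" => WittVector.teichmuller (R := k) p

/-- Subtracting `p (Ξ + [1, Z])` from `T Ψ` makes the second application of `T` divisible by `p²`.
-/
lemma red_eq_zero_of_correction {Ψ Ξ : cInd (RingHom.id (Zq p k)) r} {u : SymV (Zq p k) r}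
    (hΨ : hecke _ r Ψ = el _ r u + (p : Zq p k) • Ξ) {Z : SymV (Zq p k) r}
    (hZ : ∀ s : Option k, ∃ w, symRep (RingHom.id _) r (heckeAdj s) u
        - (p : Zq p k) • symRep (RingHom.id _) r (heckeAdj s) Z = (p : Zq p k) ^ 2 • w) :
    D.red Ψ = 0 := by
  choose w hw using hZ
  refine D.eq_zero_of_hecke_sq Ψ (Ξ + el _ r Z)
    (∑ s : Option k, cIndRep _ r (heckeG p s) (el _ r (w s))) ?_
  have h1 : hecke _ r Ψ - (p : Zq p k) • (Ξ + el _ r Z)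
      = el _ r u - (p : Zq p k) • el _ r Z := by
    rw [hΨ]
    module
  rw [h1, map_sub, map_smul, hecke_el, hecke_el, Finset.smul_sum, Finset.smul_sum,
    ← Finset.sum_sub_distrib]
  refine Finset.sum_congr rfl fun s _ => ?_
  rw [← map_smul, ← map_smul, ← map_sub, ← map_sub, hw, map_smul, map_smul]

lemma sum_rep_vec_eq_zero_of_isSteep (hD : D.IsSteep) {Ψ Ξ : cInd (RingHom.id (Zq p k)) r}
    {u : SymV (Zq p k) r} (hΨ : hecke _ r Ψ = el _ r u + (p : Zq p k) • Ξ)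
    {w : Option k → SymV (Zq p k) r}
    (hw : ∀ s, symRep (RingHom.id _) r (heckeAdj s) u = (p : Zq p k) • w s) :
    ∑ s : Option k, π (heckeG p s) (D.vec (w s)) = 0 := by
  have h1 := hD Ψ Ξ (∑ s : Option k, cIndRep _ r (heckeG p s) (el _ r (w s))) (by
    rw [hΨ, add_sub_cancel_right, hecke_el, Finset.smul_sum]
    refine Finset.sum_congr rfl fun s _ => ?_
    rw [hw, map_smul, map_smul])
  rw [map_sum] at h1
  simp only [D.equivariant] at h1
  exact h1

variable {c : ℕ} (hc : 0 < c) (hcr : c < r 0)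
  (hN : r 0 + p * r 1 ≡ c [MOD Fintype.card k - 1])

include hc hcr hN

/-- By `exists_hecke_deltaV` this vector is, up to translation, the reduction of `T [1, δ]`. -/
lemma vec_topV_one : D.vec (topV r 1) = 0 := by
  obtain ⟨Ξ, hΞ⟩ := exists_hecke_deltaV hc hcr hN
  have h1 := D.red_hecke (el _ r (deltaV r c))
  rw [hΞ, map_add, D.smul, map_natCast, CharP.cast_eq_zero, zero_smul, add_zero, D.equivariant,
    ← vec_apply] at h1
  have h2 := congrArg (π (heckeG p none)⁻¹) h1
  rwa [← Module.End.mul_apply, ← map_mul, inv_mul_cancel, map_one, Module.End.one_apply,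
    map_zero] at h2

lemma vec_symRep_topV_one (u : GrpK p k) :
    D.vec (symRep (RingHom.id _) r u.1 (topV r 1)) = 0 := by
  rw [← rep_incl_vec, vec_topV_one D hc hcr hN, map_zero]

/-- The element `w` exchanges `∏ X_i ^ r_i` and `∏ Y_i ^ r_i`. -/
lemma vec_wV_zero : D.vec (wV r 0 0) = 0 := by
  rw [← D.vec_symRep_topV_one hc hcr hN wK]
  refine D.vec_congr fun x y => ?_
  rw [ev_symRep, coe_wK, ev_topV_one, ev_wV (Nat.zero_le _) (Nat.zero_le _)]
  simp

lemma vec_deltaV : D.vec (deltaV r c) = - D.vec (wV r c 0) := by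
  rw [deltaV, map_sub, vec_topV_one D hc hcr hN, zero_sub]

/-- The vanishing of the Hecke eigenvalue in the spherical case. -/
lemma sum_option_rep_vec_deltaV (hr1 : 1 ≤ r 1) (hcard : Fintype.card k = p ^ 2) (hp : 2 < p)
    (hN' : Fintype.card k - 1 ∣ r 0 + p * r 1)
    (hw : π (incl p k wK) (D.vec (deltaV r c)) = D.vec (deltaV r c)) :
    ∑ s : Option k, π (heckeG p s) (D.vec (deltaV r c)) = 0 := by
  have hpq : p < p ^ 2 - 1 := by
    have : 3 * p ≤ p ^ 2 := by nlinarith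
    omega
  obtain ⟨Ξ, hΞ⟩ := exists_hecke_sum_option (p := p) hc hcr hN
  obtain ⟨Z, hZ⟩ := exists_correction (p := p) (k := k) hc hcr hr1 hN hcard hp (Or.inl ⟨rfl, hN'⟩)
    (Or.inl fun h => by
      have h2 : r 0 + p * r 1 = (r 0 - 1 + p * r 1) + 1 := by omega
      rw [h2, Nat.dvd_add_right h] at hN'
      have := Nat.le_of_dvd one_pos hN'
      omega)
    (fun h => by
      have h2 : r 0 + p * r 1 = (r 0 + p * (r 1 - 1)) + p := by
        obtain ⟨d, hd⟩ := Nat.exists_eq_add_of_le hr1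
        rw [hd, Nat.add_sub_cancel_left]
        ring
      rw [h2, Nat.dvd_add_right h] at hN'
      have := Nat.le_of_dvd (by omega) hN'
      omega)
  have h1 := D.red_eq_zero_of_correction hΞ hZ
  rw [map_add, map_sum] at h1
  simp only [D.equivariant, ← vec_apply] at h1
  rw [hw] at h1
  rw [Fintype.sum_option, add_comm, h1]

/-- The vanishing of `U_p` on the generator of the quotient. -/
lemma sum_some_rep_vec_deltaV (hr1 : 1 ≤ r 1) (hcard : Fintype.card k = p ^ 2) (hp : 2 < p)
    (hcp : c ≤ p - 1) (h0 : c = 1 → p ∣ r 0) :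
    ∑ lam : k, π (heckeG p (some lam)) (D.vec (deltaV r c)) = 0 := by
  have hpq : p < p ^ 2 - 1 := by
    have : 3 * p ≤ p ^ 2 := by nlinarith
    omega
  rw [← hcard] at hpq
  obtain ⟨Ξ, hΞ⟩ := exists_hecke_sum_some (p := p) hc hcr hN (fun _ => 1)
  -- Lowering the degree by `d ≢ c` cannot reach a multiple of `q - 1`. This is used for `d = 0`,
  -- `1` and `p`; for `c = 1` the choice `d = 1` is excluded, and `p ∣ r 0` takes its place.
  have hmod : ∀ m d : ℕ, m + d = r 0 + p * r 1 → d < c + (Fintype.card k - 1) → d ≠ c →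
      ¬ Fintype.card k - 1 ∣ m := by
    intro m d hmd hd hdc h
    have h2 : d ≡ c [MOD Fintype.card k - 1] := by
      have h3 : m + d ≡ 0 + d [MOD Fintype.card k - 1] :=
        Nat.ModEq.add_right d ((Nat.modEq_zero_iff_dvd).mpr h)
      rw [zero_add, hmd] at h3
      exact h3.symm.trans hN
    rcases le_total d c with hle | hle
    · have := Nat.le_of_dvd (by omega) ((Nat.modEq_iff_dvd' hle).mp h2)
      omega
    · have := Nat.le_of_dvd (by omega) ((Nat.modEq_iff_dvd' hle).mp h2.symm)
      omega
  obtain ⟨Z, hZ⟩ := exists_correction (p := p) (k := k) hc hcr hr1 hN hcard hp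
    (Or.inr ⟨rfl, hmod _ 0 (by omega) (by omega) (by omega)⟩)
    (by
      rcases eq_or_ne c 1 with h | h
      · exact Or.inr (h0 h)
      · exact Or.inl (hmod _ 1 (by omega) (by omega) (by omega)))
    (hmod _ p (by
      obtain ⟨d, hd⟩ := Nat.exists_eq_add_of_le hr1
      rw [hd, Nat.add_sub_cancel_left]
      ring) (by omega) (by omega))
  have h1 := D.red_eq_zero_of_correction hΞ hZ
  simpa only [map_sum, one_smul, D.equivariant, ← vec_apply] using h1

/-- The vanishing of `U_p` on the generator of the subrepresentation. -/
lemma sum_some_rep_vec_wV (hD : D.IsSteep) (hr1 : ¬ p ∣ r 1) (hcard : Fintype.card k = p ^ 2)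
    (hp : 2 < p) (hcp : c ≤ p - 1) (h0 : c = 1 → p ∣ r 0) :
    ∑ lam : k, π (heckeG p (some lam)) (D.vec (wV r 0 1)) = 0 := by
  have hpq : 2 * p < p ^ 2 := by nlinarith
  rw [← hcard] at hpq
  have hr1' : 1 ≤ r 1 := Nat.one_le_iff_ne_zero.mpr fun h => hr1 (by simp [h])
  have hr0 : 1 ≤ r 0 := by omega
  -- The weight `μ ^ (p - c)` singles out the linear Taylor term in direction `1`. Its power sum has
  -- degree `q - 1 + c - p`, complementary to `p - c`, while the other sums have total degree
  -- strictly between `0` and `q - 1`.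
  obtain ⟨Ξ, hΞ⟩ := exists_hecke_sum_some (p := p) hc hcr hN (fun mu => τ mu ^ (p - c))
  obtain ⟨w, hw⟩ := symRep_heckeAdj_none_uniV hr0 hr1' (fun mu : k => τ mu ^ (p - c)) 0
  choose w' hw' using symRep_heckeAdj_some_uniV hr0 hr1' (fun mu : k => τ mu ^ (p - c)) 0
  have hndvd : ∀ n, 0 < n → n < Fintype.card k - 1 → ¬ Fintype.card k - 1 ∣ n :=
    fun n h1 h2 h => absurd (Nat.le_of_dvd h1 h) (by omega)
  simp only [← pow_succ, ← pow_add] at hw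
  rw [sum_teichmuller_eq_zero (hndvd _ (by omega) (by omega)),
    sum_teichmuller_eq_zero (hndvd _ (by omega) (by omega)),
    sum_teichmuller_eq_zero (hndvd _ (by omega) (by omega))] at hw
  have hsum : ∀ (lam : k) (n : ℕ), p - c + n < Fintype.card k - 1 →
      ∑ mu : k, mu ^ (p - c) * (mu - lam) ^ n = 0 := by
    intro lam n hn
    simp_rw [sub_eq_add_neg, add_pow, Finset.mul_sum]
    rw [Finset.sum_comm]
    refine Finset.sum_eq_zero fun j hj => ?_
    have hj' := Finset.mem_range.mp hj
    have h1 : ∀ mu : k, mu ^ (p - c) * (mu ^ j * (-lam) ^ (n - j) * (n.choose j : k))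
        = mu ^ (p - c + j) * ((-lam) ^ (n - j) * (n.choose j : k)) := fun mu => by
      rw [pow_add]
      ring
    simp_rw [h1]
    rw [← Finset.sum_mul, sum_pow_eq_zero (hndvd _ (by omega) (by omega)), zero_mul]
  have hA : ∀ lam, ∃ a, diffSum (fun mu : k => τ mu ^ (p - c)) (r 0) (r 1) lam = p * a := by
    intro lam
    apply exists_eq_mul_of_constantCoeff
    rw [constantCoeff_diffSum]
    simp_rw [map_pow, constantCoeff_teichmuller, fun x : k =>
      pow_eq_pow_of_modEq hN (by omega) hc x]
    exact hsum _ _ (by omega)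
  choose a ha using hA
  have hmod : ∀ m n d : ℕ, m + d = r 0 + p * r 1 → n + d ≡ c [MOD Fintype.card k - 1] →
      m ≡ n [MOD Fintype.card k - 1] := by
    intro m n d hm hn
    refine Nat.ModEq.add_right_cancel' d ?_
    rw [hm]
    exact hN.trans hn.symm
  have hB0 : ∀ lam, D.coeff (r 0 * diffSum (fun mu : k => τ mu ^ (p - c)) (r 0 - 1) (r 1) lam)
      = 0 := by
    intro lam
    apply D.coeff_eq_zero
    rw [map_mul]
    rcases eq_or_ne c 1 with h | h
    · rw [map_natCast, (CharP.cast_eq_zero_iff k p _).mpr (h0 h), zero_mul]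
    · rw [constantCoeff_diffSum]
      simp_rw [map_pow, constantCoeff_teichmuller, fun x : k =>
        pow_eq_pow_of_modEq (hmod (r 0 - 1 + p * r 1) (c - 1) 1 (by omega) (by
          rw [Nat.sub_add_cancel hc])) (by omega) (by omega) x]
      rw [hsum _ _ (by omega), mul_zero]
  have hB1 : ∀ lam, D.coeff (diffSum (fun mu : k => τ mu ^ (p - c)) (r 0) (r 1 - 1) lam)
      = -1 := by
    intro lam
    have h2 : Fintype.card k - 1 + c - p + p ≡ c [MOD Fintype.card k - 1] := by
      rw [Nat.sub_add_cancel (by omega)]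
      simp [Nat.ModEq]
    have h3 : r 0 + p * (r 1 - 1) + p = r 0 + p * r 1 := by
      obtain ⟨d, hd⟩ := Nat.exists_eq_add_of_le hr1'
      rw [hd, Nat.add_sub_cancel_left]
      ring
    have h1 : WittVector.constantCoeff (diffSum (fun mu : k => τ mu ^ (p - c)) (r 0) (r 1 - 1) lam
        + 1) = 0 := by
      rw [map_add, map_one, constantCoeff_diffSum]
      simp_rw [map_pow, constantCoeff_teichmuller, fun x : k =>
        pow_eq_pow_of_modEq (hmod (r 0 + p * (r 1 - 1)) (Fintype.card k - 1 + c - p) p h3 h2)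
        (by omega) (by omega) x]
      set n := Fintype.card k - 1 + c - p with hn
      simp_rw [sub_eq_add_neg, add_pow, Finset.mul_sum]
      -- Only the top power of `μ`, of exponent `p - c + n = q - 1`, has a nonzero sum, so the
      -- result is independent of `λ`.
      rw [Finset.sum_comm, Finset.sum_eq_single n]
      · simp only [Nat.sub_self, pow_zero, mul_one, Nat.choose_self, Nat.cast_one, ← pow_add]
        rw [sum_pow_eq_neg_one (by omega) ⟨1, by omega⟩, neg_add_cancel]
      · intro j hj hjn
        have hj' := Finset.mem_range.mp hj
        have h1 : ∀ mu : k, mu ^ (p - c) * (mu ^ j * (-lam) ^ (n - j) * (n.choose j : k))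
            = mu ^ (p - c + j) * ((-lam) ^ (n - j) * (n.choose j : k)) := fun mu => by
          rw [pow_add]
          ring
        simp_rw [h1]
        rw [← Finset.sum_mul, sum_pow_eq_zero (hndvd _ (by omega) (by omega)), zero_mul]
      · intro h
        exact absurd (Finset.mem_range.mpr (Nat.lt_succ_self n)) h
    have h4 := D.coeff_eq_zero h1
    rw [map_add, map_one] at h4
    exact eq_neg_of_add_eq_zero_left h4
  -- `W` is the quotient by `p` of the image of `u`. In `V` all that remains of it is `-r_1` times
  -- the vector under consideration, for every `λ`, and `-r_1` is invertible.
  let W : Option k → SymV (Zq p k) r := fun s => s.elim ((p : Zq p k) • w) fun lam =>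
    a lam • wV r 0 0
      + ((r 0 * diffSum (fun mu : k => τ mu ^ (p - c)) (r 0 - 1) (r 1) lam) • wV r 1 0
          + (r 1 * diffSum (fun mu : k => τ mu ^ (p - c)) (r 0) (r 1 - 1) lam) • wV r 0 1)
      + (p : Zq p k) • w' lam
  have hW := D.sum_rep_vec_eq_zero_of_isSteep hD hΞ (w := W) (by
    intro s
    cases s with
    | none =>
      rw [hw]
      simp only [W, Option.elim]
      module
    | some lam =>
      rw [hw', ha]
      simp only [W, Option.elim]
      module)
  rw [Fintype.sum_option] at hW
  have hp0 : D.coeff (p : Zq p k) = 0 := by rw [map_natCast, CharP.cast_eq_zero]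
  have hW0 : D.vec (W none) = 0 := by
    change D.vec ((p : Zq p k) • w) = 0
    rw [vec_smul, hp0, zero_smul]
  have hW1 : ∀ lam, D.vec (W (some lam)) = (-(r 1 : F)) • D.vec (wV r 0 1) := by
    intro lam
    simp only [W, Option.elim, map_add, vec_smul, hB0, hp0, zero_smul, add_zero, zero_add,
      D.vec_wV_zero hc hcr hN, smul_zero, map_mul, hB1, map_natCast, mul_neg, mul_one]
  rw [hW0, map_zero, zero_add] at hW
  simp_rw [hW1, map_smul] at hW
  rw [← Finset.smul_sum, smul_eq_zero, neg_eq_zero, CharP.cast_eq_zero_iff F p] at hW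
  exact hW.resolve_left hr1

end Reduction

end GL2Red
end

noncomputable section

namespace GL2Red

/-! ### Unipotent translates and the two pieces of the filtration -/

section EvalMonomials

variable {p : ℕ} [Fact p.Prime] {k : Type} [Field k] [CharP k p] [Fintype k] {r : Fin 2 → ℕ}

lemma ev_wV_left {a : ℕ} (ha : a ≤ r 0) (x y : k) :
    ev (wV r a 0 : SymV (Zq p k) r) x y = x ^ (r 0 - a + p * r 1) * y ^ a := by
  rw [ev_wV ha (Nat.zero_le _), mul_zero, add_zero, Nat.sub_zero]

lemma ev_wV_zero_one (h : 1 ≤ r 1) (x y : k) :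
    ev (wV r 0 1 : SymV (Zq p k) r) x y = x ^ (r 0 + p * (r 1 - 1)) * y ^ p := by
  rw [ev_wV (Nat.zero_le _) h, mul_one, zero_add, Nat.sub_zero]

end EvalMonomials

namespace Reduction

variable {p : ℕ} [Fact p.Prime] {k : Type} [Field k] [CharP k p] [Fintype k] {r : Fin 2 → ℕ}
  {F V : Type} [Field F] [CharP F p] [AddCommGroup V] [Module F V]
  {π : Representation F (GrpG p k) V} (D : Reduction r π)

local notation "τ" => WittVector.teichmuller (R := k) p

lemma rep_upK_vec (b : Zq p k) {v w : SymV (Zq p k) r}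
    (h : ∀ x y, ev v x (WittVector.constantCoeff b * x + y) = ev w x y) :
    π (incl p k (upK b)) (D.vec v) = D.vec w := by
  rw [rep_incl_vec]
  refine D.vec_congr fun x y => ?_
  rw [ev_symRep, ← h, coe_upK]
  simp

/-- Extraction of the coefficients of a family of vectors that is polynomial in a parameter. -/
lemma vec_mem_of_forall {M : Submodule F V} {h : k → SymV (Zq p k) r} {m : ℕ → SymV (Zq p k) r}
    {n : ℕ} (hn : n < Fintype.card k - 1)
    (hev : ∀ lam x y, ev (h lam) x y = ∑ i ∈ Finset.range (n + 1), lam ^ i * ev (m i) x y)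
    (hM : ∀ lam, D.vec (h lam) ∈ M) {i : ℕ} (hi : 0 < i) (hin : i ≤ n) : D.vec (m i) ∈ M := by
  -- Discrete Fourier inversion: the sum over `λ` of `λ ^ (q - 1 - i + j)` is `-1` for `j = i` and
  -- zero otherwise, because the bounds `0 < i` and `i, j ≤ n < q - 1` keep the exponent strictly
  -- between `0` and `2 (q - 1)`.
  have h1 : D.vec (m i) = - D.vec (∑ lam : k, τ (lam ^ (Fintype.card k - 1 - i)) • h lam) := by
    rw [← map_neg]
    refine D.vec_congr fun x y => ?_
    rw [← sub_zero (-_), ← zero_sub, sub_zero, ev_sub, ev_zero, ev_sum]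
    simp_rw [ev_smul, constantCoeff_teichmuller, hev, Finset.mul_sum]
    rw [Finset.sum_comm, Finset.sum_eq_single i]
    · simp_rw [← mul_assoc, ← pow_add]
      rw [← Finset.sum_mul, sum_pow_eq_neg_one (by omega) ⟨1, by omega⟩]
      ring
    · intro j hj hji
      have hj' := Finset.mem_range.mp hj
      simp_rw [← mul_assoc, ← pow_add]
      rw [← Finset.sum_mul, sum_pow_eq_zero, zero_mul]
      rintro ⟨d, hd⟩
      rcases d with - | - | d
      · omega
      · omega
      · have : (Fintype.card k - 1) * (d + 1 + 1)
          = (Fintype.card k - 1) * d + (Fintype.card k - 1) + (Fintype.card k - 1) := by ring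
        omega
    · intro h
      exact absurd (Finset.mem_range.mpr (by omega)) h
  rw [h1, map_sum]
  refine M.neg_mem (M.sum_mem fun lam _ => ?_)
  rw [vec_smul]
  exact M.smul_mem _ (hM lam)

lemma vec_mem_of_choose {M : Submodule F V} {n i : ℕ} {v : SymV (Zq p k) r}
    (h : D.vec ((n.choose i : Zq p k) • v) ∈ M) (hn : ¬ p ∣ n.choose i) : D.vec v ∈ M := by
  rw [vec_smul, map_natCast] at h
  exact (M.smul_mem_iff fun h0 => hn ((CharP.cast_eq_zero_iff F p _).mp h0)).mp h

section Cases

variable {c : ℕ} (hc : 0 < c) (hcr : c < r 0)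
  (hN : r 0 + p * r 1 ≡ c [MOD Fintype.card k - 1])

include hc hcr hN

lemma rep_upK_vec_deltaV (b : Zq p k) :
    π (incl p k (upK b)) (D.vec (deltaV r c)) = D.vec (deltaV r c) := by
  refine D.rep_upK_vec b fun x y => ?_
  rw [ev_deltaV hc hcr hN, ev_deltaV hc hcr hN]
  rcases eq_or_ne x 0 with rfl | hx
  · simp
  · rw [FiniteField.pow_card_sub_one_eq_one x hx]
    simp

/-- All the elementary functions are combinations of translates of a single one. -/
lemma eq_top_of_vec_deltaV_mem (W : Subrepresentation π) (h : D.vec (deltaV r c) ∈ W.toSubmodule) :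
    W.toSubmodule = ⊤ := by
  classical
  refine D.eq_top_of_vec_mem W fun v => ?_
  -- The translate of `δ` by `κ mu` is `x ^ c` on the line `y = μ x` and zero elsewhere, while `δ`
  -- covers the line `x = 0`. A homogeneous function is thus recovered from its values at `(1, μ)`
  -- and `(0, 1)`.
  let κ : k → GrpK p k := fun mu =>
    Matrix.GeneralLinearGroup.mk'' !![-τ mu, 1; 1, 0] (by simp)
  have hκ : ∀ mu, (κ mu).1 = !![-τ mu, 1; 1, 0] := fun mu => rfl
  have h1 : D.vec v = D.vec (∑ mu : k, τ (ev v 1 mu) • symRep (RingHom.id _) r (κ mu).1 (deltaV r c)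
      + τ (ev v 0 1) • deltaV r c) := by
    refine D.vec_congr fun x y => ?_
    have hq : Fintype.card k - 1 ≠ 0 := by have := Fintype.one_lt_card (α := k); omega
    have hN' : ∀ a : k, a ^ (∑ i : Fin 2, p ^ i.val * r i) = a ^ c := by
      intro a
      rw [← pow_eq_pow_of_modEq hN (by omega) hc a]
      simp [Fin.sum_univ_two]
    rw [ev_add, ev_sum]
    simp_rw [ev_smul, constantCoeff_teichmuller, ev_symRep, ev_deltaV hc hcr hN, hκ]
    have hτ : ∀ mu : k, WittVector.constantCoeff (-τ mu) = -mu := fun mu => by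
      rw [map_neg, constantCoeff_teichmuller]
    simp only [Matrix.of_apply, Matrix.cons_val_zero, Matrix.cons_val_one, hτ, map_one, map_zero,
      one_mul, zero_mul, add_zero]
    rcases eq_or_ne x 0 with rfl | hx
    · rw [zero_pow hq, zero_pow hc.ne']
      simp only [mul_zero, Finset.sum_const_zero, zero_add, sub_zero, one_mul]
      have h2 := ev_homogeneous v y 0 1
      rw [mul_zero, mul_one, hN'] at h2
      rw [h2, mul_comm]
    · rw [FiniteField.pow_card_sub_one_eq_one x hx, sub_self, zero_mul, mul_zero, add_zero,
        Finset.sum_eq_single (y / x)]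
      · have h2 := ev_homogeneous v x 1 (y / x)
        rw [mul_one, mul_div_cancel₀ _ hx, hN'] at h2
        rw [h2, neg_mul, div_mul_cancel₀ _ hx, neg_add_cancel, zero_pow hq]
        ring
      · intro mu _ hmu
        rw [FiniteField.pow_card_sub_one_eq_one]
        · ring
        · intro h0
          refine hmu ?_
          rw [eq_div_iff hx]
          linear_combination -h0
      · intro h
        exact absurd (Finset.mem_univ _) h
  rw [h1, map_add, map_sum, vec_smul]
  refine add_mem (sum_mem fun mu _ => ?_) (Submodule.smul_mem _ _ h)
  rw [vec_smul, ← rep_incl_vec]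
  exact Submodule.smul_mem _ _ (W.apply_mem_toSubmodule _ h)

end Cases

lemma natCast_card_eq_zero (hcard : Fintype.card k = p ^ 2) : (Fintype.card k : F) = 0 := by
  rw [hcard, Nat.cast_pow, CharP.cast_eq_zero, zero_pow two_ne_zero]

include D in
/-- The spherical case. -/
theorem irredQuotientsSupercuspidal_of_dvd (hr : ∀ i, p ^ 2 + p - 2 < r i)
    (hcard : Fintype.card k = p ^ 2) (hp : 2 < p) (hN : Fintype.card k - 1 ∣ r 0 + p * r 1)
    (U : Subrepresentation π) : IrredQuotientsSupercuspidal (quotRep π U) := by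
  have hpq : p < p ^ 2 - 1 := by
    have : 3 * p ≤ p ^ 2 := by nlinarith
    omega
  have hr0 := hr 0
  have hr1 := hr 1
  -- The class `0` is represented by `q - 1`, since `deltaV` requires a positive exponent.
  obtain ⟨c, hc⟩ : ∃ c, c = Fintype.card k - 1 := ⟨_, rfl⟩
  have hc0 : 0 < c := by omega
  have hcr : c < r 0 := by omega
  have hN' : r 0 + p * r 1 ≡ c [MOD Fintype.card k - 1] := by
    rw [hc]
    exact ((Nat.modEq_zero_iff_dvd).mpr hN).trans (by simp [Nat.ModEq])
  -- In `V`, `δ` equals minus the vector of `x ^ (q - 1) y ^ (q - 1)`, which is symmetric.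
  have hw : π (incl p k wK) (D.vec (deltaV r c)) = D.vec (deltaV r c) := by
    rw [D.vec_deltaV hc0 hcr hN', map_neg, rep_incl_vec, neg_inj]
    refine D.vec_congr fun x y => ?_
    have h1 := ev_wV_eq (k := k) hc0 hcr hN' c hcr c hc0
      (by rw [← hc]; simp [Nat.ModEq])
    rw [ev_symRep, coe_wK, h1, h1]
    simp [mul_comm]
  have hlo : ∀ b : Zq p k, π (incl p k (loK b)) (D.vec (deltaV r c)) = D.vec (deltaV r c) := by
    intro b
    have h1 : (loK b : GrpK p k) = wK * upK b * wK := by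
      apply Units.ext
      rw [Units.val_mul, Units.val_mul, coe_loK, coe_upK, coe_wK]
      simp
    rw [h1, map_mul, map_mul, map_mul, map_mul, Module.End.mul_apply, Module.End.mul_apply, hw,
      D.rep_upK_vec_deltaV hc0 hcr hN', hw]
  have hmk : ∀ g v, quotRep π U g (U.toSubmodule.mkQ v) = U.toSubmodule.mkQ (π g v) :=
    fun g v => rfl
  refine irredQuotientsSupercuspidal_of_spherical (D.isSmooth.quot U)
    (v := U.toSubmodule.mkQ (D.vec (deltaV r c)))
    (quot_generated (D.eq_top_of_vec_deltaV_mem hc0 hcr hN')) (fun b => ?_) (fun b => ?_) ?_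
    (natCast_card_eq_zero hcard)
  · rw [hmk, D.rep_upK_vec_deltaV hc0 hcr hN']
  · rw [hmk, hlo]
  · simp_rw [hmk]
    rw [← map_sum, D.sum_option_rep_vec_deltaV hc0 hcr hN' (by omega) hcard hp hN hw, map_zero]

section Steep

variable {c : ℕ} (hc : 0 < c) (hcp : c ≤ p - 1)
  (hN : r 0 + p * r 1 ≡ c [MOD Fintype.card k - 1]) (hr : ∀ i, p ^ 2 + p - 2 < r i)
  (hcard : Fintype.card k = p ^ 2) (hp : 2 < p)

lemma not_dvd_choose_of_lt {n i : ℕ} (hn : n < p) (hi : i ≤ n) : ¬ p ∣ n.choose i := by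
  have hpp : p.Prime := Fact.out
  intro h
  have h1 : p ∣ n.factorial := by
    rw [← Nat.choose_mul_factorial_mul_factorial hi, mul_assoc]
    exact h.mul_right _
  exact absurd ((hpp.dvd_factorial).mp h1) (by omega)

lemma not_dvd_choose_lucas {a b i j : ℕ} (ha : a < p) (hi : i ≤ a) (hb : b < p) (hj : j ≤ b) :
    ¬ p ∣ (a + p * b).choose (i + p * j) := by
  have hpp : p.Prime := Fact.out
  intro h
  have h1 := Choose.choose_modEq_choose_mod_mul_choose_div_nat (p := p) (n := a + p * b)
    (k := i + p * j)
  rw [Nat.add_mul_mod_self_left, Nat.add_mul_mod_self_left, Nat.mod_eq_of_lt ha,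
    Nat.mod_eq_of_lt (by omega), Nat.add_mul_div_left _ _ hpp.pos, Nat.add_mul_div_left _ _ hpp.pos,
    Nat.div_eq_of_lt ha, Nat.div_eq_of_lt (by omega), zero_add, zero_add] at h1
  have h2 := (h1.symm.trans ((Nat.modEq_zero_iff_dvd).mpr h))
  rcases (hpp.dvd_mul).mp ((Nat.modEq_zero_iff_dvd).mp h2) with h3 | h3
  · exact not_dvd_choose_of_lt ha hi h3
  · exact not_dvd_choose_of_lt hb hj h3

include hc hcp hN hr hcard hp

/-- The upper unipotent translates of `∏ Y_i ^ r_i` have functions `(λ x + y) ^ c` and die in `V`;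
hence so do their coefficients in `λ`, and the binomials are units because `c < p`. -/
lemma vec_wV_eq_zero_of_lt {t : ℕ} (ht : t < c) : D.vec (wV r t 0) = 0 := by
  have hr0 := hr 0
  have hpq : 3 * p ≤ p ^ 2 := by nlinarith
  have hcr : c < r 0 := by omega
  rw [← Submodule.mem_bot F]
  -- For `i = 0` the function `y ^ c` must also be correct on `x = 0`; there `wV r c 0` vanishes, so
  -- `topV r 1` is used.
  let m : ℕ → SymV (Zq p k) r := fun i =>
    (c.choose i : Zq p k) • (if i = 0 then topV r 1 else wV r (c - i) 0)
  have h1 : D.vec (m (c - t)) ∈ (⊥ : Submodule F V) := by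
    refine D.vec_mem_of_forall (n := c) (by omega)
      (h := fun lam => symRep (RingHom.id _) r (upK (τ lam)).1 (topV r 1)) (fun lam x y => ?_)
      (fun lam => (Submodule.mem_bot F).mpr (D.vec_symRep_topV_one hc hcr hN _)) (by omega)
      (by omega)
    have h2 : ∀ i ∈ Finset.range (c + 1), lam ^ i * ev (m i) x y
        = (lam * x) ^ i * y ^ (c - i) * (c.choose i : k) := by
      intro i hi
      have hi' := Finset.mem_range.mp hi
      simp only [m]
      rw [ev_smul, map_natCast]
      split_ifs with h0
      · rw [ev_topV_one, pow_eq_pow_of_modEq hN (by omega) hc, h0]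
        simp
      · rw [ev_wV_eq hc hcr hN (c - i) (by omega) i (by omega) (by
          rw [Nat.sub_add_cancel (by omega)])]
        ring
    rw [Finset.sum_congr rfl h2, ← add_pow, ev_symRep, ev_topV_one, coe_upK,
      pow_eq_pow_of_modEq hN (by omega) hc]
    simp
  have h3 := D.vec_mem_of_choose h1 (not_dvd_choose_of_lt (by omega) (by omega))
  rwa [if_neg (by omega), Nat.sub_sub_self ht.le] at h3

/-- The generator has the function `x ^ n y ^ p` with `n = q - 1 + c - p`, and its lower unipotent
translates are `(x + λ y) ^ n y ^ p`. The base `p` digits of `n` are `c - 1` and `p - 1`, so by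
Lucas the binomials `n.choose i` with `i < c` or `i = p` are units. The lower bound on `r 0` gives
`i + p < r 0` for all `i < n`. -/
lemma vec_wV_mem_genSub {i : ℕ} (hi0 : 0 < i) (hi : i < c ∨ i = p) :
    D.vec (wV r (i + p) 0) ∈ (genSub π (D.vec (wV r 0 1))).toSubmodule := by
  have hr0 := hr 0
  have hr1 := hr 1
  have hpq : 3 * p ≤ p ^ 2 := by nlinarith
  have hcr : c < r 0 := by omega
  obtain ⟨P, hP⟩ : ∃ P, P = p - 1 := ⟨_, rfl⟩
  have hsq : p ^ 2 = p * P + p := by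
    obtain rfl : p = P + 1 := by omega
    ring
  obtain ⟨n, hn⟩ : ∃ n, n = c - 1 + p * P := ⟨_, rfl⟩
  have hN1 : r 0 + p * (r 1 - 1) + p = r 0 + p * r 1 := by
    obtain ⟨d, hd⟩ := Nat.exists_eq_add_of_le (show 1 ≤ r 1 by omega)
    rw [hd, Nat.add_sub_cancel_left]
    ring
  have hnp : n + p ≡ c [MOD Fintype.card k - 1] := by
    have : n + p = Fintype.card k - 1 + c := by omega
    rw [this]
    simp [Nat.ModEq]
  have hPp : p ≤ p * P := Nat.le_mul_of_pos_right p (by omega)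
  have hPp2 : p * 2 ≤ p * P := Nat.mul_le_mul_left p (by omega)
  have hin : i < n := by omega
  let m : ℕ → SymV (Zq p k) r := fun i =>
    (n.choose i : Zq p k) • (if i = n then topV r 1 else wV r (i + p) 0)
  have h1 : D.vec (m i) ∈ (genSub π (D.vec (wV r 0 1))).toSubmodule := by
    refine D.vec_mem_of_forall (n := n) (by omega)
      (h := fun lam => symRep (RingHom.id _) r (loK (τ lam)).1 (wV r 0 1)) (fun lam x y => ?_)
      (fun lam => ?_) hi0 hin.le
    · have h2 : ∀ i ∈ Finset.range (n + 1), lam ^ i * ev (m i) x y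
          = (lam * y) ^ i * x ^ (n - i) * (n.choose i : k) * y ^ p := by
        intro i hi
        have hi' := Finset.mem_range.mp hi
        simp only [m]
        rw [ev_smul, map_natCast]
        split_ifs with h0
        · rw [ev_topV_one, pow_eq_pow_of_modEq (hN.trans hnp.symm) (by omega) (by omega), h0,
            Nat.sub_self]
          ring
        · rw [ev_wV_eq hc hcr hN (i + p) (by omega) (n - i) (by omega) (by
            have : i + p + (n - i) = n + p := by omega
            rw [this]
            exact hnp)]
          ring
      rw [Finset.sum_congr rfl h2, ← Finset.sum_mul, ← add_pow, ev_symRep,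
        ev_wV_zero_one (by omega), coe_loK, pow_eq_pow_of_modEq
          (Nat.ModEq.add_right_cancel' p (hN1 ▸ hN.trans hnp.symm)) (by omega) (by omega)]
      simp [add_comm]
    · rw [← rep_incl_vec]
      exact (genSub π _).apply_mem_toSubmodule _ (mem_genSub _)
  have h3 := D.vec_mem_of_choose h1 (by
    rcases hi with hi | rfl
    · have := not_dvd_choose_lucas (p := p) (a := c - 1) (b := P) (i := i) (j := 0) (by omega)
        (by omega) (by omega) (by omega)
      rwa [mul_zero, add_zero, ← hn] at this
    · have := not_dvd_choose_lucas (p := i) (a := c - 1) (b := P) (i := 0) (j := 1) (by omega)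
        (by omega) (by omega) (by omega)
      rwa [mul_one, zero_add, ← hn] at this)
  rwa [if_neg (by omega)] at h3

/-- Invariance under `N(ℤ_q)` holds because `(b x + y) ^ p = b ^ p x ^ p + y ^ p` adds only a
multiple of `∏ X_i ^ r_i`, which dies in `V`. The generator is `n x - x` for `x` one half of the
vector of `wV r (2 p) 0`, since `(x + y) ^ (2 p) = x ^ (2 p) + 2 x ^ p y ^ p + y ^ (2 p)`; dividing
by `2` requires `p > 2`. -/
lemma irredQuotientsSupercuspidal_genSub (hD : D.IsSteep) (hr1 : ¬ p ∣ r 1)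
    (h0 : c = 1 → p ∣ r 0) : IrredQuotientsSupercuspidal
      (V := (genSub π (D.vec (wV r 0 1))).toSubmodule)
      (genSub π (D.vec (wV r 0 1))).toRepresentation := by
  have hrr0 := hr 0
  have hrr1 := hr 1
  have hpq : 3 * p ≤ p ^ 2 := by nlinarith
  have hcr : c < r 0 := by omega
  have h2F : (2 : F) ≠ 0 := by
    intro h
    have h1 : ((2 : ℕ) : F) = 0 := by exact_mod_cast h
    have := Nat.le_of_dvd two_pos ((CharP.cast_eq_zero_iff F p 2).mp h1)
    omega
  have hN1 : r 0 + p * (r 1 - 1) + p = r 0 + p * r 1 := by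
    obtain ⟨d, hd⟩ := Nat.exists_eq_add_of_le (show 1 ≤ r 1 by omega)
    rw [hd, Nat.add_sub_cancel_left]
    ring
  have hup : ∀ b : Zq p k, π (incl p k (upK b)) (D.vec (wV r 0 1)) = D.vec (wV r 0 1) := by
    intro b
    have h1 : π (incl p k (upK b)) (D.vec (wV r 0 1)) = D.vec (b ^ p • wV r 0 0 + wV r 0 1) := by
      refine D.rep_upK_vec b fun x y => ?_
      rw [ev_add, ev_smul, ev_wV_zero_one (by omega), ev_wV_zero_one (by omega), ev_wV_left
        (Nat.zero_le _), Nat.sub_zero, ← hN1, pow_add _ _ p, map_pow, pow_zero, add_pow_char]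
      ring
    rw [h1, map_add, vec_smul, D.vec_wV_zero hc hcr hN, smul_zero, zero_add]
  have hx : π (incl p k (upK 1)) (D.vec (wV r (p + p) 0))
      = (2 : F) • D.vec (wV r 0 1) + D.vec (wV r (p + p) 0) := by
    have h1 : π (incl p k (upK 1)) (D.vec (wV r (p + p) 0))
        = D.vec (wV r 0 0 + (2 : Zq p k) • wV r 0 1 + wV r (p + p) 0) := by
      refine D.rep_upK_vec 1 fun x y => ?_
      have e1 : r 0 + p * r 1 = r 0 - (p + p) + p * r 1 + p + p := by omega
      have e2 : r 0 + p * (r 1 - 1) = r 0 - (p + p) + p * r 1 + p := by omega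
      rw [ev_add, ev_add, ev_smul, ev_wV_zero_one (by omega), ev_wV_left (Nat.zero_le _),
        ev_wV_left (by omega), ev_wV_left (by omega), Nat.sub_zero, map_one, one_mul, pow_zero, e1,
        e2, pow_add _ p p, add_pow_char, map_ofNat]
      ring
    rw [h1, map_add, map_add, vec_smul, D.vec_wV_zero hc hcr hN, zero_add, map_ofNat]
  have hmem := D.vec_wV_mem_genSub hc hcp hN hr hcard hp (i := p) (by omega) (Or.inr rfl)
  refine irredQuotientsSupercuspidal_of_Up (D.isSmooth.sub _)
    (v := ⟨D.vec (wV r 0 1), mem_genSub _⟩)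
    (x := ⟨(2 : F)⁻¹ • D.vec (wV r (p + p) 0), Submodule.smul_mem _ _ hmem⟩)
    (genSub_generated _) (fun b => Subtype.ext (hup b)) (fun b => Subtype.ext ?_) 1
    (Subtype.ext ?_) (Subtype.ext ?_)
  · exact D.rep_vec_of_congrOne _ (congrOne_loK (by rw [pow_one]; exact dvd_mul_right _ _))
  · change π (incl p k (upK 1)) ((2 : F)⁻¹ • D.vec (wV r (p + p) 0))
      - (2 : F)⁻¹ • D.vec (wV r (p + p) 0) = D.vec (wV r 0 1)
    rw [map_smul, hx, smul_add, add_sub_cancel_right, inv_smul_smul₀ h2F]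
  · have h1 := D.sum_some_rep_vec_wV hc hcr hN hD hr1 hcard hp hcp h0
    exact (map_sum (genSub π (D.vec (wV r 0 1))).toSubmodule.subtype _ _).trans h1

/-- The generator of the quotient is `n x - x` for `x` the vector of `wV r (c + p) 0`: in the
binomial expansion of degree `c + p` only the terms `i = c` and `i = c + p` survive modulo the
subrepresentation, both with coefficient `1`. -/
lemma irredQuotientsSupercuspidal_quotRep_genSub (h0 : c = 1 → p ∣ r 0) :
    IrredQuotientsSupercuspidal (quotRep π (genSub π (D.vec (wV r 0 1)))) := by
  have hpp : p.Prime := Fact.out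
  have hrr0 := hr 0
  have hrr1 := hr 1
  have hpq : 3 * p ≤ p ^ 2 := by nlinarith
  have hcr : c < r 0 := by omega
  have hd : D.vec (wV r c 0) = - D.vec (deltaV r c) := by
    rw [D.vec_deltaV hc hcr hN, neg_neg]
  have hN1 : r 0 + p * (r 1 - 1) + p = r 0 + p * r 1 := by
    obtain ⟨d, hd⟩ := Nat.exists_eq_add_of_le (show 1 ≤ r 1 by omega)
    rw [hd, Nat.add_sub_cancel_left]
    ring
  set U := genSub π (D.vec (wV r 0 1)) with hU
  have hmk : ∀ g v, quotRep π U g (U.toSubmodule.mkQ v) = U.toSubmodule.mkQ (π g v) :=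
    fun g v => rfl
  have hx : π (incl p k (upK 1)) (D.vec (wV r (c + p) 0)) = D.vec (∑ i ∈ Finset.range (c + p + 1),
      ((c + p).choose i : Zq p k) • wV r i 0) := by
    refine D.rep_upK_vec 1 fun x y => ?_
    rw [ev_sum, ev_wV_left (by omega), map_one, one_mul, add_comm x y, add_pow, Finset.mul_sum]
    refine Finset.sum_congr rfl fun i hi => ?_
    have hi' := Finset.mem_range.mp hi
    have e : r 0 - i + p * r 1 = r 0 - (c + p) + p * r 1 + (c + p - i) := by omega
    rw [ev_smul, ev_wV_left (by omega), map_natCast, e, pow_add x _ (c + p - i)]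
    ring
  -- For `i < c` the vector is zero; for `c < i < p` the binomial is divisible by `p` by Lucas; for
  -- `i = p` the vector is the generator of the subrepresentation; for `p < i < c + p` it lies there
  -- by `vec_wV_mem_genSub`.
  have hrest : ∀ i ∈ (Finset.range (c + p)).erase c,
      D.vec (((c + p).choose i : Zq p k) • wV r i 0) ∈ U.toSubmodule := by
    intro i hi
    have hic := Finset.ne_of_mem_erase hi
    have hi' := Finset.mem_range.mp (Finset.mem_of_mem_erase hi)
    rw [vec_smul]
    rcases lt_or_ge i c with h1 | h1
    · rw [D.vec_wV_eq_zero_of_lt hc hcp hN hr hcard hp h1, smul_zero]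
      exact zero_mem _
    · rcases lt_or_ge i p with h2 | h2
      · have h3 := Choose.choose_modEq_choose_mod_mul_choose_div_nat (p := p) (n := c + p) (k := i)
        rw [Nat.add_mod_right, Nat.mod_eq_of_lt (show c < p by omega), Nat.mod_eq_of_lt h2,
          Nat.choose_eq_zero_of_lt (show c < i by omega), zero_mul] at h3
        rw [map_natCast, (CharP.cast_eq_zero_iff F p _).mpr ((Nat.modEq_zero_iff_dvd).mp h3),
          zero_smul]
        exact zero_mem _
      · refine Submodule.smul_mem _ _ ?_
        rcases eq_or_lt_of_le h2 with rfl | h3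
        · have h4 : D.vec (wV r p 0) = D.vec (wV r 0 1) := by
            refine D.vec_congr fun x y => ?_
            rw [ev_wV_left (by omega), ev_wV_zero_one (by omega)]
            have e : r 0 - p + p * r 1 = r 0 + p * (r 1 - 1) := by omega
            rw [e]
          rw [h4]
          exact mem_genSub _
        · have h4 := D.vec_wV_mem_genSub hc hcp hN hr hcard hp (i := i - p) (by omega)
            (Or.inl (by omega))
          rwa [Nat.sub_add_cancel h2] at h4
  have hchoose : (((c + p).choose c : ℕ) : F) = 1 := by
    have h3 := Choose.choose_modEq_choose_mod_mul_choose_div_nat (p := p) (n := c + p) (k := c)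
    rw [Nat.add_mod_right, Nat.mod_eq_of_lt (show c < p by omega), Nat.choose_self,
      Nat.div_eq_of_lt (show c < p by omega), Nat.choose_zero_right, mul_one] at h3
    have h4 := (CharP.natCast_eq_natCast' F p h3)
    rw [h4, Nat.cast_one]
  have hrest' : ∑ i ∈ (Finset.range (c + p)).erase c,
      U.toSubmodule.mkQ (D.vec (((c + p).choose i : Zq p k) • wV r i 0)) = 0 :=
    Finset.sum_eq_zero fun i hi => (Submodule.Quotient.mk_eq_zero _).mpr (hrest i hi)
  have hx' : U.toSubmodule.mkQ (π (incl p k (upK 1)) (D.vec (wV r (c + p) 0)))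
      = U.toSubmodule.mkQ (D.vec (wV r c 0)) + U.toSubmodule.mkQ (D.vec (wV r (c + p) 0)) := by
    rw [hx, Finset.sum_range_succ, ← Finset.add_sum_erase _ _ (Finset.mem_range.mpr
      (show c < c + p by omega)), map_add, map_add, map_add, map_add, map_sum, map_sum,
      hrest', add_zero, Nat.choose_self, Nat.cast_one, one_smul, vec_smul, map_natCast, hchoose, one_smul]
  refine irredQuotientsSupercuspidal_of_Up (D.isSmooth.quot U)
    (v := U.toSubmodule.mkQ (D.vec (wV r c 0))) (x := U.toSubmodule.mkQ (D.vec (wV r (c + p) 0)))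
    (quot_generated fun W hW => ?_) (fun b => ?_) (fun b => ?_) 1 ?_ ?_
  · refine D.eq_top_of_vec_deltaV_mem hc hcr hN W ?_
    rw [hd] at hW
    exact W.toSubmodule.neg_mem_iff.mp hW
  · rw [hmk, hd, map_neg, D.rep_upK_vec_deltaV hc hcr hN]
  · rw [hmk, D.rep_vec_of_congrOne _ (congrOne_loK (by rw [pow_one]; exact dvd_mul_right _ _))]
  · rw [hmk, hx', add_sub_cancel_right]
  · simp_rw [hmk, hd, map_neg]
    rw [Finset.sum_neg_distrib, ← map_sum,
      D.sum_some_rep_vec_deltaV hc hcr hN (by omega) hcard hp hcp h0, map_zero, neg_zero]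

end Steep

end Reduction

end GL2Red
end

noncomputable section

namespace GL2Red

/-! ### Exchange of the two tensor factors -/

section Swap

variable {p : ℕ} [Fact p.Prime] {k : Type} [Field k] [CharP k p] {r r' : Fin 2 → ℕ}

/-- The exchange of the two sets of variables. -/
def swapVar : Fin 2 × Fin 2 → Fin 2 × Fin 2 := fun v => (Equiv.swap 0 1 v.1, v.2)

/-- The ring homomorphism that exchanges the two sets of variables and applies the Frobenius to the
coefficients. -/
def swapHom : MvPolynomial (Fin 2 × Fin 2) (Zq p k) →+* MvPolynomial (Fin 2 × Fin 2) (Zq p k) :=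
  (MvPolynomial.rename (R := Zq p k) swapVar).toRingHom.comp (MvPolynomial.map WittVector.frobenius)

lemma swapHom_C (c : Zq p k) :
    swapHom (MvPolynomial.C c) = MvPolynomial.C (WittVector.frobenius c) := by
  simp [swapHom]

lemma swapHom_X (v : Fin 2 × Fin 2) :
    swapHom (MvPolynomial.X v : MvPolynomial (Fin 2 × Fin 2) (Zq p k))
      = MvPolynomial.X (swapVar v) := by
  simp [swapHom]

lemma swapVar_injective : Function.Injective swapVar := by
  rintro ⟨a, b⟩ ⟨a', b'⟩ h
  simpa [swapVar] using h

lemma swapHom_mem (hr : ∀ i, r' i = r (Equiv.swap 0 1 i))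
    {P : MvPolynomial (Fin 2 × Fin 2) (Zq p k)} (hP : P ∈ symSubmodule (Zq p k) r) :
    swapHom P ∈ symSubmodule (Zq p k) r' := by
  intro d hd
  obtain ⟨u, rfl, hu⟩ := MvPolynomial.coeff_rename_ne_zero _ _ _ hd
  have h1 : Finsupp.weight (multiDeg 2) u = r := hP fun h0 => hu (by
    rw [MvPolynomial.coeff_map, h0, map_zero])
  have h2 : ∀ i l, u.mapDomain swapVar (i, l) = u (Equiv.swap 0 1 i, l) := by
    intro i l
    have h3 := Finsupp.mapDomain_apply swapVar_injective u (Equiv.swap 0 1 i, l)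
    rwa [swapVar, Equiv.swap_apply_self] at h3
  funext i
  rw [weight_multiDeg, h2, h2, hr, ← h1, weight_multiDeg]

/-- The exchange of the two tensor factors, twisted by the Frobenius. -/
def symSwap (hr : ∀ i, r' i = r (Equiv.swap 0 1 i)) : SymV (Zq p k) r →+ SymV (Zq p k) r' where
  toFun P := ⟨swapHom P.1, swapHom_mem hr P.2⟩
  map_zero' := Subtype.ext (map_zero swapHom)
  map_add' P Q := Subtype.ext (map_add swapHom P.1 Q.1)

variable (hr : ∀ i, r' i = r (Equiv.swap 0 1 i))

lemma symSwap_smul (c : Zq p k) (v : SymV (Zq p k) r) :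
    symSwap hr (c • v) = WittVector.frobenius c • symSwap hr v := by
  apply Subtype.ext
  change swapHom (c • v.1) = WittVector.frobenius c • swapHom v.1
  rw [MvPolynomial.smul_eq_C_mul, map_mul, swapHom_C, MvPolynomial.smul_eq_C_mul]

variable [Fintype k] (hcard : Fintype.card k = p ^ 2)

include hcard in
lemma frobenius_frobenius (x : Zq p k) :
    WittVector.frobenius (WittVector.frobenius x) = x := by
  ext n
  rw [WittVector.coeff_frobenius_charP, WittVector.coeff_frobenius_charP, ← pow_mul, ← sq, ← hcard,
    FiniteField.pow_card]

include hcard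

/-- The factor of index `1` carries one Frobenius twist. Twisting once more moves index `0` to index
`1`, and index `1` back to index `0` because the Frobenius has order dividing two when `q = p ^ 2`.
-/
lemma swapHom_substHom (m : Matrix (Fin 2) (Fin 2) (Zq p k))
    (P : MvPolynomial (Fin 2 × Fin 2) (Zq p k)) :
    swapHom (substHom (RingHom.id _) 2 m P) = substHom (RingHom.id _) 2 m (swapHom P) := by
  induction P using MvPolynomial.induction_on with
  | C a => simp [substHom, MvPolynomial.algebraMap_eq, swapHom_C]
  | add P Q hP hQ => simp only [map_add, hP, hQ]
  | mul_X P v hP =>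
    have h1 : swapHom (substHom (RingHom.id _) 2 m (MvPolynomial.X v))
        = substHom (RingHom.id _) 2 m (MvPolynomial.X (swapVar v)) := by
      obtain ⟨i, j⟩ := v
      simp only [substHom, MvPolynomial.aeval_X, map_sum, map_mul, swapHom_C, swapHom_X, swapVar,
        RingHom.id_apply]
      fin_cases i <;> simp [frobenius_frobenius hcard]
    rw [map_mul, map_mul, map_mul, map_mul, hP, swapHom_X, h1]

lemma symSwap_symRep (m : Matrix (Fin 2) (Fin 2) (Zq p k)) (v : SymV (Zq p k) r) :
    symSwap hr (symRep (RingHom.id _) r m v) = symRep (RingHom.id _) r' m (symSwap hr v) :=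
  Subtype.ext (swapHom_substHom hcard m v.1)

lemma swapHom_swapHom (P : MvPolynomial (Fin 2 × Fin 2) (Zq p k)) : swapHom (swapHom P) = P := by
  induction P using MvPolynomial.induction_on with
  | C a => rw [swapHom_C, swapHom_C, frobenius_frobenius hcard]
  | add P Q hP hQ => simp only [map_add, hP, hQ]
  | mul_X P v hP => rw [map_mul, map_mul, hP, swapHom_X, swapHom_X]; simp [swapVar]

lemma symSwap_surjective : Function.Surjective (symSwap (p := p) (k := k) hr) := fun v =>
  ⟨symSwap (r := r') (r' := r) (fun i => by rw [hr, Equiv.swap_apply_self]) v,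
    Subtype.ext (swapHom_swapHom hcard v.1)⟩

lemma cIndPost_symSwap_surjective : Function.Surjective
    (cIndPost (symSwap (p := p) (k := k) hr) (symSwap_symRep hr hcard)) := by
  intro φ
  induction φ using cInd_induction with
  | zero => exact ⟨0, map_zero _⟩
  | add φ ψ hφ hψ =>
    obtain ⟨φ', rfl⟩ := hφ
    obtain ⟨ψ', rfl⟩ := hψ
    exact ⟨φ' + ψ', map_add _ _ _⟩
  | basic g v =>
    obtain ⟨w, rfl⟩ := symSwap_surjective hr hcard v
    exact ⟨cIndRep _ r g (el _ r w), by rw [cIndPost_cIndRep, cIndPost_el]⟩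

namespace Reduction

variable {F V : Type} [Field F] [AddCommGroup V] [Module F V]
  {π : Representation F (GrpG p k) V} (D : Reduction r' π)

lemma cIndPost_symSwap_natCast_smul (n : ℕ) (φ : cInd (RingHom.id (Zq p k)) r) :
    cIndPost (symSwap hr) (symSwap_symRep hr hcard) ((p : Zq p k) ^ n • φ)
      = (p : Zq p k) ^ n • cIndPost (symSwap hr) (symSwap_symRep hr hcard) φ := by
  refine cIndPost_smul _ _ (fun v => ?_) φ
  have hf : WittVector.frobenius (p : Zq p k) = p := map_natCast _ p
  rw [symSwap_smul, map_pow, hf]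

/-- The reduction with the two tensor factors exchanged. -/
def swap : Reduction r π where
  red := D.red.comp (cIndPost (symSwap hr) (symSwap_symRep hr hcard))
  coeff := D.coeff.comp WittVector.frobenius
  smul c Ψ := by
    rw [AddMonoidHom.comp_apply, cIndPost_smul _ _ (symSwap_smul hr c), D.smul]
    rfl
  equivariant g Ψ := by
    rw [AddMonoidHom.comp_apply, cIndPost_cIndRep, D.equivariant]
    rfl
  span_eq_top := by
    rw [AddMonoidHom.coe_comp, (cIndPost_symSwap_surjective hr hcard).range_comp]
    exact D.span_eq_top
  eq_zero_of_hecke Ψ Ξ h := by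
    refine D.eq_zero_of_hecke _ (cIndPost (symSwap hr) (symSwap_symRep hr hcard) Ξ) ?_
    have h1 := cIndPost_symSwap_natCast_smul hr hcard 1 Ξ
    rw [pow_one] at h1
    rw [← cIndPost_hecke, h, h1]
  red_hecke Ψ := by
    rw [AddMonoidHom.comp_apply, cIndPost_hecke, D.red_hecke]
  eq_zero_of_hecke_sq Ψ Z Ω h := by
    refine D.eq_zero_of_hecke_sq _ (cIndPost (symSwap hr) (symSwap_symRep hr hcard) Z)
      (cIndPost (symSwap hr) (symSwap_symRep hr hcard) Ω) ?_
    have h1 := cIndPost_symSwap_natCast_smul hr hcard 1 Z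
    rw [pow_one] at h1
    rw [← cIndPost_hecke, ← h1, ← map_sub, ← cIndPost_hecke, h,
      cIndPost_symSwap_natCast_smul hr hcard]

lemma swap_isSteep (hD : D.IsSteep) : (D.swap hr hcard).IsSteep := by
  intro Ψ Ξ Ω h
  refine hD (cIndPost (symSwap hr) (symSwap_symRep hr hcard) Ψ)
    (cIndPost (symSwap hr) (symSwap_symRep hr hcard) Ξ) _ ?_
  have h1 : ∀ Ξ, _ := cIndPost_symSwap_natCast_smul hr hcard 1
  simp only [pow_one] at h1
  rw [← cIndPost_hecke, ← h1, ← map_sub, ← cIndPost_hecke, h, h1]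

end Reduction

end Swap

/-! ### The filtration in the three families of cases -/

section Filtration

variable {p : ℕ} [Fact p.Prime] {k : Type} [Field k] [CharP k p] [Fintype k] {r : Fin 2 → ℕ}
  {F V : Type} [Field F] [CharP F p] [AddCommGroup V] [Module F V]
  {π : Representation F (GrpG p k) V}

lemma irredQuotientsSupercuspidal_of_subsingleton [Subsingleton V] :
    IrredQuotientsSupercuspidal π := fun W hW =>
  absurd (map_zero _) (mk_ne_zero_of_irreducible (v := (0 : V))
    (fun _ _ => Subsingleton.elim _ _) W hW)

namespace Reduction

variable (D : Reduction r π) (hr : ∀ i, p ^ 2 + p - 2 < r i) (hcard : Fintype.card k = p ^ 2)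
  (hp : 2 < p)

include D hr hcard hp

theorem exists_filtration_of_dvd (hN : Fintype.card k - 1 ∣ r 0 + p * r 1) :
    ∃ W : Subrepresentation π,
      IrredQuotientsSupercuspidal (V := W.toSubmodule) W.toRepresentation ∧
      IrredQuotientsSupercuspidal (quotRep π W) := by
  -- The spherical vector generates everything, so the lower step can be zero.
  refine ⟨⊥, ?_, D.irredQuotientsSupercuspidal_of_dvd hr hcard hp hN ⊥⟩
  have : Subsingleton (⊥ : Subrepresentation π).toSubmodule :=
    inferInstanceAs (Subsingleton (⊥ : Submodule F V))
  exact irredQuotientsSupercuspidal_of_subsingleton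

theorem exists_filtration_of_isSteep (hD : D.IsSteep) {c : ℕ} (hc : 0 < c) (hcp : c ≤ p - 1)
    (hN : r 0 + p * r 1 ≡ c [MOD p ^ 2 - 1]) (hr1 : ¬ p ∣ r 1) (h0 : c = 1 → p ∣ r 0) :
    ∃ W : Subrepresentation π,
      IrredQuotientsSupercuspidal (V := W.toSubmodule) W.toRepresentation ∧
      IrredQuotientsSupercuspidal (quotRep π W) := by
  rw [← hcard] at hN
  exact ⟨_, D.irredQuotientsSupercuspidal_genSub hc hcp hN hr hcard hp hD hr1 h0,
    D.irredQuotientsSupercuspidal_quotRep_genSub hc hcp hN hr hcard hp h0⟩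

theorem exists_filtration_of_isSteep_swap (hD : D.IsSteep) {c : ℕ} (hc : 0 < c) (hcp : c ≤ p - 1)
    (hN : r 0 + p * r 1 ≡ c * p [MOD p ^ 2 - 1]) (hr0 : ¬ p ∣ r 0) (h1 : c = 1 → p ∣ r 1) :
    ∃ W : Subrepresentation π,
      IrredQuotientsSupercuspidal (V := W.toSubmodule) W.toRepresentation ∧
      IrredQuotientsSupercuspidal (quotRep π W) := by
  have hs : ∀ i, r i = (fun i => r (Equiv.swap 0 1 i)) (Equiv.swap 0 1 i) := fun i => by
    simp only [Equiv.swap_apply_self]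
  have hp2 : p * p ≡ 1 [MOD p ^ 2 - 1] := by
    rw [← sq]
    exact ((Nat.modEq_iff_dvd' (by nlinarith)).mpr dvd_rfl).symm
  refine (D.swap hs hcard).exists_filtration_of_isSteep (fun i => hr _) hcard hp
    (D.swap_isSteep hs hcard hD) hc hcp ?_ (by simpa using hr0) (by simpa using h1)
  -- Multiplying by `p` and using `p² ≡ 1` turns `r_0 + p r_1 ≡ c p` into `r_1 + p r_0 ≡ c`.
  have h2 := (hN.mul_left p).trans ((show p * (c * p) = c * (p * p) by ring) ▸ hp2.mul_left c)
  rw [mul_one, mul_add, ← mul_assoc] at h2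
  have h3 := ((hp2.mul_right (r 1)).add_left (p * r 0)).symm.trans h2
  rw [one_mul, add_comm] at h3
  simpa using h3

end Reduction

end Filtration

/-! ### Norms on `ℚ̄_p` and the residue field -/

section Padic

variable {p : ℕ} [Fact p.Prime]

lemma algebraMap_Fpbar_eq_zero {x : Zpbar p} (hx : ‖(x : PadicAlgCl p)‖ < 1) :
    algebraMap (Zpbar p) (Fpbar p) x = 0 := by
  change IsLocalRing.residue (Zpbar p) x = 0
  rw [IsLocalRing.residue_eq_zero_iff, IsLocalRing.mem_maximalIdeal, mem_nonunits_iff]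
  intro h
  obtain ⟨y, hy⟩ := h.exists_right_inv
  have h1 : ‖(x : PadicAlgCl p)‖ * ‖(y : PadicAlgCl p)‖ = 1 := by
    rw [← norm_mul]
    have := congrArg (fun z : Zpbar p => ‖(z : PadicAlgCl p)‖) hy
    simpa using this
  have h2 : ‖(y : PadicAlgCl p)‖ ≤ 1 := y.2
  nlinarith [norm_nonneg (x : PadicAlgCl p), norm_nonneg (y : PadicAlgCl p)]

lemma mem_Zpbar {x : PadicAlgCl p} (hx : ‖x‖ ≤ 1) : x ∈ Zpbar p := hx

lemma norm_natCast_p : ‖(p : PadicAlgCl p)‖ = (p : ℝ)⁻¹ := by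
  have h := PadicAlgCl.valuation_p p
  rw [← PadicAlgCl.valuation_coe, h]
  simp

instance : CharP (Fpbar p) p := by
  have hp : p.Prime := Fact.out
  rw [CharP.charP_iff_prime_eq_zero hp]
  have h := algebraMap_Fpbar_eq_zero (p := p) (x := (p : Zpbar p)) (by
    rw [SubringClass.coe_natCast, norm_natCast_p]
    exact inv_lt_one_of_one_lt₀ (by exact_mod_cast hp.one_lt))
  rwa [map_natCast] at h

lemma norm_eq_rpow_padicSlope {a : PadicAlgCl p} (ha : a ≠ 0) :
    ‖a‖ = (p : ℝ) ^ (-padicSlope a) := by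
  have hp : p.Prime := Fact.out
  rw [padicSlope, neg_neg, Real.rpow_logb (by exact_mod_cast hp.pos)
    (by exact_mod_cast hp.one_lt.ne') (norm_pos_iff.mpr ha)]

lemma ne_zero_of_padicSlope_pos {a : PadicAlgCl p} (ha : 0 < padicSlope a) : a ≠ 0 := by
  rintro rfl
  simp [padicSlope] at ha

end Padic

end GL2Red
end

open GL2Red in
theorem mainTheorem8 (p : ℕ) [Fact p.Prime] (hp : 2 < p)
    (ι : GL2Red.Zq p (GaloisField p 2) →+* GL2Red.Zpbar p)
    (r : Fin 2 → ℕ) (hr : ∀ i, p ^ 2 + p - 2 < r i)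
    (a : PadicAlgCl p) (ha : 0 < GL2Red.padicSlope a ∧ GL2Red.padicSlope a < 1)
    (hcond :
      r 0 + p * r 1 ≡ 0 [MOD p ^ 2 - 1] ∨
      (1 / 2 < GL2Red.padicSlope a ∧
        ((r 0 + p * r 1 ≡ 1 [MOD p ^ 2 - 1] ∧ ¬ p ∣ r 1 ∧ p ∣ r 0) ∨
         (∃ c ∈ Finset.Icc 2 (p - 1), r 0 + p * r 1 ≡ c [MOD p ^ 2 - 1] ∧ ¬ p ∣ r 1) ∨
         (r 0 + p * r 1 ≡ p [MOD p ^ 2 - 1] ∧ ¬ p ∣ r 0 ∧ p ∣ r 1) ∨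
         (∃ c ∈ Finset.Icc 2 (p - 1), r 0 + p * r 1 ≡ c * p [MOD p ^ 2 - 1] ∧ ¬ p ∣ r 0)))) :
    ∃ W : Subrepresentation (GL2Red.thetaBarRep (PadicAlgCl p) (GL2Red.Fpbar p) ι r a),
      GL2Red.IrredQuotientsSupercuspidal (V := W.toSubmodule) W.toRepresentation ∧
      GL2Red.IrredQuotientsSupercuspidal
        (GL2Red.quotRep (GL2Red.thetaBarRep (PadicAlgCl p) (GL2Red.Fpbar p) ι r a) W) := by
  have : Fintype (GaloisField p 2) := Fintype.ofFinite _
  have hcard : Fintype.card (GaloisField p 2) = p ^ 2 := by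
    rw [← Nat.card_eq_fintype_card, GaloisField.card p 2 two_ne_zero]
  have hp1 : (1 : ℝ) < p := by exact_mod_cast (by omega : 1 < p)
  have hp0 : (0 : ℝ) < p := by linarith
  have ha0 : a ≠ 0 := ne_zero_of_padicSlope_pos ha.1
  have hnorm := norm_eq_rpow_padicSlope ha0
  have hlt : ‖a‖ < 1 := by
    rw [hnorm]
    exact Real.rpow_lt_one_of_one_lt_of_neg hp1 (by linarith)
  have hgt : (p : ℝ)⁻¹ < ‖a‖ := by
    rw [hnorm, ← Real.rpow_neg_one]
    exact Real.rpow_lt_rpow_of_exponent_lt hp1 (by linarith)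
  have hpE : (p : PadicAlgCl p) ≠ 0 := by
    rw [← norm_pos_iff, norm_natCast_p]
    positivity
  -- The element `c = p / a` lies in the maximal ideal because `v(a) < 1`.
  have hc1 : ‖(p : PadicAlgCl p) / a‖ < 1 := by
    rw [norm_div, norm_natCast_p, div_lt_one (norm_pos_iff.mpr ha0)]
    exact hgt
  obtain ⟨a', rfl⟩ : ∃ a' : Zpbar p, algebraMap (Zpbar p) (PadicAlgCl p) a' = a :=
    ⟨⟨a, mem_Zpbar hlt.le⟩, rfl⟩
  obtain ⟨c, hc⟩ : ∃ c : Zpbar p, (c : PadicAlgCl p) = p / algebraMap _ (PadicAlgCl p) a' :=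
    ⟨⟨_, mem_Zpbar hc1.le⟩, rfl⟩
  rw [← hc] at hc1
  have hac : (p : Zpbar p) = a' * c := Subtype.ext (by
    rw [MulMemClass.coe_mul, hc]
    exact (mul_div_cancel₀ _ ha0).symm)
  let D := thetaReduction (E := PadicAlgCl p) (F := Fpbar p) ι r (a := a') (c := c) ha0
    (algebraMap_Fpbar_eq_zero hlt) (algebraMap_Fpbar_eq_zero hc1) hac
  rcases hcond with h | ⟨hs, h⟩
  · exact D.exists_filtration_of_dvd hr hcard hp (by rw [hcard]; exact (Nat.modEq_zero_iff_dvd).mp h)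
  -- The element `c' = a² / p` lies in the maximal ideal exactly because `v(a) > 1/2`.
  have hsq : ‖algebraMap _ (PadicAlgCl p) a' ^ 2 / (p : PadicAlgCl p)‖ < 1 := by
    rw [norm_div, norm_natCast_p, norm_pow, div_lt_one (by positivity), hnorm, ← Real.rpow_natCast,
      ← Real.rpow_mul hp0.le, ← Real.rpow_neg_one]
    refine Real.rpow_lt_rpow_of_exponent_lt hp1 ?_
    push_cast
    linarith
  obtain ⟨c', hc'⟩ : ∃ c' : Zpbar p, (c' : PadicAlgCl p)
      = algebraMap _ (PadicAlgCl p) a' ^ 2 / p := ⟨⟨_, mem_Zpbar hsq.le⟩, rfl⟩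
  rw [← hc'] at hsq
  have hac' : a' ^ 2 = p * c' := Subtype.ext (by
    rw [MulMemClass.coe_mul, hc']
    exact (mul_div_cancel₀ _ hpE).symm)
  have hD : D.IsSteep := thetaReduction_isSteep ι r ha0 (algebraMap_Fpbar_eq_zero hlt)
    (algebraMap_Fpbar_eq_zero hc1) hac (algebraMap_Fpbar_eq_zero hsq) hac'
    (by rwa [map_natCast])
  rcases h with ⟨h, h1, h0⟩ | ⟨c, hc, h, h1⟩ | ⟨h, h0, h1⟩ | ⟨c, hc, h, h0⟩
  · exact D.exists_filtration_of_isSteep hr hcard hp hD one_pos (by omega) h h1 fun _ => h0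
  · have := Finset.mem_Icc.mp hc
    exact D.exists_filtration_of_isSteep hr hcard hp hD (by omega) (by omega) h h1
      fun h => absurd h (by omega)
  · exact D.exists_filtration_of_isSteep_swap hr hcard hp hD one_pos (by omega)
      (by rwa [one_mul]) h0 fun _ => h1
  · have := Finset.mem_Icc.mp hc
    exact D.exists_filtration_of_isSteep_swap hr hcard hp hD (by omega) (by omega) h h0
      fun h => absurd h (by omega)
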